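/- **Setting.** There are $M\ge 2$ arms with coefficient vectors $\alpha_1,\dots,\alpha_M\in\mathbb R^p$. In period $t$ the agent observes covariates $v_t\in\mathbb R^p$ and instruments $z_t\in\mathbb R^q$, pulls an arm $a_t$ and receives $R_t=v_t^\intercal\alpha_{a_t}+\epsilon_t$. The draws $(v_t,z_t,\epsilon_t)$ are i.i.d. in $t$. Put $\delta_{i,j}=\alpha_i-\alpha_j$, let $a_t^*$ be the arm with $v_t^\intercal\delta_{a^*_t,j}>0$ for all $j\ne a_t^*$, let $v_t^*\in\mathbb R^{Mp}$ have blocks $\mathbb 1(a_t^*=i)v_t$, $\Sigma^*_{vz}=\mathbb E[v_t^*z_t^\intercal]$, $\Sigma_{zz}=\mathbb E[z_tz_t^\intercal]$. **Assumptions.** $q\ge Mp$; $\mathbb E[\epsilon_t]=0$ and $\epsilon_t$ is sub-Gaussian with variance proxy $\varsigma^2$; $\mathbb E[z_t\epsilon_t]=0$ and $\mathrm{Var}(\epsilon_t)=\sigma^2$; $\|z_t\|_\infty\le\bar z$ and $\|v_t\|_\infty\le\bar v$ a.s. with $\bar v,\bar z>0$; $\Sigma^*_{vz}$ has full rank and $\Sigma_{zz}$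 is positive definite; there is $L>0$ with $\Pr(|v_t^\intercal\delta_{i,j}|\le c)\le Lc$ for all $c>0$, $i\ne j$. **Algorithm (IV-UCB, $\theta>0$, integers $0\le T_1\le T_2<T$).** For data matrices $V,Z$ and a reward vector $R$ put $\mathcal P[Z]=Z(Z^\intercal Z)^{-1}Z^\intercal$, $\Omega=(V^\intercal\mathcal P[Z]V)^{-1}$; the 2SLS estimate is $\Omega V^\intercal\mathcal P[Z]R$. Periods $1,\dots,T_1$: arms are pulled uniformly at random, independently of each other and of the data; then 2SLS run separately on the data of each arm $i$ gives $\widehat\alpha_{i,T_1}$ and $\Omega_i$. Periods $T_1+1,\dots,T_2$: $a_t$ maximizes $v_t^\intercal\widehat\alpha_{i,T_1}$. Put $\widehat\alpha_{i,T_2}=\widehat\alpha_{i,T_1}$, $\widehat\Omega_{i,T_2}=\Omega_i$, $\widehat\sigma_{T_2}^2=T_1^{-1}\sum_{s\le T_1}(R_s-v_s^\intercal\widehat\alpha_{a_s,T_1})^2$. Periods $t=T_2+1,\dots,T$: $a_t$ maximizes $$v_t^\intercal\widehat\alpha_{i,t-1}+\widehat\sigma_{t-1}\sqrt{2\theta\log(t-T_1)\,v_t^\intercal\widehat\Omega_{i,t-1}v_t},$$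 and then 2SLS on the periods $T_1+1,\dots,t$ with regressors $\widetilde v_s=(\mathbb 1(a_s=1)v_s,\dots,\mathbb 1(a_s=M)v_s)$, instruments $z_s$ and rewards $R_s$ gives $\widehat\alpha_t=(\widehat\alpha_{1,t},\dots,\widehat\alpha_{M,t})$ and $\widehat\Omega_t$ with $i$-th diagonal $p\times p$ block $\widehat\Omega_{i,t}$, and $\widehat\sigma_t^2=(t-T_1)^{-1}\sum_{s=T_1+1}^t(R_s-\widetilde v_s^\intercal\widehat\alpha_t)^2$. Ties may be broken in any measurable way. The regret is $\mathsf{Regret}(T)=\sum_{t=1}^T\mathbb E[v_t^\intercal(\alpha_{a_t^*}-\alpha_{a_t})]$. **Constants.** Let $\phi_{\max},\phi_{\min}$ denote the largest and smallest singular values, let $\breve\Sigma_{vz}=\mathbb E[\widetilde v\,\widetilde z^\intercal]$ and $\breve\Sigma_{zz}=\mathbb E[\widetilde z\,\widetilde z^\intercal]$, where $\widetilde v,\widetilde z$ have blocks $\mathbb 1(a=i)v$, $\mathbb 1(a=i)z$ with $a$ uniform and independent of $(v,z)$, and put $$\breve\kappa=\frac{2\phi_{\max}(\breve\Sigma_{vz})\phi_{\max}(\breve\Sigma_{zz})}{\phi_{\min}(\breve\Sigma_{vz})^2\phi_{\min}(\breve\Sigma_{zz})},\quad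 \bar\kappa=\frac{2\phi_{\max}(\Sigma^*_{vz})\phi_{\max}(\Sigma_{zz})}{\phi_{\min}(\Sigma^*_{vz})^2\phi_{\min}(\Sigma_{zz})},\quad \mathring\kappa=\frac{2\phi_{\max}(\Sigma_{zz})}{\phi_{\min}(\Sigma^*_{vz})^2},\quad\bar\delta=\max_{i\ne j}\|\delta_{i,j}\|,$$ $K_\epsilon=\inf\{w>0:\mathbb E\,e^{|\epsilon_t^2-\sigma^2|/w}\le 2\}$. Call $L^\circ$ an *optimal-arm margin constant* if $\mathbb E\,\#\{j\ne a_t^*: |v_t^\intercal\delta_{j,a_t^*}|\le c\}\le (M-1)L^\circ c$ for all $c>0$. **Theorem.** Under these assumptions, with $\theta>0$: 1. If $C_{1},C_{2}$ are sufficiently large constants and $T_1=C_1\log T$, $T_2=(C_1+C_2)\log T$ up to rounding to an integer, then $\mathsf{Regret}(T)=\mathcal O(\log^2T)$ for all $T>T_2$, $T\ge2$. 2. There is an absolute constant $\mathsf C>0$ with the following property. Let $L^\circ$ be an optimal-arm margin constant, $\Delta>0$, $0<\eta\le\frac1{10}\min\{\phi_{\min}(\Sigma^*_{vz}),\phi_{\min}(\Sigma_{zz})\}$,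 $C_A\ge 2q\bar z\varsigma\bar\kappa$, $\Gamma=C_A+\sqrt{\theta\mathring\kappa(\sigma^2+\Delta)}$, $$C_1\ge\max\Big\{\Big(\tfrac{40M\max\{\sqrt{pq}\bar v\bar z,\,q\bar z^2\}}{\min\{\phi_{\min}(\breve\Sigma_{vz}),\phi_{\min}(\breve\Sigma_{zz})\}}\Big)^2,\ 1024M^4p^2q^3\bar v^4\bar z^4\varsigma^2\breve\kappa^2(L^\circ)^2\eta^{-2}\Big\},$$ $$C_2\ge\max\Big\{\tfrac{3}{\mathsf C\min\{\frac{\Delta^2}{4K_\epsilon^2},\frac{\Delta}{2K_\epsilon}\}},\ \tfrac{6Mpq^2\bar v^2\bar z^2\varsigma^2\bar\kappa^2}{\min\{\frac{\Delta^2}{128\sigma^2},\frac{\Delta}{64}\}},\ 6q^2\bar z^4\eta^{-2},\ 128(M-1)^2pq\bar v^2\bar z^2\eta^{-2},\ 256M^2(L^\circ)^2p^2q\bar v^4\bar z^2\Gamma^2\eta^{-2}\Big\}.$$ If $T_1\ge C_1\log T$, $T_2-T_1\ge C_2\log T$ and $T>T_2$, then $$\mathsf{Regret}(T)\le 4L^\circ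 p\bar v^2(M-1)\Gamma^2\log^2T+\sqrt p\,\bar v\bar\delta\,T_2+\sqrt p\,\bar v\bar\delta\big[(M-1)(24Mp+(40M+48)q+16)+1\big];$$ for $T_1=C_1\log T$, $T_2=(C_1+C_2)\log T$ the middle term is $\sqrt p\,\bar v\bar\delta(C_1+C_2)\log T$. 3. $L^\circ=ML/2$ is always an optimal-arm margin constant; in particular, for two arms one may take $L^\circ=L$. -/

import Mathlib

open MeasureTheory ProbabilityTheory Matrix
open scoped NNReal ENNReal

noncomputable section

/-! ### Singular values and norms -/

/-- `s` is a singular value of the real matrix `A`: `s ≥ 0` and `s ^ 2` is an eigenvalue of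
`Aᵀ * A` if `A` has at least as many rows as columns, and of `A * Aᵀ` otherwise. -/
def IsSingularValue {m n : Type*} [Fintype m] [DecidableEq m] [Fintype n] [DecidableEq n]
    (A : Matrix m n ℝ) (s : ℝ) : Prop :=
  0 ≤ s ∧
    (Fintype.card n ≤ Fintype.card m →
      Module.End.HasEigenvalue (Matrix.toLin' (Aᵀ * A)) (s ^ 2)) ∧
    (Fintype.card m < Fintype.card n →
      Module.End.HasEigenvalue (Matrix.toLin' (A * Aᵀ)) (s ^ 2))

/-- The largest singular value. -/
def phiMax {m n : Type*} [Fintype m] [DecidableEq m] [Fintype n] [DecidableEq n]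
    (A : Matrix m n ℝ) : ℝ :=
  sSup {s : ℝ | IsSingularValue A s}

/-- The smallest singular value. -/
def phiMin {m n : Type*} [Fintype m] [DecidableEq m] [Fintype n] [DecidableEq n]
    (A : Matrix m n ℝ) : ℝ :=
  sInf {s : ℝ | IsSingularValue A s}

/-- The sub-exponential norm `inf {w > 0 : E exp (|Y| / w) ≤ 2}`. -/
def psiOneNorm {S : Type*} [MeasurableSpace S] (Y : S → ℝ) (ν : Measure S) : ℝ :=
  sInf {w : ℝ | 0 < w ∧ ∫⁻ x, ENNReal.ofReal (Real.exp (|Y x| / w)) ∂ν ≤ 2}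

/-! ### The bandit model -/

/-- One period's draw `(v, z, ε)`: covariates, instrumental variables, noise. -/
abbrev Obs (p q : ℕ) : Type := (Fin p → ℝ) × (Fin q → ℝ) × ℝ

/-- A linear contextual bandit with `M` arms, `p` covariates and `q` instrumental variables:
the common law of the draws `(v_t, z_t, ε_t)`, the arm coefficients `α_i`, and the constants
(variance proxy `ς ^ 2`, sup-norm bounds for covariates and instruments, margin constant). -/
structure IVModel (M p q : ℕ) where
  /-- the law of `(v_t, z_t, ε_t)` -/
  law : Measure (Obs p q)
  /-- the coefficients of the arms -/
  α : Fin M → Fin p → ℝ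
  /-- the square root of the variance proxy of the noise -/
  ς : ℝ≥0
  /-- the bound for the covariates -/
  vbar : ℝ
  /-- the bound for the instruments -/
  zbar : ℝ
  /-- the margin constant -/
  L : ℝ

namespace IVModel

variable {M p q : ℕ} (P : IVModel M p q)

/-- `i` is the (unique) optimal arm for the covariate vector `v`:
`min_{j ≠ i} vᵀ (α_i - α_j) > 0`. -/
def IsOptArm (v : Fin p → ℝ) (i : Fin M) : Prop :=
  ∀ j, j ≠ i → 0 < v ⬝ᵥ (P.α i - P.α j)

open Classical in
/-- `v*`: the stacked vector with blocks `1(a* = i) v`. -/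
def vStar (v : Fin p → ℝ) : Fin M × Fin p → ℝ :=
  fun ik => if P.IsOptArm v ik.1 then v ik.2 else 0

/-- `Σ*_vz = E[v* zᵀ]`. -/
def SigmaVZStar : Matrix (Fin M × Fin p) (Fin q) ℝ :=
  Matrix.of fun ik l => ∫ x, P.vStar x.1 ik * x.2.1 l ∂P.law

/-- `Σ_zz = E[z zᵀ]`. -/
def SigmaZZ : Matrix (Fin q) (Fin q) ℝ :=
  Matrix.of fun k l => ∫ x, x.2.1 k * x.2.1 l ∂P.law

/-- `E[ṽ z̃ᵀ]` for an arm drawn uniformly, independently of `(v, z)`, where `ṽ` and `z̃` are the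
stacked vectors with blocks `1(a = i) v` and `1(a = i) z`. -/
def SigmaVZBreve : Matrix (Fin M × Fin p) (Fin M × Fin q) ℝ :=
  Matrix.of fun ik jl => (M : ℝ)⁻¹ * ∑ m : Fin M,
    ∫ x, (if m = ik.1 then x.1 ik.2 else 0) * (if m = jl.1 then x.2.1 jl.2 else 0) ∂P.law

/-- `E[z̃ z̃ᵀ]` for an arm drawn uniformly, independently of `z`. -/
def SigmaZZBreve : Matrix (Fin M × Fin q) (Fin M × Fin q) ℝ :=
  Matrix.of fun ik jl => (M : ℝ)⁻¹ * ∑ m : Fin M,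
    ∫ x, (if m = ik.1 then x.2.1 ik.2 else 0) * (if m = jl.1 then x.2.1 jl.2 else 0) ∂P.law

/-- The noise variance `σ ^ 2`. -/
def sigmaSq : ℝ := variance (fun x => x.2.2) P.law

/-- `K_ε`, the sub-exponential norm of `ε ^ 2 - σ ^ 2`. -/
def Keps : ℝ := psiOneNorm (fun x => x.2.2 ^ 2 - P.sigmaSq) P.law

/-- The standing assumptions on the bandit model. -/
structure Assumption : Prop where
  prob : IsProbabilityMeasure P.law
  enough_iv : M * p ≤ q
  noise_mean : ∫ x, x.2.2 ∂P.law = 0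
  noise_subG : HasSubgaussianMGF (fun x => x.2.2 - ∫ y, y.2.2 ∂P.law) (P.ς ^ 2) P.law
  valid_iv : ∀ l, ∫ x, x.2.1 l * x.2.2 ∂P.law = 0
  vbar_pos : 0 < P.vbar
  zbar_pos : 0 < P.zbar
  z_bdd : ∀ᵐ x ∂P.law, ∀ l, |x.2.1 l| ≤ P.zbar
  v_bdd : ∀ᵐ x ∂P.law, ∀ k, |x.1 k| ≤ P.vbar
  full_rank : P.SigmaVZStar.rank = M * p
  posDef : P.SigmaZZ.PosDef
  L_pos : 0 < P.L
  margin : ∀ c : ℝ, 0 < c → ∀ i j, i ≠ j →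
    P.law.real {x | |x.1 ⬝ᵥ (P.α i - P.α j)| ≤ c} ≤ P.L * c

/-- `Lo` bounds the average margin at the optimal arm: for all `c > 0`, the expected number of
arms `j ≠ a*` with `|vᵀ (α_j - α_{a*})| ≤ c` is at most `(M - 1) * Lo * c`. -/
def IsOptMargin (Lo : ℝ) : Prop :=
  ∀ c : ℝ, 0 < c →
    ∑ i, ∑ j ∈ Finset.univ.erase i,
        P.law.real {x | P.IsOptArm x.1 i ∧ |x.1 ⬝ᵥ (P.α j - P.α i)| ≤ c}
      ≤ ((M : ℝ) - 1) * Lo * c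

/-- `κ̆`. -/
def kappaBreve : ℝ :=
  2 * phiMax P.SigmaVZBreve * phiMax P.SigmaZZBreve /
    (phiMin P.SigmaVZBreve ^ 2 * phiMin P.SigmaZZBreve)

/-- `κ̄`. -/
def kappaBar : ℝ :=
  2 * phiMax P.SigmaVZStar * phiMax P.SigmaZZ / (phiMin P.SigmaVZStar ^ 2 * phiMin P.SigmaZZ)

/-- `κ̊`. -/
def kappaRing : ℝ := 2 * phiMax P.SigmaZZ / phiMin P.SigmaVZStar ^ 2

/-- `δ̄`, the largest Euclidean distance between the coefficient vectors of two arms. -/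
def deltaBar : ℝ := ⨆ ij : Fin M × Fin M, ‖WithLp.toLp 2 (P.α ij.1 - P.α ij.2)‖

/-- The factor `C_A + √(θ κ̊ (σ² + Δ))`. -/
def ucbFactor (θ CA Δ : ℝ) : ℝ := CA + √(θ * P.kappaRing * (P.sigmaSq + Δ))

/-- The requirements on the constants. The lower bounds for `C2` that involve the minimum of two
terms in a denominator are split into two lower bounds, one for each term. -/
structure ConstantsOK (θ cB Lo CA η Δ C1 C2 : ℝ) : Prop where
  η_pos : 0 < η
  η_le : η ≤ 1 / 10 * min (phiMin P.SigmaVZStar) (phiMin P.SigmaZZ)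
  Δ_pos : 0 < Δ
  CA_ge : 2 * q * P.zbar * P.ς * P.kappaBar ≤ CA
  C1_ge₁ : (40 * M * max (√(p * q) * P.vbar * P.zbar) (q * P.zbar ^ 2) /
    min (phiMin P.SigmaVZBreve) (phiMin P.SigmaZZBreve)) ^ 2 ≤ C1
  C1_ge₂ : 1024 * M ^ 4 * p ^ 2 * q ^ 3 * P.vbar ^ 4 * P.zbar ^ 4 * P.ς ^ 2 *
    P.kappaBreve ^ 2 * Lo ^ 2 / η ^ 2 ≤ C1
  C2_ge₁ : 3 * (4 * P.Keps ^ 2) / (cB * Δ ^ 2) ≤ C2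
  C2_ge₂ : 3 * (2 * P.Keps) / (cB * Δ) ≤ C2
  C2_ge₃ : 6 * M * p * q ^ 2 * P.vbar ^ 2 * P.zbar ^ 2 * P.ς ^ 2 * P.kappaBar ^ 2 *
    (128 * P.sigmaSq) / Δ ^ 2 ≤ C2
  C2_ge₄ : 6 * M * p * q ^ 2 * P.vbar ^ 2 * P.zbar ^ 2 * P.ς ^ 2 * P.kappaBar ^ 2 *
    64 / Δ ≤ C2
  C2_ge₅ : 6 * q ^ 2 * P.zbar ^ 4 / η ^ 2 ≤ C2
  C2_ge₆ : 128 * ((M : ℝ) - 1) ^ 2 * p * q * P.vbar ^ 2 * P.zbar ^ 2 / η ^ 2 ≤ C2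
  C2_ge₇ : 256 * M ^ 2 * Lo ^ 2 * p ^ 2 * q * P.vbar ^ 4 * P.zbar ^ 2 *
    P.ucbFactor θ CA Δ ^ 2 / η ^ 2 ≤ C2

end IVModel

/-! ### Two-stage least squares -/

section TwoSLS

variable {n m r : Type*} [Fintype n] [DecidableEq n] [Fintype m] [DecidableEq m]
  [Fintype r] [DecidableEq r]

/-- `𝒫[Z] = Z (Zᵀ Z)⁻¹ Zᵀ`. -/
def projOp (Z : Matrix n r ℝ) : Matrix n n ℝ := Z * (Zᵀ * Z)⁻¹ * Zᵀ

/-- `(Vᵀ 𝒫[Z] V)⁻¹`. -/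
def omega2SLS (V : Matrix n m ℝ) (Z : Matrix n r ℝ) : Matrix m m ℝ := (Vᵀ * projOp Z * V)⁻¹

/-- The 2SLS estimate `(Vᵀ 𝒫[Z] V)⁻¹ Vᵀ 𝒫[Z] R`. -/
def coef2SLS (V : Matrix n m ℝ) (Z : Matrix n r ℝ) (R : n → ℝ) : m → ℝ :=
  (omega2SLS V Z * Vᵀ * projOp Z) *ᵥ R

end TwoSLS

/-! ### The algorithm -/

/-- What the agent has observed: covariates, instruments, pulled arms and rewards, by period. -/
structure History (M p q : ℕ) where
  /-- covariates -/
  v : ℕ → Fin p → ℝ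
  /-- instruments -/
  z : ℕ → Fin q → ℝ
  /-- pulled arms -/
  arm : ℕ → Fin M
  /-- rewards -/
  R : ℕ → ℝ

namespace History

variable {M p q : ℕ} (h : History M p q)

/-- The periods `s ∈ {1, …, t}` in which arm `i` is pulled. -/
def armPeriods (i : Fin M) (t : ℕ) : Finset ℕ := {s ∈ Finset.Icc 1 t | h.arm s = i}

/-- The covariates of the periods in `S`, as rows. -/
def rowsV (S : Finset ℕ) : Matrix S (Fin p) ℝ := Matrix.of fun s k => h.v s k

/-- The instruments of the periods in `S`, as rows. -/
def rowsZ (S : Finset ℕ) : Matrix S (Fin q) ℝ := Matrix.of fun s l => h.z s l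

/-- The rewards of the periods in `S`. -/
def rowsR (S : Finset ℕ) : S → ℝ := fun s => h.R s

/-- The stacked vectors `ṽ_s` with blocks `1(a_s = i) v_s` of the periods in `S`, as rows. -/
def rowsVTilde (S : Finset ℕ) : Matrix S (Fin M × Fin p) ℝ :=
  Matrix.of fun s ik => if h.arm s = ik.1 then h.v s ik.2 else 0

/-- Arm-specific 2SLS on the periods `1, …, t`: coefficients of arm `i`. -/
def armCoef (i : Fin M) (t : ℕ) : Fin p → ℝ :=
  coef2SLS (h.rowsV (h.armPeriods i t)) (h.rowsZ (h.armPeriods i t)) (h.rowsR (h.armPeriods i t))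

/-- Arm-specific 2SLS on the periods `1, …, t`: the matrix `(Vᵀ 𝒫[Z] V)⁻¹` of arm `i`. -/
def armOmega (i : Fin M) (t : ℕ) : Matrix (Fin p) (Fin p) ℝ :=
  omega2SLS (h.rowsV (h.armPeriods i t)) (h.rowsZ (h.armPeriods i t))

/-- Joint 2SLS on the periods `T1 + 1, …, t`: the stacked coefficients. -/
def jointCoef (T1 t : ℕ) : Fin M × Fin p → ℝ :=
  coef2SLS (h.rowsVTilde (Finset.Ioc T1 t)) (h.rowsZ (Finset.Ioc T1 t))
    (h.rowsR (Finset.Ioc T1 t))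

/-- Joint 2SLS on the periods `T1 + 1, …, t`: the matrix `(Ṽᵀ 𝒫[Z] Ṽ)⁻¹`. -/
def jointOmega (T1 t : ℕ) : Matrix (Fin M × Fin p) (Fin M × Fin p) ℝ :=
  omega2SLS (h.rowsVTilde (Finset.Ioc T1 t)) (h.rowsZ (Finset.Ioc T1 t))

/-- The coefficient estimate of arm `i` after period `t ≥ T2`: the arm-specific estimate of
Phase 1 for `t = T2`, the joint estimate for `t > T2`. -/
def alphaHat (T1 T2 t : ℕ) (i : Fin M) : Fin p → ℝ :=
  if t ≤ T2 then h.armCoef i T1 else fun k => h.jointCoef T1 t (i, k)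

/-- The matrix estimate `Ω̂_{i,t}` for `t ≥ T2`; for `t > T2` it is the `i`-th diagonal block of
the joint matrix. -/
def omegaHat (T1 T2 t : ℕ) (i : Fin M) : Matrix (Fin p) (Fin p) ℝ :=
  if t ≤ T2 then h.armOmega i T1
  else (h.jointOmega T1 t).submatrix (fun k => (i, k)) (fun k => (i, k))

/-- The noise standard deviation estimate `σ̂_t` for `t ≥ T2`. -/
def sigmaHat (T1 T2 t : ℕ) : ℝ :=
  if t ≤ T2 then
    √((T1 : ℝ)⁻¹ * ∑ i : Fin M, ∑ s ∈ h.armPeriods i T1, (h.R s - h.v s ⬝ᵥ h.armCoef i T1) ^ 2)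
  else
    √(((t : ℝ) - T1)⁻¹ * ∑ s : Finset.Ioc T1 t,
      (h.R s - (h.rowsVTilde (Finset.Ioc T1 t) *ᵥ h.jointCoef T1 t) s) ^ 2)

/-- The criterion that the arm pulled in period `t > T1` maximizes: the estimated reward in
Phase 2 (`T1 < t ≤ T2`), the upper confidence bound in Phase 3 (`T2 < t`). -/
def criterion (θ : ℝ) (T1 T2 t : ℕ) (i : Fin M) : ℝ :=
  if t ≤ T2 then h.v t ⬝ᵥ h.armCoef i T1
  else h.v t ⬝ᵥ h.alphaHat T1 T2 (t - 1) i +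
    h.sigmaHat T1 T2 (t - 1) *
      √(2 * θ * Real.log ((t : ℝ) - T1) * (h.v t ⬝ᵥ (h.omegaHat T1 T2 (t - 1) i *ᵥ h.v t)))

end History

namespace IVModel

variable {M p q : ℕ} (P : IVModel M p q)

/-- The reward `vᵀ α_a + ε` of arm `a`. -/
def reward (x : Obs p q) (a : Fin M) : ℝ := x.1 ⬝ᵥ P.α a + x.2.2

/-- The reward of the oracle, who pulls an arm that maximizes `vᵀ α_i`. -/
def oracleReward (x : Obs p q) : ℝ := (⨆ i, x.1 ⬝ᵥ P.α i) + x.2.2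

/-- The history produced by the draws `x` and the arms `a`. -/
def history (x : ℕ → Obs p q) (a : ℕ → Fin M) : History M p q where
  v t := (x t).1
  z t := (x t).2.1
  arm := a
  R t := P.reward (x t) (a t)

variable {Ω : Type*} [MeasurableSpace Ω]

/-- `X 1, …, X T` are i.i.d. draws of `(v, z, ε)`, and `a 1, …, a T` are the arms that the
IV-Bandit algorithm with parameters `θ`, `T1`, `T2` pulls on these data: in Phase 1 uniformly at
random, independently of each other and of the data; later a maximizer of the criterion (ties
may be broken in any measurable way). -/
structure IsRun (θ : ℝ) (T1 T2 T : ℕ) (μ : Measure Ω) (X : ℕ → Ω → Obs p q)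
    (a : ℕ → Ω → Fin M) : Prop where
  measurable_X : ∀ t ∈ Finset.Icc 1 T, Measurable (X t)
  law_X : ∀ t ∈ Finset.Icc 1 T, μ.map (X t) = P.law
  indep_X : iIndepFun (fun t : Finset.Icc 1 T => X t) μ
  measurable_a : ∀ t ∈ Finset.Icc 1 T, Measurable (a t)
  uniform_a : ∀ t ∈ Finset.Icc 1 T1, ∀ i, μ {ω | a t ω = i} = (M : ℝ≥0∞)⁻¹
  indep_a : iIndepFun (fun t : Finset.Icc 1 T1 => a t) μ
  indep_X_a : IndepFun (fun ω (t : Finset.Icc 1 T) => X t ω)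
    (fun ω (t : Finset.Icc 1 T1) => a t ω) μ
  argmax_a : ∀ t ∈ Finset.Ioc T1 T, ∀ ω i,
    (P.history (fun s => X s ω) (fun s => a s ω)).criterion θ T1 T2 t i ≤
      (P.history (fun s => X s ω) (fun s => a s ω)).criterion θ T1 T2 t (a t ω)

/-- The expected cumulative regret over the periods `1, …, T`. -/
def regret (T : ℕ) (μ : Measure Ω) (X : ℕ → Ω → Obs p q) (a : ℕ → Ω → Fin M) : ℝ :=
  ∑ t ∈ Finset.Icc 1 T, ∫ ω, (P.oracleReward (X t ω) - P.reward (X t ω) (a t ω)) ∂μ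

end IVModel

end

/-!
The whole analysis rests on sums of functions of the i.i.d. draws. The pulled arms of the later
phases depend on the past, but the moments that enter the event `IVModel.Typical`, namely those of
`(v*, z)`, `(z, z)`, `z ε`, `ε ^ 2` and the number of draws near the margin, do not involve them. So
Hoeffding's inequality, the sub-Gaussian tail and Bernstein's inequality (`bernstein_sum`) bound the
probability of an atypical run, and no martingale is needed. In the exploration phase the arms are
independent of the data, so the same inequalities apply to the draws of each arm. As `η` is small
compared with the moments, `T ≥ 400 q ^ 2`, which absorbs the dimensions:
`T` times the probability of an atypical run is at most `2 q + 2`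
(`IVModel.IsRun.mul_measureReal_not_typical_le`).

On the typical event the argument is deterministic. The error of two-stage least squares is a
multiple of the length of `Zᵀ ε`, as soon as `Zᵀ Z` and `Zᵀ V` are well-conditioned
(`omega2SLS_bound`, `coef2SLS_error`). For the exploration phase this is part of the event. For the
joint estimate, `Ṽᵀ Z` differs from the sum of `v* zᵀ` only in the periods with a wrong arm. These
are controlled by strong induction on the period: if all earlier wrong arms had gaps at most
`IVModel.marginWidth`, then they occurred at draws near the margin, whose number is small; so the
estimates of the next period are precise (`IVModel.joint_estimate`), and an arm that maximizes the
upper confidence bound has a gap at most `IVModel.ucbWidth`, which is at most `marginWidth`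
(`IVModel.gap_le_marginWidth`, `IVModel.gap_le_ucbWidth`). Only period `T2 + 1`, whose upper
confidence bounds still use the exploration estimates, escapes; it counts as one wrong arm and costs
at most `√p v̄ δ̄`.

A wrong arm with gap at most `w` requires a draw within `w` of the margin, which has probability at
most `(M - 1) Lo w`, and costs at most `w` (`IVModel.IsRun.integral_regret_le_of_gap`). With
`w ^ 2 = 4 p v̄ ^ 2 Γ ^ 2 log T / n` after `n` periods, where `Γ` is `IVModel.ucbFactor`, the sum
over `n` is harmonic and gives the leading term of order `log ^ 2 T`. The first `T2` periods cost at
most `√p v̄ δ̄` each.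

The first part of the theorem is the second one for one admissible choice of the other constants,
and the third part holds because each unordered pair of arms is met twice in the sum over ordered
pairs, on disjoint events.
-/

noncomputable section

set_option linter.unusedSectionVars false

/-! ### Euclidean norms and quadratic forms -/

section LinearAlgebra

variable {n m r : Type*} [Fintype n] [Fintype m] [Fintype r]

/-- The Euclidean norm of a plain coordinate function, which carries the sup norm in Mathlib. -/
def euclNorm (x : n → ℝ) : ℝ := √(x ⬝ᵥ x)

lemma dotProduct_self_nonneg' (x : n → ℝ) : 0 ≤ x ⬝ᵥ x :=
  Finset.sum_nonneg fun i _ => mul_self_nonneg (x i)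

lemma euclNorm_nonneg (x : n → ℝ) : 0 ≤ euclNorm x := Real.sqrt_nonneg _

lemma euclNorm_sq (x : n → ℝ) : euclNorm x ^ 2 = x ⬝ᵥ x :=
  Real.sq_sqrt (dotProduct_self_nonneg' x)

lemma euclNorm_eq (x : n → ℝ) : euclNorm x = ‖WithLp.toLp 2 x‖ := by
  rw [EuclideanSpace.norm_eq, euclNorm, dotProduct]
  congr 1
  refine Finset.sum_congr rfl fun i _ => ?_
  simp [sq]

lemma euclNorm_add_le (x y : n → ℝ) : euclNorm (x + y) ≤ euclNorm x + euclNorm y := by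
  simp only [euclNorm_eq, WithLp.toLp_add]
  exact norm_add_le _ _

lemma euclNorm_smul (c : ℝ) (x : n → ℝ) : euclNorm (c • x) = |c| * euclNorm x := by
  simp only [euclNorm_eq, WithLp.toLp_smul, norm_smul, Real.norm_eq_abs]

lemma euclNorm_sub_le (x y : n → ℝ) : euclNorm y - euclNorm (x - y) ≤ euclNorm x := by
  have h := euclNorm_add_le x ((-1 : ℝ) • (x - y))
  rw [euclNorm_smul, neg_one_smul, neg_sub, add_sub_cancel] at h
  simp only [abs_neg, abs_one, one_mul] at h
  linarith

lemma euclNorm_sum_le {ι : Type*} (s : Finset ι) (f : ι → n → ℝ) :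
    euclNorm (∑ i ∈ s, f i) ≤ ∑ i ∈ s, euclNorm (f i) := by
  classical
  induction s using Finset.induction_on with
  | empty => simp [euclNorm]
  | insert a s ha ih =>
    rw [Finset.sum_insert ha, Finset.sum_insert ha]
    exact (euclNorm_add_le _ _).trans (by gcongr)

lemma dotProduct_sq_le (x y : n → ℝ) : (x ⬝ᵥ y) ^ 2 ≤ (x ⬝ᵥ x) * (y ⬝ᵥ y) := by
  have := Finset.sum_mul_sq_le_sq_mul_sq Finset.univ x y
  simpa [dotProduct, sq] using this

lemma abs_dotProduct_le (x y : n → ℝ) : |x ⬝ᵥ y| ≤ euclNorm x * euclNorm y := by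
  rw [euclNorm, euclNorm, ← Real.sqrt_mul (dotProduct_self_nonneg' x)]
  exact Real.abs_le_sqrt (dotProduct_sq_le x y)

/-- Entries bounded by `d` bound the Euclidean norm by `d` times the root of the dimension. -/
lemma euclNorm_le_of_abs_le {x : n → ℝ} {d : ℝ} (hd : 0 ≤ d) (h : ∀ i, |x i| ≤ d) :
    euclNorm x ≤ √(Fintype.card n) * d := by
  have h1 : x ⬝ᵥ x ≤ Fintype.card n * d ^ 2 := by
    calc x ⬝ᵥ x ≤ ∑ _i : n, d ^ 2 := Finset.sum_le_sum fun i _ => by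
          rw [← sq, ← sq_abs]; exact pow_le_pow_left₀ (abs_nonneg _) (h i) 2
      _ = _ := by simp
  calc euclNorm x ≤ √(Fintype.card n * d ^ 2) := Real.sqrt_le_sqrt h1
    _ = _ := by rw [Real.sqrt_mul (by positivity), Real.sqrt_sq hd]

lemma euclNorm_vecMul_le_of_abs_le (D : Matrix m n ℝ) {d : ℝ} (hd : 0 ≤ d)
    (h : ∀ i j, |D i j| ≤ d) (x : m → ℝ) :
    euclNorm (x ᵥ* D) ≤ √(Fintype.card m * Fintype.card n) * d * euclNorm x := by
  have h1 : ∀ j, |(x ᵥ* D) j| ≤ euclNorm x * (√(Fintype.card m) * d) := fun j =>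
    (abs_dotProduct_le x (fun i => D i j)).trans
      (mul_le_mul_of_nonneg_left (euclNorm_le_of_abs_le hd fun i => h i j) (euclNorm_nonneg x))
  refine (euclNorm_le_of_abs_le (by have := euclNorm_nonneg x; positivity) h1).trans_eq ?_
  rw [Real.sqrt_mul (by positivity)]; ring

lemma euclNorm_single [DecidableEq n] (i : n) (c : ℝ) : euclNorm (Pi.single i c) = |c| := by
  rw [euclNorm, single_dotProduct, Pi.single_eq_same, Real.sqrt_mul_self_eq_abs]

variable [DecidableEq n] [DecidableEq m] [DecidableEq r]

lemma hasEigenvalue_toLin'_iff {S : Matrix n n ℝ} {μ : ℝ} :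
    Module.End.HasEigenvalue (Matrix.toLin' S) μ ↔ ∃ x, x ≠ 0 ∧ S *ᵥ x = μ • x := by
  constructor
  · intro h
    obtain ⟨x, hx⟩ := h.exists_hasEigenvector
    exact ⟨x, hx.2, by simpa using hx.apply_eq_smul⟩
  · rintro ⟨x, hx, h⟩
    exact Module.End.hasEigenvalue_of_hasEigenvector
      (x := x) (Module.End.hasEigenvector_iff.2 ⟨by
        rw [Module.End.mem_eigenspace_iff]; simpa using h, hx⟩)

lemma hermitian_hasEigenvalue {S : Matrix n n ℝ} (hS : S.IsHermitian) (i : n) :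
    Module.End.HasEigenvalue (Matrix.toLin' S) (hS.eigenvalues i) := by
  rw [hasEigenvalue_toLin'_iff]
  refine ⟨hS.eigenvectorBasis i, fun h => ?_, hS.mulVec_eigenvectorBasis i⟩
  exact hS.eigenvectorBasis.orthonormal.ne_zero i (by ext j; exact congrFun h j)

/-- A lower bound for the eigenvalues of a symmetric matrix bounds its quadratic form. -/
lemma hermitian_quadForm_ge {S : Matrix n n ℝ} (hS : S.IsHermitian) {lo : ℝ}
    (h : ∀ μ, Module.End.HasEigenvalue (Matrix.toLin' S) μ → lo ≤ μ) (x : n → ℝ) :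
    lo * (x ⬝ᵥ x) ≤ x ⬝ᵥ (S *ᵥ x) := by
  have hS' : (S - lo • (1 : Matrix n n ℝ)).IsHermitian := by
    refine hS.sub ?_
    rw [Matrix.IsHermitian, conjTranspose_smul, conjTranspose_one, star_trivial]
  have hps : (S - lo • (1 : Matrix n n ℝ)).PosSemidef := by
    rw [hS'.posSemidef_iff_eigenvalues_nonneg]
    intro i
    obtain ⟨y, hy, hy'⟩ := hasEigenvalue_toLin'_iff.1 (hermitian_hasEigenvalue hS' i)
    have := h (hS'.eigenvalues i + lo) (hasEigenvalue_toLin'_iff.2 ⟨y, hy, by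
      rw [sub_mulVec, smul_mulVec, one_mulVec, sub_eq_iff_eq_add] at hy'
      rw [hy', add_smul]⟩)
    simp only [Pi.zero_apply]
    linarith
  have := hps.dotProduct_mulVec_nonneg x
  rw [star_trivial, sub_mulVec, smul_mulVec, one_mulVec, dotProduct_sub, dotProduct_smul,
    smul_eq_mul] at this
  linarith

lemma hermitian_quadForm_le {S : Matrix n n ℝ} (hS : S.IsHermitian) {hi : ℝ}
    (h : ∀ μ, Module.End.HasEigenvalue (Matrix.toLin' S) μ → μ ≤ hi) (x : n → ℝ) :
    x ⬝ᵥ (S *ᵥ x) ≤ hi * (x ⬝ᵥ x) := by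
  have := hermitian_quadForm_ge (S := -S) hS.neg (lo := -hi) (fun μ hμ => by
    obtain ⟨y, hy, hy'⟩ := hasEigenvalue_toLin'_iff.1 hμ
    have := h (-μ) (hasEigenvalue_toLin'_iff.2 ⟨y, hy, by
      rw [neg_mulVec] at hy'; rw [neg_smul, ← hy', neg_neg]⟩)
    linarith) x
  rw [neg_mulVec, dotProduct_neg] at this
  linarith

/-! ### Extreme singular values -/

lemma isHermitian_mul_transpose (A : Matrix m n ℝ) : (A * Aᵀ).IsHermitian := by
  have := Matrix.isHermitian_mul_conjTranspose_self A
  rwa [conjTranspose_eq_transpose_of_trivial] at this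

lemma vecMul_dotProduct_self (A : Matrix m n ℝ) (x : m → ℝ) :
    (x ᵥ* A) ⬝ᵥ (x ᵥ* A) = x ⬝ᵥ ((A * Aᵀ) *ᵥ x) := by
  rw [← mulVec_mulVec, mulVec_transpose, dotProduct_mulVec]

/-- For a matrix with at least as many columns as rows, `s` is a singular value iff `s ^ 2` is an
eigenvalue of `A * Aᵀ`; in the square case `A * Aᵀ` and `Aᵀ * A` have the same eigenvalues. -/
lemma isSingularValue_iff {A : Matrix m n ℝ} (h : Fintype.card m ≤ Fintype.card n) {s : ℝ} :
    IsSingularValue A s ↔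
      0 ≤ s ∧ Module.End.HasEigenvalue (Matrix.toLin' (A * Aᵀ)) (s ^ 2) := by
  rcases h.lt_or_eq with h | h
  · simp [IsSingularValue, h, h.not_ge]
  · have h2 : (Aᵀ * A).charpoly = (A * Aᵀ).charpoly := by
      rw [charpoly_mul_comm_of_le Aᵀ A h.le, h]; simp
    have h3 : ∀ t, Module.End.HasEigenvalue (Matrix.toLin' (Aᵀ * A)) t ↔
        Module.End.HasEigenvalue (Matrix.toLin' (A * Aᵀ)) t := by
      intro t
      rw [Module.End.hasEigenvalue_iff_isRoot_charpoly,
        Module.End.hasEigenvalue_iff_isRoot_charpoly, Matrix.charpoly_toLin',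
        Matrix.charpoly_toLin', h2]
    simp only [IsSingularValue, h, h3, le_refl, lt_irrefl, false_imp_iff, true_imp_iff, and_true]

lemma eigenvalue_mul_transpose_nonneg {A : Matrix m n ℝ} {μ : ℝ}
    (h : Module.End.HasEigenvalue (Matrix.toLin' (A * Aᵀ)) μ) : 0 ≤ μ := by
  obtain ⟨x, hx, h⟩ := hasEigenvalue_toLin'_iff.1 h
  have h1 := vecMul_dotProduct_self A x
  rw [h, dotProduct_smul, smul_eq_mul] at h1
  have h2 : 0 < x ⬝ᵥ x := (dotProduct_self_nonneg' x).lt_of_ne' (by simpa using hx)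
  have h3 := dotProduct_self_nonneg' (x ᵥ* A)
  by_contra! hμ
  nlinarith

lemma finite_singularValues {A : Matrix m n ℝ} (h : Fintype.card m ≤ Fintype.card n) :
    {s | IsSingularValue A s}.Finite := by
  have h1 : {μ | Module.End.HasEigenvalue (Matrix.toLin' (A * Aᵀ)) μ}.Finite :=
    Module.End.finite_hasEigenvalue _
  refine (h1.image Real.sqrt).subset fun s hs => ?_
  obtain ⟨h2, h3⟩ := (isSingularValue_iff h).1 hs
  exact ⟨s ^ 2, h3, Real.sqrt_sq h2⟩

lemma isSingularValue_sqrt {A : Matrix m n ℝ} (h : Fintype.card m ≤ Fintype.card n) {μ : ℝ}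
    (hμ : Module.End.HasEigenvalue (Matrix.toLin' (A * Aᵀ)) μ) : IsSingularValue A (√μ) := by
  rw [isSingularValue_iff h, Real.sq_sqrt (eigenvalue_mul_transpose_nonneg hμ)]
  exact ⟨Real.sqrt_nonneg _, hμ⟩

lemma nonempty_singularValues [Nonempty m] {A : Matrix m n ℝ}
    (h : Fintype.card m ≤ Fintype.card n) : {s | IsSingularValue A s}.Nonempty :=
  ⟨_, isSingularValue_sqrt h
    (hermitian_hasEigenvalue (isHermitian_mul_transpose A) (Classical.arbitrary m))⟩

lemma phiMin_nonneg (A : Matrix m n ℝ) : 0 ≤ phiMin A := Real.sInf_nonneg fun _ hs => hs.1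

lemma phiMin_le {A : Matrix m n ℝ} {s : ℝ} (hs : IsSingularValue A s) : phiMin A ≤ s :=
  csInf_le ⟨0, fun _ hs => hs.1⟩ hs

lemma le_phiMax {A : Matrix m n ℝ} (h : Fintype.card m ≤ Fintype.card n) {s : ℝ}
    (hs : IsSingularValue A s) : s ≤ phiMax A :=
  le_csSup (finite_singularValues h).bddAbove hs

lemma phiMin_le_phiMax [Nonempty m] {A : Matrix m n ℝ} (h : Fintype.card m ≤ Fintype.card n) :
    phiMin A ≤ phiMax A := by
  obtain ⟨s, hs⟩ := nonempty_singularValues (A := A) h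
  exact (phiMin_le hs).trans (le_phiMax h hs)

lemma phiMin_mul_le {A : Matrix m n ℝ} (h : Fintype.card m ≤ Fintype.card n) (x : m → ℝ) :
    phiMin A * euclNorm x ≤ euclNorm (x ᵥ* A) := by
  have h1 := hermitian_quadForm_ge (isHermitian_mul_transpose A) (lo := phiMin A ^ 2)
    (fun μ hμ => by
      have h2 := pow_le_pow_left₀ (phiMin_nonneg A) (phiMin_le (isSingularValue_sqrt h hμ)) 2
      rwa [Real.sq_sqrt (eigenvalue_mul_transpose_nonneg hμ)] at h2) x
  rw [← vecMul_dotProduct_self, ← euclNorm_sq, ← euclNorm_sq, ← mul_pow] at h1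
  exact le_of_abs_le (abs_le_of_sq_le_sq h1 (euclNorm_nonneg _))

lemma phiMin_pos_of_vecMul_ne_zero [Nonempty m] {A : Matrix m n ℝ}
    (h : Fintype.card m ≤ Fintype.card n) (hA : ∀ x, x ≠ 0 → x ᵥ* A ≠ 0) : 0 < phiMin A := by
  have h1 := (nonempty_singularValues (A := A) h).csInf_mem (finite_singularValues h)
  obtain ⟨h2, h3⟩ := (isSingularValue_iff h).1 h1
  change 0 ≤ phiMin A at h2
  change Module.End.HasEigenvalue _ (phiMin A ^ 2) at h3
  refine lt_of_le_of_ne h2 fun h0 => ?_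
  obtain ⟨x, hx, h4⟩ := hasEigenvalue_toLin'_iff.1 h3
  have h5 := vecMul_dotProduct_self A x
  rw [h4, ← h0] at h5
  refine hA x hx (dotProduct_self_eq_zero.1 (h5.trans (by simp)))

lemma posDef_singularValue {B : Matrix n n ℝ} (hB : B.PosDef) {μ : ℝ}
    (hμ : Module.End.HasEigenvalue (Matrix.toLin' B) μ) : IsSingularValue B μ := by
  obtain ⟨x, hx, h⟩ := hasEigenvalue_toLin'_iff.1 hμ
  have h1 := hB.dotProduct_mulVec_pos hx
  have h2 : 0 < x ⬝ᵥ x := (dotProduct_self_nonneg' x).lt_of_ne' (by simpa using hx)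
  rw [h, star_trivial, dotProduct_smul, smul_eq_mul] at h1
  rw [isSingularValue_iff le_rfl]
  refine ⟨(pos_of_mul_pos_left h1 h2.le).le, hasEigenvalue_toLin'_iff.2 ⟨x, hx, ?_⟩⟩
  have h3 : Bᵀ = B := by
    have := hB.isHermitian; rwa [Matrix.IsHermitian, conjTranspose_eq_transpose_of_trivial] at this
  rw [h3, ← mulVec_mulVec, h, mulVec_smul, h, smul_smul, sq]

lemma posDef_phiMin_le {B : Matrix n n ℝ} (hB : B.PosDef) (x : n → ℝ) :
    phiMin B * (x ⬝ᵥ x) ≤ x ⬝ᵥ (B *ᵥ x) :=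
  hermitian_quadForm_ge hB.isHermitian (fun _ hμ => phiMin_le (posDef_singularValue hB hμ)) x

lemma posDef_le_phiMax {B : Matrix n n ℝ} (hB : B.PosDef) (x : n → ℝ) :
    x ⬝ᵥ (B *ᵥ x) ≤ phiMax B * (x ⬝ᵥ x) :=
  hermitian_quadForm_le hB.isHermitian
    (fun _ hμ => le_phiMax le_rfl (posDef_singularValue hB hμ)) x

lemma posDef_phiMin_pos [Nonempty n] {B : Matrix n n ℝ} (hB : B.PosDef) : 0 < phiMin B := by
  refine phiMin_pos_of_vecMul_ne_zero le_rfl fun x hx h => ?_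
  have h1 := hB.dotProduct_mulVec_pos hx
  rw [star_trivial, dotProduct_mulVec, h, zero_dotProduct] at h1
  exact h1.false

/-! ### The error of two-stage least squares -/

lemma isUnit_of_quadForm_ge {S : Matrix m m ℝ} {c : ℝ} (hc : 0 < c)
    (h : ∀ x, c * (x ⬝ᵥ x) ≤ x ⬝ᵥ (S *ᵥ x)) : IsUnit S := by
  rw [← Matrix.mulVec_injective_iff_isUnit]
  intro x y hxy
  have h1 : S *ᵥ (x - y) = 0 := by rw [mulVec_sub]; exact sub_eq_zero.2 hxy
  have h2 := h (x - y)
  rw [h1, dotProduct_zero] at h2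
  have h3 : (x - y) ⬝ᵥ (x - y) = 0 :=
    le_antisymm (by nlinarith) (dotProduct_self_nonneg' _)
  exact sub_eq_zero.1 (dotProduct_self_eq_zero.1 h3)

variable {V : Matrix n m ℝ} {Z : Matrix n r ℝ} {aL bL bU : ℝ}

lemma mulVec_dotProduct_mulVec (Z : Matrix n r ℝ) (x y : r → ℝ) :
    (Z *ᵥ x) ⬝ᵥ (Z *ᵥ y) = x ⬝ᵥ ((Zᵀ * Z) *ᵥ y) := by
  rw [← mulVec_mulVec, dotProduct_mulVec x, vecMul_transpose]

lemma isUnit_gram (hbL : 0 < bL) (hlo : ∀ y, bL * (y ⬝ᵥ y) ≤ (Z *ᵥ y) ⬝ᵥ (Z *ᵥ y)) :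
    IsUnit (Zᵀ * Z) :=
  isUnit_of_quadForm_ge hbL fun y => by rw [← mulVec_dotProduct_mulVec]; exact hlo y

lemma projOp_transpose (Z : Matrix n r ℝ) : (projOp Z)ᵀ = projOp Z := by
  simp [projOp, transpose_mul, transpose_nonsing_inv, Matrix.mul_assoc]

lemma transpose_mul_projOp (h : IsUnit (Zᵀ * Z)) : Zᵀ * projOp Z = Zᵀ := by
  rw [projOp, ← Matrix.mul_assoc, ← Matrix.mul_assoc,
    Matrix.mul_nonsing_inv _ ((isUnit_iff_isUnit_det _).1 h), Matrix.one_mul]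

lemma projOp_mul_self (h : IsUnit (Zᵀ * Z)) : projOp Z * projOp Z = projOp Z := by
  nth_rw 1 [projOp]
  rw [Matrix.mul_assoc, transpose_mul_projOp h, ← projOp]

lemma projOp_dotProduct (h : IsUnit (Zᵀ * Z)) (x y : n → ℝ) :
    (projOp Z *ᵥ x) ⬝ᵥ (projOp Z *ᵥ y) = x ⬝ᵥ (projOp Z *ᵥ y) := by
  rw [mulVec_dotProduct_mulVec, projOp_transpose, projOp_mul_self h]

/-- The quadratic form of `Vᵀ 𝒫[Z] V` in terms of the projected regressors. -/
lemma quadForm_projOp (h : IsUnit (Zᵀ * Z)) (V : Matrix n m ℝ) (x : m → ℝ) :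
    x ⬝ᵥ ((Vᵀ * projOp Z * V) *ᵥ x) =
      (projOp Z *ᵥ (V *ᵥ x)) ⬝ᵥ (projOp Z *ᵥ (V *ᵥ x)) := by
  rw [projOp_dotProduct h, ← mulVec_mulVec, ← mulVec_mulVec, dotProduct_mulVec x,
    vecMul_transpose]

lemma transpose_mulVec_dotProduct_le (hhi : ∀ y, (Z *ᵥ y) ⬝ᵥ (Z *ᵥ y) ≤ bU * (y ⬝ᵥ y))
    (hbU : 0 ≤ bU) (w : n → ℝ) : (Zᵀ *ᵥ w) ⬝ᵥ (Zᵀ *ᵥ w) ≤ bU * (w ⬝ᵥ w) := by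
  set y := Zᵀ *ᵥ w with hy
  clear_value y
  have h1 : y ⬝ᵥ y = w ⬝ᵥ (Z *ᵥ y) := by
    rw [dotProduct_mulVec, ← mulVec_transpose, ← hy]
  have h2 := dotProduct_sq_le w (Z *ᵥ y)
  rw [← h1] at h2
  have h3 := hhi y
  have h4 := dotProduct_self_nonneg' y
  have h5 := dotProduct_self_nonneg' w
  rcases h4.eq_or_lt with h0 | h0
  · rw [← h0]; positivity
  · have : (y ⬝ᵥ y) ^ 2 ≤ (bU * (w ⬝ᵥ w)) * (y ⬝ᵥ y) := by nlinarith
    rw [sq] at this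
    exact le_of_mul_le_mul_right this h0

lemma omega2SLS_quadForm_ge (hbL : 0 < bL) (hbU : 0 < bU)
    (hlo : ∀ y, bL * (y ⬝ᵥ y) ≤ (Z *ᵥ y) ⬝ᵥ (Z *ᵥ y))
    (hhi : ∀ y, (Z *ᵥ y) ⬝ᵥ (Z *ᵥ y) ≤ bU * (y ⬝ᵥ y))
    (hA : ∀ x, aL * (x ⬝ᵥ x) ≤ (Zᵀ *ᵥ (V *ᵥ x)) ⬝ᵥ (Zᵀ *ᵥ (V *ᵥ x))) (x : m → ℝ) :
    aL / bU * (x ⬝ᵥ x) ≤ x ⬝ᵥ ((Vᵀ * projOp Z * V) *ᵥ x) := by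
  have hu := isUnit_gram hbL hlo
  rw [quadForm_projOp hu, div_mul_eq_mul_div, div_le_iff₀ hbU, mul_comm _ bU]
  refine (hA x).trans ?_
  refine le_trans (le_of_eq ?_) (transpose_mulVec_dotProduct_le hhi hbU.le _)
  rw [mulVec_mulVec (V *ᵥ x) Zᵀ (projOp Z), transpose_mul_projOp hu]

/-- If `ZᵀZ` has its eigenvalues in `[bL, bU]` and `ZᵀV` has its singular values above `√aL`, then
the quadratic form of `(Vᵀ 𝒫[Z] V)⁻¹` is bounded by `bU / aL`. -/
theorem omega2SLS_bound (haL : 0 < aL) (hbL : 0 < bL) (hbU : 0 < bU)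
    (hlo : ∀ y, bL * (y ⬝ᵥ y) ≤ (Z *ᵥ y) ⬝ᵥ (Z *ᵥ y))
    (hhi : ∀ y, (Z *ᵥ y) ⬝ᵥ (Z *ᵥ y) ≤ bU * (y ⬝ᵥ y))
    (hA : ∀ x, aL * (x ⬝ᵥ x) ≤ (Zᵀ *ᵥ (V *ᵥ x)) ⬝ᵥ (Zᵀ *ᵥ (V *ᵥ x))) (x : m → ℝ) :
    x ⬝ᵥ (omega2SLS V Z *ᵥ x) ≤ bU / aL * (x ⬝ᵥ x) := by
  have hS := omega2SLS_quadForm_ge hbL hbU hlo hhi hA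
  have hSu := isUnit_of_quadForm_ge (by positivity) hS
  set S := Vᵀ * projOp Z * V
  set w := omega2SLS V Z *ᵥ x with hw
  have hx : S *ᵥ w = x := by
    rw [hw, mulVec_mulVec, omega2SLS, mul_nonsing_inv _ ((isUnit_iff_isUnit_det _).1 hSu),
      one_mulVec]
  have h1 := hS w
  rw [hx, dotProduct_comm w x] at h1
  have h2 := dotProduct_sq_le x w
  have h3 := dotProduct_self_nonneg' w
  have h4 := dotProduct_self_nonneg' x
  have h5 : w ⬝ᵥ w ≤ bU / aL * (x ⬝ᵥ w) := by
    rw [div_mul_eq_mul_div, div_le_iff₀ hbU] at h1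
    rw [div_mul_eq_mul_div, le_div_iff₀ haL]; linarith
  have h6 : 0 ≤ x ⬝ᵥ w := le_trans (by positivity) h1
  rcases h6.eq_or_lt with h0 | h0
  · rw [← h0]; positivity
  · refine le_of_mul_le_mul_right (a := x ⬝ᵥ w) ?_ h0
    nlinarith [mul_le_mul_of_nonneg_left h5 h4]

/-- The error of two-stage least squares: the estimate is the truth up to a multiple of `Zᵀε`.
The projection `𝒫[Z]` makes `𝒫[Z] V` times the error the orthogonal projection of `𝒫[Z] ε`. -/
theorem coef2SLS_error (haL : 0 < aL) (hbL : 0 < bL) (hbU : 0 < bU)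
    (hlo : ∀ y, bL * (y ⬝ᵥ y) ≤ (Z *ᵥ y) ⬝ᵥ (Z *ᵥ y))
    (hhi : ∀ y, (Z *ᵥ y) ⬝ᵥ (Z *ᵥ y) ≤ bU * (y ⬝ᵥ y))
    (hA : ∀ x, aL * (x ⬝ᵥ x) ≤ (Zᵀ *ᵥ (V *ᵥ x)) ⬝ᵥ (Zᵀ *ᵥ (V *ᵥ x)))
    (α : m → ℝ) (ε : n → ℝ) :
    (coef2SLS V Z (V *ᵥ α + ε) - α) ⬝ᵥ (coef2SLS V Z (V *ᵥ α + ε) - α) ≤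
      bU / (aL * bL) * ((Zᵀ *ᵥ ε) ⬝ᵥ (Zᵀ *ᵥ ε)) := by
  have hu := isUnit_gram hbL hlo
  have hS := omega2SLS_quadForm_ge hbL hbU hlo hhi hA
  have hSu := isUnit_of_quadForm_ge (by positivity) hS
  set S := Vᵀ * projOp Z * V with hSdef
  set e := coef2SLS V Z (V *ᵥ α + ε) - α with he
  have hSe : S *ᵥ e = Vᵀ *ᵥ (projOp Z *ᵥ ε) := by
    have h1 : S *ᵥ coef2SLS V Z (V *ᵥ α + ε) = (Vᵀ * projOp Z) *ᵥ (V *ᵥ α + ε) := by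
      rw [coef2SLS, mulVec_mulVec, ← Matrix.mul_assoc, ← Matrix.mul_assoc, omega2SLS,
        mul_nonsing_inv _ ((isUnit_iff_isUnit_det _).1 hSu), Matrix.one_mul]
    rw [he, mulVec_sub, h1, mulVec_add, mulVec_mulVec, ← hSdef, add_sub_cancel_left,
      mulVec_mulVec]
  set w := projOp Z *ᵥ (V *ᵥ e) with hw
  set f := projOp Z *ᵥ ε with hf
  set g := Zᵀ *ᵥ ε with hg
  have hww : w ⬝ᵥ w = w ⬝ᵥ f := by
    rw [hw, ← quadForm_projOp hu, ← hSdef, hSe, dotProduct_mulVec e, vecMul_transpose, hf,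
      projOp_dotProduct hu]
  have hwf : w ⬝ᵥ w ≤ f ⬝ᵥ f := by
    have h1 := dotProduct_sq_le w f
    rw [← hww, sq] at h1
    rcases (dotProduct_self_nonneg' w).eq_or_lt with h0 | h0
    · rw [← h0]; exact dotProduct_self_nonneg' f
    · exact le_of_mul_le_mul_left h1 h0
  have hfg : bL * (f ⬝ᵥ f) ≤ g ⬝ᵥ g := by
    set y := (Zᵀ * Z)⁻¹ *ᵥ g with hy
    have h1 : f = Z *ᵥ y := by
      rw [hf, hy, hg, projOp, ← mulVec_mulVec, ← mulVec_mulVec]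
    have h2 : f ⬝ᵥ f = y ⬝ᵥ g := by
      rw [h1, mulVec_dotProduct_mulVec, hy, mulVec_mulVec (g),
        mul_nonsing_inv _ ((isUnit_iff_isUnit_det _).1 hu), one_mulVec]
    have h3 := dotProduct_sq_le y g
    have h4 := hlo y
    rw [← h1] at h4
    rw [← h2] at h3
    have h5 := dotProduct_self_nonneg' g
    rcases (dotProduct_self_nonneg' f).eq_or_lt with h0 | h0
    · rw [← h0]; simpa using h5
    · refine le_of_mul_le_mul_right (a := f ⬝ᵥ f) ?_ h0
      nlinarith [mul_le_mul_of_nonneg_right h4 h5]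
  have h1 := hS e
  rw [quadForm_projOp hu] at h1
  have h2 : aL * (e ⬝ᵥ e) ≤ bU * (w ⬝ᵥ w) := by
    rw [div_mul_eq_mul_div, div_le_iff₀ hbU] at h1; linarith
  rw [div_mul_eq_mul_div, le_div_iff₀ (by positivity)]
  nlinarith [mul_le_mul_of_nonneg_left hwf hbU.le, mul_le_mul_of_nonneg_left hfg hbU.le,
    mul_le_mul_of_nonneg_left h2 hbL.le, mul_le_mul_of_nonneg_left
      (mul_le_mul_of_nonneg_left hwf hbU.le) hbL.le]

end LinearAlgebra

/-! ### Concentration inequalities -/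

section Concentration

variable {S : Type*} [MeasurableSpace S] {ν : Measure S}

/-- The strict inequality keeps the Chernoff bound true for the variance proxy `0`. -/
lemma subgaussian_tail {Y : S → ℝ} {c : ℝ≥0} (h : HasSubgaussianMGF Y c ν) {x : ℝ} (hx : 0 ≤ x) :
    ν.real {ω | x * √c < Y ω} ≤ Real.exp (-x ^ 2 / 2) := by
  have hfin : IsFiniteMeasure ν := by
    have := h.integrable_exp_mul 0
    simpa [integrable_const_iff, isFiniteMeasure_iff] using this
  rcases eq_or_ne c 0 with rfl | hc
  · have h1 : ν.real {ω | x * √(0 : ℝ≥0) < Y ω} = 0 := by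
      rw [measureReal_eq_zero_iff]
      refine measure_mono_null (fun ω hω => ?_) (ae_iff.1 h.ae_eq_zero_of_hasSubgaussianMGF_zero)
      simp only [NNReal.coe_zero, Real.sqrt_zero, mul_zero, Set.mem_ofPred_eq] at hω
      simpa using hω.ne'
    rw [h1]; positivity
  · have hc' : (0 : ℝ) < c := by positivity
    calc ν.real {ω | x * √c < Y ω} ≤ ν.real {ω | x * √c ≤ Y ω} :=
          measureReal_mono fun ω hω => by
            rw [Set.mem_ofPred_eq] at *; exact hω.le
      _ ≤ Real.exp (-(x * √c) ^ 2 / (2 * c)) := h.measure_ge_le (by positivity)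
      _ = _ := by
        congr 1
        rw [mul_pow, Real.sq_sqrt hc'.le]
        field_simp

lemma subgaussian_tail_abs {Y : S → ℝ} {c : ℝ≥0} (h : HasSubgaussianMGF Y c ν) {x : ℝ}
    (hx : 0 ≤ x) : ν.real {ω | x * √c < |Y ω|} ≤ 2 * Real.exp (-x ^ 2 / 2) := by
  have hfin : IsFiniteMeasure ν := by
    have := h.integrable_exp_mul 0
    simpa [integrable_const_iff, isFiniteMeasure_iff] using this
  calc ν.real {ω | x * √c < |Y ω|}
      ≤ ν.real ({ω | x * √c < Y ω} ∪ {ω | x * √c < (-Y) ω}) :=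
        measureReal_mono fun ω hω => by
          rw [Set.mem_union, Set.mem_ofPred_eq, Set.mem_ofPred_eq] at *; exact lt_abs.1 hω
    _ ≤ _ := (measureReal_union_le _ _).trans (add_le_add (subgaussian_tail h hx)
        (subgaussian_tail h.neg hx))
    _ = _ := by ring

/-- A centred variable that is dominated by a multiple of a sub-Gaussian one is sub-Gaussian. With
`m t = E e ^ (t Y)` one has `m t ≤ m t * m (-t) ≤ ((m t + m (-t)) / 2) ^ 2 = (E cosh (t Y)) ^ 2`,
and `cosh` is monotone in the absolute value. No independence of `Y / X` and `X` is needed. -/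
lemma subgaussian_of_abs_le [IsProbabilityMeasure ν] {X Y : S → ℝ} {c b : ℝ≥0}
    (h : HasSubgaussianMGF X c ν) (hY : AEMeasurable Y ν) (hle : ∀ᵐ ω ∂ν, |Y ω| ≤ b * |X ω|)
    (h0 : ∫ ω, Y ω ∂ν = 0) : HasSubgaussianMGF Y (2 * b ^ 2 * c) ν := by
  have hcosh : ∀ t : ℝ, ∀ᵐ ω ∂ν, Real.exp (t * Y ω) + Real.exp (-t * Y ω) ≤
      Real.exp (t * b * X ω) + Real.exp (-(t * b) * X ω) := by
    intro t
    filter_upwards [hle] with ω hω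
    have h1 : |t * Y ω| ≤ |t * b * X ω| := by
      rw [mul_assoc, abs_mul, abs_mul t, abs_mul (b : ℝ), NNReal.abs_eq]
      gcongr
    have h2 := Real.cosh_le_cosh.2 h1
    rw [Real.cosh_eq, Real.cosh_eq] at h2
    simp only [neg_mul]
    linarith
  have hXint : ∀ t : ℝ, Integrable (fun ω => Real.exp (t * b * X ω) +
      Real.exp (-(t * b) * X ω)) ν :=
    fun t => (h.integrable_exp_mul _).add (h.integrable_exp_mul _)
  have hint : ∀ t : ℝ, Integrable (fun ω => Real.exp (t * Y ω)) ν := by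
    intro t
    refine (hXint t).mono' (by fun_prop) ?_
    filter_upwards [hcosh t] with ω hω
    rw [Real.norm_eq_abs, Real.abs_exp]
    have := Real.exp_pos (-t * Y ω)
    linarith
  refine ⟨hint, fun t => ?_⟩
  have hYint : Integrable Y ν := by
    refine Integrable.mono' (h.integrable.abs.const_mul b) hY.aestronglyMeasurable ?_
    filter_upwards [hle] with ω hω
    exact hω
  have hone : 1 ≤ mgf Y ν (-t) := by
    calc (1 : ℝ) = ∫ ω, (-t * Y ω + 1) ∂ν := by
          rw [integral_add (hYint.const_mul _) (integrable_const _), integral_const_mul, h0]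
          simp
      _ ≤ _ := integral_mono ((hYint.const_mul _).add (integrable_const _)) (hint _)
          fun ω => Real.add_one_le_exp _
  have hsum : mgf Y ν t + mgf Y ν (-t) ≤ 2 * Real.exp (c * (t * b) ^ 2 / 2) := by
    calc mgf Y ν t + mgf Y ν (-t) =
          ∫ ω, (Real.exp (t * Y ω) + Real.exp (-t * Y ω)) ∂ν :=
          (integral_add (hint t) (hint (-t))).symm
      _ ≤ ∫ ω, (Real.exp (t * b * X ω) + Real.exp (-(t * b) * X ω)) ∂ν :=
          integral_mono_ae ((hint t).add (hint (-t))) (hXint t) (hcosh t)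
      _ = mgf X ν (t * b) + mgf X ν (-(t * b)) :=
          integral_add (h.integrable_exp_mul _) (h.integrable_exp_mul _)
      _ ≤ Real.exp (c * (t * b) ^ 2 / 2) + Real.exp (c * (-(t * b)) ^ 2 / 2) :=
          add_le_add (h.mgf_le _) (h.mgf_le _)
      _ = _ := by rw [neg_sq]; ring
  have hpos : 0 ≤ mgf Y ν t := mgf_nonneg
  calc mgf Y ν t ≤ mgf Y ν t * mgf Y ν (-t) := le_mul_of_one_le_right hpos hone
    _ ≤ ((mgf Y ν t + mgf Y ν (-t)) / 2) ^ 2 := by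
      nlinarith [sq_nonneg (mgf Y ν t - mgf Y ν (-t))]
    _ ≤ (Real.exp (c * (t * b) ^ 2 / 2)) ^ 2 := by
      have : 0 ≤ mgf Y ν (-t) := mgf_nonneg
      gcongr; linarith
    _ = _ := by
      rw [← Real.exp_nat_mul]; congr 1; push_cast; ring

/-- The square of a sub-Gaussian variable has some exponential moment: write `e ^ (u² / 2)` as a
Gaussian average of `e ^ (u g)` and exchange the integrals. -/
lemma exists_lintegral_exp_sq_lt_top [IsProbabilityMeasure ν] {X : S → ℝ} {c : ℝ≥0}
    (h : HasSubgaussianMGF X c ν) (hX : Measurable X) :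
    ∃ b : ℝ, 0 < b ∧ ∫⁻ ω, ENNReal.ofReal (Real.exp (b * X ω ^ 2)) ∂ν < ∞ := by
  set a : ℝ := √((2 * (c + 1))⁻¹) with ha
  have ha2 : a ^ 2 = (2 * (c + 1 : ℝ))⁻¹ := Real.sq_sqrt (by positivity)
  refine ⟨a ^ 2 / 2, by rw [ha2]; positivity, ?_⟩
  set G : ℝ≥0∞ := ∫⁻ g : ℝ, ENNReal.ofReal (Real.exp (-(g ^ 2) / 2)) with hG
  have hGpos : G ≠ 0 := by
    intro h0
    rw [hG, lintegral_eq_zero_iff (by fun_prop)] at h0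
    have : (volume : Measure ℝ) Set.univ = 0 := by
      refine measure_mono_null (fun g _ => ?_) (ae_iff.1 h0)
      simp [Real.exp_pos]
    simp at this
  have hcalc : ∀ u : ℝ, ENNReal.ofReal (Real.exp (u ^ 2 / 2)) * G =
      ∫⁻ g : ℝ, ENNReal.ofReal (Real.exp (-(g ^ 2) / 2)) * ENNReal.ofReal (Real.exp (g * u)) := by
    intro u
    rw [hG, ← lintegral_sub_right_eq_self _ u, ← lintegral_const_mul _ (by fun_prop)]
    refine lintegral_congr fun g => ?_
    rw [← ENNReal.ofReal_mul (Real.exp_nonneg _), ← ENNReal.ofReal_mul (Real.exp_nonneg _),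
      ← Real.exp_add, ← Real.exp_add]
    congr 2; ring
  have hfin : (∫⁻ ω, ENNReal.ofReal (Real.exp (a ^ 2 / 2 * X ω ^ 2)) ∂ν) * G < ∞ := by
    calc (∫⁻ ω, ENNReal.ofReal (Real.exp (a ^ 2 / 2 * X ω ^ 2)) ∂ν) * G
        = ∫⁻ ω, ∫⁻ g : ℝ, ENNReal.ofReal (Real.exp (-(g ^ 2) / 2)) *
            ENNReal.ofReal (Real.exp (g * (a * X ω))) ∂volume ∂ν := by
          rw [← lintegral_mul_const _ (by fun_prop)]
          refine lintegral_congr fun ω => ?_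
          rw [← hcalc]; congr 3; ring
      _ = ∫⁻ g : ℝ, ∫⁻ ω, ENNReal.ofReal (Real.exp (-(g ^ 2) / 2)) *
            ENNReal.ofReal (Real.exp (g * (a * X ω))) ∂ν :=
          lintegral_lintegral_swap (by fun_prop)
      _ ≤ ∫⁻ g : ℝ, ENNReal.ofReal (Real.exp (-(1 / 4) * g ^ 2)) := by
          refine lintegral_mono fun g => ?_
          rw [lintegral_const_mul _ (by fun_prop)]
          have h1 : ∫⁻ ω, ENNReal.ofReal (Real.exp (g * (a * X ω))) ∂ν =
              ENNReal.ofReal (mgf X ν (g * a)) := by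
            rw [mgf, ofReal_integral_eq_lintegral_ofReal (h.integrable_exp_mul _)
              (ae_of_all _ fun ω => Real.exp_nonneg _)]
            simp only [mul_assoc]
          rw [h1, ← ENNReal.ofReal_mul (Real.exp_nonneg _)]
          refine ENNReal.ofReal_le_ofReal ?_
          calc Real.exp (-(g ^ 2) / 2) * mgf X ν (g * a)
              ≤ Real.exp (-(g ^ 2) / 2) * Real.exp (c * (g * a) ^ 2 / 2) := by
                gcongr; exact h.mgf_le _
            _ ≤ _ := by
                rw [← Real.exp_add, Real.exp_le_exp, mul_pow, ha2]
                have h2 : (c : ℝ) * (2 * (c + 1 : ℝ))⁻¹ ≤ 1 / 2 := by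
                  rw [← div_eq_mul_inv, div_le_iff₀ (by positivity)]
                  linarith
                nlinarith [mul_le_mul_of_nonneg_left h2 (sq_nonneg g)]
      _ < ∞ := by
          have := integrable_exp_neg_mul_sq (b := 1 / 4) (by norm_num)
          exact this.lintegral_lt_top
  exact lt_of_not_ge fun h => by
    rw [top_le_iff.1 h, ENNReal.top_mul hGpos] at hfin
    exact hfin.false

/-- A variable with some exponential moment has a finite sub-exponential norm. -/
lemma exists_lintegral_exp_le_two [IsProbabilityMeasure ν] {Y : S → ℝ} (hY : Measurable Y)
    {b : ℝ} (hb : 0 < b) (h : ∫⁻ ω, ENNReal.ofReal (Real.exp (b * |Y ω|)) ∂ν < ∞) :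
    ∃ w : ℝ, 0 < w ∧ ∫⁻ ω, ENNReal.ofReal (Real.exp (|Y ω| / w)) ∂ν ≤ 2 := by
  have h1 : Filter.Tendsto (fun k : ℕ => ∫⁻ ω, ENNReal.ofReal (Real.exp (|Y ω| / (k + b⁻¹))) ∂ν)
      Filter.atTop (nhds (∫⁻ _, 1 ∂ν)) := by
    refine tendsto_lintegral_of_dominated_convergence
      (fun ω => ENNReal.ofReal (Real.exp (b * |Y ω|))) (fun k => by fun_prop) (fun k => ?_)
      h.ne (ae_of_all _ fun ω => ?_)
    · refine ae_of_all _ fun ω => ENNReal.ofReal_le_ofReal (Real.exp_le_exp.2 ?_)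
      rw [div_eq_inv_mul]
      refine mul_le_mul_of_nonneg_right ?_ (abs_nonneg _)
      refine inv_le_of_inv_le₀ hb ?_
      linarith [(Nat.cast_nonneg k : (0 : ℝ) ≤ k)]
    · have h2 : Filter.Tendsto (fun k : ℕ => |Y ω| / ((k : ℝ) + b⁻¹)) Filter.atTop (nhds 0) :=
        Filter.Tendsto.const_div_atTop
          (Filter.tendsto_atTop_add_const_right _ _ tendsto_natCast_atTop_atTop) _
      have h3 := (ENNReal.continuous_ofReal.comp Real.continuous_exp).tendsto 0 |>.comp h2
      simpa [Function.comp_def] using h3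
  simp only [lintegral_const, measure_univ, mul_one] at h1
  obtain ⟨k, hk⟩ := (h1.eventually (gt_mem_nhds (by norm_num : (1 : ℝ≥0∞) < 2))).exists
  exact ⟨k + b⁻¹, by positivity, hk.le⟩

lemma exp_le_one_add_add_sq_mul (x : ℝ) : Real.exp x ≤ 1 + x + x ^ 2 * Real.exp |x| := by
  rcases le_or_gt |x| 1 with h | h
  · have h1 := (abs_le.1 (Real.abs_exp_sub_one_sub_id_le h)).2
    have h2 : 1 ≤ Real.exp |x| := Real.one_le_exp (abs_nonneg x)
    nlinarith [sq_nonneg x]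
  · have h1 : 1 ≤ x ^ 2 := by rw [← sq_abs]; nlinarith
    have h2 := Real.add_one_le_exp |x|
    have h3 : Real.exp |x| ≤ x ^ 2 * Real.exp |x| := le_mul_of_one_le_left (Real.exp_nonneg _) h1
    rcases le_or_gt 0 x with hx | hx
    · rw [abs_of_nonneg hx] at *; linarith
    · have h4 : Real.exp x ≤ 1 := Real.exp_le_one_iff.2 hx.le
      rw [abs_of_neg hx] at *; linarith

/-- The exponential moments of a centred variable with sub-exponential norm at most `w`. -/
lemma subexponential_mgf [IsProbabilityMeasure ν] {Y : S → ℝ} (hY : AEMeasurable Y ν) {w : ℝ}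
    (hw : 0 < w) (h : ∫⁻ ω, ENNReal.ofReal (Real.exp (|Y ω| / w)) ∂ν ≤ 2)
    (h0 : ∫ ω, Y ω ∂ν = 0) {t : ℝ} (ht : 0 ≤ t) (htw : t ≤ 1 / (2 * w)) :
    Integrable (fun ω => Real.exp (t * Y ω)) ν ∧
      mgf Y ν t ≤ Real.exp (16 * t ^ 2 * w ^ 2) := by
  have hmeas : AEStronglyMeasurable (fun ω => Real.exp (|Y ω| / w)) ν := by
    have : AEMeasurable (fun ω => Real.exp (|Y ω| / w)) ν := by
      have := hY.abs
      fun_prop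
    exact this.aestronglyMeasurable
  have hint : Integrable (fun ω => Real.exp (|Y ω| / w)) ν :=
    (lintegral_ofReal_ne_top_iff_integrable hmeas (ae_of_all _ fun ω => Real.exp_nonneg _)).1
      (h.trans_lt (by norm_num)).ne
  have hint2 : ∫ ω, Real.exp (|Y ω| / w) ∂ν ≤ 2 := by
    rw [integral_eq_lintegral_of_nonneg_ae (ae_of_all _ fun ω => Real.exp_nonneg _) hmeas]
    exact ENNReal.toReal_le_of_le_ofReal (by norm_num) (by simpa using h)
  have htY : ∀ ω, |t * Y ω| ≤ |Y ω| / w / 2 := fun ω => by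
    rw [abs_mul, abs_of_nonneg ht]
    calc t * |Y ω| ≤ 1 / (2 * w) * |Y ω| := by gcongr
      _ = _ := by field_simp
  have hYint : Integrable Y ν := by
    refine Integrable.mono' (hint.const_mul w) hY.aestronglyMeasurable (ae_of_all _ fun ω => ?_)
    have := Real.add_one_le_exp (|Y ω| / w)
    rw [Real.norm_eq_abs]
    calc |Y ω| = w * (|Y ω| / w) := by field_simp
      _ ≤ _ := by gcongr; linarith
  have hexp : Integrable (fun ω => Real.exp (t * Y ω)) ν := by
    refine hint.mono' (by fun_prop) (ae_of_all _ fun ω => ?_)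
    rw [Real.norm_eq_abs, Real.abs_exp, Real.exp_le_exp]
    have : 0 ≤ |Y ω| / w := by positivity
    linarith [htY ω, le_abs_self (t * Y ω)]
  refine ⟨hexp, ?_⟩
  have hpt : ∀ ω, Real.exp (t * Y ω) ≤
      1 + t * Y ω + 8 * t ^ 2 * w ^ 2 * Real.exp (|Y ω| / w) := by
    intro ω
    set u := |Y ω| / w with hu
    have hu0 : 0 ≤ u := by positivity
    have hYu : Y ω ^ 2 = u ^ 2 * w ^ 2 := by rw [hu, div_pow, sq_abs]; field_simp
    have h1 : u ^ 2 ≤ 8 * Real.exp (u / 2) := by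
      nlinarith [Real.quadratic_le_exp_of_nonneg (x := u / 2) (by positivity)]
    have h2 : Real.exp |t * Y ω| ≤ Real.exp (u / 2) := Real.exp_le_exp.2 (htY ω)
    have h3 : Real.exp u = Real.exp (u / 2) * Real.exp (u / 2) := by
      rw [← Real.exp_add]; ring_nf
    calc Real.exp (t * Y ω) ≤ _ := exp_le_one_add_add_sq_mul _
      _ ≤ 1 + t * Y ω + (t ^ 2 * w ^ 2 * (8 * Real.exp (u / 2))) * Real.exp (u / 2) := by
        gcongr
        rw [mul_pow, hYu]
        nlinarith [mul_le_mul_of_nonneg_left h1 (by positivity : 0 ≤ t ^ 2 * w ^ 2)]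
      _ = _ := by rw [h3]; ring
  calc mgf Y ν t ≤ ∫ ω, (1 + t * Y ω + 8 * t ^ 2 * w ^ 2 * Real.exp (|Y ω| / w)) ∂ν :=
        integral_mono hexp (((integrable_const _).add (hYint.const_mul _)).add
          (hint.const_mul _)) hpt
    _ = 1 + 8 * t ^ 2 * w ^ 2 * ∫ ω, Real.exp (|Y ω| / w) ∂ν := by
        have h1 : Integrable (fun ω => 1 + t * Y ω) ν :=
          (integrable_const _).add (hYint.const_mul _)
        rw [integral_add h1 (hint.const_mul _),
          integral_add (integrable_const _) (hYint.const_mul _), integral_const_mul,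
          integral_const_mul, h0]
        simp
    _ ≤ 16 * t ^ 2 * w ^ 2 + 1 := by
        nlinarith [mul_le_mul_of_nonneg_left hint2 (by positivity : 0 ≤ 8 * t ^ 2 * w ^ 2)]
    _ ≤ _ := Real.add_one_le_exp _

/-- **Bernstein's inequality** for independent sub-exponential variables (upper tail). -/
theorem bernstein_sum {ι : Type*} [Fintype ι] {Y : ι → S → ℝ} (hind : iIndepFun Y ν)
    (hY : ∀ i, Measurable (Y i)) {w : ℝ} (hw : 0 < w)
    (h : ∀ i, ∫⁻ ω, ENNReal.ofReal (Real.exp (|Y i ω| / w)) ∂ν ≤ 2)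
    (h0 : ∀ i, ∫ ω, Y i ω ∂ν = 0) {D : ℝ} (hD : 0 < D) {E : ℝ}
    (hE1 : E ≤ Fintype.card ι * (D ^ 2 / (64 * w ^ 2)))
    (hE2 : E ≤ Fintype.card ι * (D / (4 * w))) :
    ν.real {ω | Fintype.card ι * D ≤ ∑ i, Y i ω} ≤ Real.exp (-E) := by
  have : IsProbabilityMeasure ν := hind.isProbabilityMeasure
  set n : ℝ := (Fintype.card ι : ℝ)
  set t : ℝ := min (1 / (2 * w)) (D / (32 * w ^ 2)) with ht
  have ht0 : 0 ≤ t := by positivity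
  have htw : t ≤ 1 / (2 * w) := min_le_left _ _
  have hmgf := fun i => subexponential_mgf (hY i).aemeasurable hw (h i) (h0 i) ht0 htw
  have hint : Integrable (fun ω => Real.exp (t * (∑ i, Y i) ω)) ν :=
    hind.integrable_exp_mul_sum hY (s := Finset.univ) fun i _ => (hmgf i).1
  have h1 := measure_ge_le_exp_mul_mgf (n * D) ht0 hint
  rw [hind.mgf_sum hY] at h1
  have h2 : ∏ i, mgf (Y i) ν t ≤ Real.exp (16 * t ^ 2 * w ^ 2) ^ Fintype.card ι := by
    refine (Finset.prod_le_prod (fun i _ => mgf_nonneg) fun i _ => (hmgf i).2).trans_eq ?_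
    rw [Finset.prod_const, Finset.card_univ]
  rw [← Real.exp_nat_mul] at h2
  simp only [Finset.sum_apply] at h1
  refine h1.trans ((mul_le_mul_of_nonneg_left h2 (Real.exp_nonneg _)).trans ?_)
  rw [← Real.exp_add, Real.exp_le_exp]
  have hn : (0 : ℝ) ≤ n := Nat.cast_nonneg _
  suffices hs : E ≤ n * (t * D - 16 * t ^ 2 * w ^ 2) by linarith
  rcases le_total (D / (32 * w ^ 2)) (1 / (2 * w)) with hc | hc
  · refine hE1.trans (mul_le_mul_of_nonneg_left (le_of_eq ?_) hn)
    rw [ht, min_eq_right hc]; field_simp; ring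
  · refine hE2.trans (mul_le_mul_of_nonneg_left ?_ hn)
    rw [ht, min_eq_left hc]
    rw [div_le_div_iff₀ (by positivity) (by positivity)] at hc
    have hDw : 16 * w ≤ D := by nlinarith
    have : 1 / (2 * w) * D - 16 * (1 / (2 * w)) ^ 2 * w ^ 2 - D / (4 * w) =
        (D - 16 * w) / (4 * w) := by field_simp; ring
    have h3 : 0 ≤ (D - 16 * w) / (4 * w) := div_nonneg (by linarith) (by positivity)
    linarith

/-- Two independent families that are independent of each other form an independent family of
pairs. -/
lemma iIndepFun_prodMk {ι β γ : Type*} [Fintype ι] [MeasurableSpace β] [MeasurableSpace γ]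
    {X : ι → S → β} {Y : ι → S → γ} (hX : ∀ i, Measurable (X i)) (hY : ∀ i, Measurable (Y i))
    (hXi : iIndepFun X ν) (hYi : iIndepFun Y ν)
    (hXY : IndepFun (fun ω i => X i ω) (fun ω i => Y i ω) ν) :
    iIndepFun (fun i ω => (X i ω, Y i ω)) ν := by
  have : IsProbabilityMeasure ν := hXi.isProbabilityMeasure
  have hX' : Measurable fun ω i => X i ω := measurable_pi_lambda _ hX
  have hY' : Measurable fun ω i => Y i ω := measurable_pi_lambda _ hY
  have hpX : ∀ i, IsProbabilityMeasure (ν.map (X i)) :=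
    fun i => Measure.isProbabilityMeasure_map (hX i).aemeasurable
  have hpY : ∀ i, IsProbabilityMeasure (ν.map (Y i)) :=
    fun i => Measure.isProbabilityMeasure_map (hY i).aemeasurable
  rw [iIndepFun_iff_map_fun_eq_pi_map fun i => ((hX i).prodMk (hY i)).aemeasurable]
  have h1 := (indepFun_iff_map_prod_eq_prod_map_map hX'.aemeasurable hY'.aemeasurable).1 hXY
  rw [hXi.map_fun_eq_pi_map fun i => (hX i).aemeasurable,
    hYi.map_fun_eq_pi_map fun i => (hY i).aemeasurable] at h1
  have h2 := (measurePreserving_arrowProdEquivProdArrow β γ ι (fun i => ν.map (X i))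
    (fun i => ν.map (Y i))).symm
  have h3 : ∀ i, ν.map (fun ω => (X i ω, Y i ω)) = (ν.map (X i)).prod (ν.map (Y i)) := by
    intro i
    refine (indepFun_iff_map_prod_eq_prod_map_map (hX i).aemeasurable (hY i).aemeasurable).1 ?_
    exact hXY.comp (measurable_pi_apply i) (measurable_pi_apply i)
  simp only [h3]
  rw [← h2.map_eq, ← h1, Measure.map_map (MeasurableEquiv.measurable _) (hX'.prodMk hY')]
  rfl

end Concentration

/-! ### The bandit model -/

namespace IVModel

variable {M p q : ℕ} (P : IVModel M p q)

@[fun_prop]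
lemma measurable_dotProduct_const {S : Type*} [MeasurableSpace S] {n : Type*} [Fintype n]
    {f : S → n → ℝ} (hf : Measurable f) (w : n → ℝ) : Measurable fun x => f x ⬝ᵥ w := by
  unfold dotProduct; fun_prop

lemma measurableSet_isOptArm (i : Fin M) : MeasurableSet {v : Fin p → ℝ | P.IsOptArm v i} := by
  refine MeasurableSet.congr (s := ⋂ j, {v | j ≠ i → 0 < v ⬝ᵥ (P.α i - P.α j)}) ?_ (by
    ext v; simp [IsOptArm])
  refine MeasurableSet.iInter fun j => ?_
  by_cases h : j = i
  · simp [h]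
  · simp only [ne_eq, h, not_false_eq_true, forall_const]
    exact measurableSet_lt measurable_const (by fun_prop)

lemma measurable_vStar (i : Fin M) (k : Fin p) :
    Measurable fun v : Fin p → ℝ => P.vStar v (i, k) := by
  unfold vStar
  exact Measurable.ite (P.measurableSet_isOptArm i) (by fun_prop) measurable_const

lemma measurable_vStar_fst (i : Fin M) (k : Fin p) :
    Measurable fun x : Obs p q => P.vStar x.1 (i, k) :=
  (P.measurable_vStar i k).comp measurable_fst

lemma sigmaSq_nonneg : 0 ≤ P.sigmaSq := variance_nonneg _ _

lemma Keps_nonneg : 0 ≤ P.Keps := Real.sInf_nonneg fun _ hw => hw.1.le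

variable {P}

lemma IsOptArm.unique {v : Fin p → ℝ} {i j : Fin M} (hi : P.IsOptArm v i) (hj : P.IsOptArm v j) :
    i = j := by
  by_contra h
  have h1 := hi j (Ne.symm h)
  have h2 := hj i h
  rw [dotProduct_sub] at h1 h2
  linarith

lemma IsOptArm.le {v : Fin p → ℝ} {i : Fin M} (hi : P.IsOptArm v i) (j : Fin M) :
    v ⬝ᵥ P.α j ≤ v ⬝ᵥ P.α i := by
  rcases eq_or_ne j i with rfl | h
  · exact le_rfl
  · have := hi j h; rw [dotProduct_sub] at this; linarith

lemma IsOptArm.iSup_eq {v : Fin p → ℝ} {i : Fin M} (hi : P.IsOptArm v i) :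
    ⨆ j, v ⬝ᵥ P.α j = v ⬝ᵥ P.α i := by
  have : Nonempty (Fin M) := ⟨i⟩
  exact le_antisymm (ciSup_le hi.le) (le_ciSup (f := fun j => v ⬝ᵥ P.α j)
    (Set.finite_range _).bddAbove i)

namespace Assumption

variable (hP : P.Assumption)
include hP

lemma ae_dotProduct_ne_zero {i j : Fin M} (hij : i ≠ j) :
    ∀ᵐ x ∂P.law, x.1 ⬝ᵥ (P.α i - P.α j) ≠ 0 := by
  have := hP.prob
  have h1 : P.law.real {x | x.1 ⬝ᵥ (P.α i - P.α j) = 0} ≤ 0 := by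
    refine le_of_forall_pos_le_add fun e he => ?_
    have h2 := hP.margin (e / P.L) (div_pos he hP.L_pos) i j hij
    rw [mul_div_cancel₀ _ hP.L_pos.ne'] at h2
    rw [zero_add]
    refine le_trans (measureReal_mono fun x hx => ?_) h2
    rw [Set.mem_ofPred_eq] at *
    rw [hx, abs_zero]; exact (div_pos he hP.L_pos).le
  have h2 := (measureReal_eq_zero_iff (μ := P.law)).1 (le_antisymm h1 measureReal_nonneg)
  rw [ae_iff]
  simpa using h2

lemma ae_exists_isOptArm (hM : 2 ≤ M) : ∀ᵐ x ∂P.law, ∃ i, P.IsOptArm x.1 i := by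
  have h1 : ∀ᵐ x ∂P.law, ∀ i j : Fin M, i ≠ j → x.1 ⬝ᵥ (P.α i - P.α j) ≠ 0 := by
    rw [ae_all_iff]; intro i
    rw [ae_all_iff]; intro j
    by_cases h : i = j
    · simp [h]
    · filter_upwards [hP.ae_dotProduct_ne_zero h] with x hx _ using hx
  filter_upwards [h1] with x hx
  have : Nonempty (Fin M) := ⟨⟨0, by omega⟩⟩
  obtain ⟨i, hi⟩ := Finite.exists_max fun i => x.1 ⬝ᵥ P.α i
  refine ⟨i, fun j hj => lt_of_le_of_ne ?_ (hx i j hj.symm).symm⟩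
  rw [dotProduct_sub]
  linarith [hi j]

lemma p_pos (hM : 2 ≤ M) : 1 ≤ p := by
  have := hP.prob
  by_contra h
  obtain rfl : p = 0 := by omega
  have h1 := hP.ae_dotProduct_ne_zero (i := ⟨0, by omega⟩) (j := ⟨1, by omega⟩) (by simp)
  simp [dotProduct] at h1
  exact IsProbabilityMeasure.ne_zero P.law h1

lemma q_ge (hM : 2 ≤ M) : 2 ≤ q :=
  hM.trans ((Nat.le_mul_of_pos_right M (hP.p_pos hM)).trans hP.enough_iv)

lemma integral_mul_le_of_bdd {f g : Obs p q → ℝ} (hf : Measurable f) (hg : Measurable g)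
    {a b : ℝ} (ha : ∀ᵐ x ∂P.law, |f x| ≤ a) (hb : ∀ᵐ x ∂P.law, |g x| ≤ b) :
    Integrable (fun x => f x * g x) P.law ∧ |∫ x, f x * g x ∂P.law| ≤ a * b := by
  have := hP.prob
  have h : ∀ᵐ x ∂P.law, ‖f x * g x‖ ≤ a * b := by
    filter_upwards [ha, hb] with x h1 h2
    rw [Real.norm_eq_abs, abs_mul]
    exact mul_le_mul h1 h2 (abs_nonneg _) ((abs_nonneg _).trans h1)
  refine ⟨Integrable.of_bound (by fun_prop) _ h, ?_⟩
  have := norm_integral_le_of_norm_le_const h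
  simpa using this

lemma v_bdd' (k : Fin p) : ∀ᵐ x ∂P.law, |x.1 k| ≤ P.vbar := by
  filter_upwards [hP.v_bdd] with x hx using hx k

lemma z_bdd' (l : Fin q) : ∀ᵐ x ∂P.law, |x.2.1 l| ≤ P.zbar := by
  filter_upwards [hP.z_bdd] with x hx using hx l

lemma vStar_bdd (i : Fin M) (k : Fin p) : ∀ᵐ x ∂P.law, |P.vStar x.1 (i, k)| ≤ P.vbar := by
  filter_upwards [hP.v_bdd' k] with x hx
  unfold vStar
  split_ifs
  · exact hx
  · simpa using hP.vbar_pos.le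

lemma integrable_vStar_mul (i : Fin M) (k : Fin p) (l : Fin q) :
    Integrable (fun x => P.vStar x.1 (i, k) * x.2.1 l) P.law :=
  (hP.integral_mul_le_of_bdd (P.measurable_vStar_fst i k) (by fun_prop) (hP.vStar_bdd i k)
    (hP.z_bdd' l)).1

/-! #### Covariance matrices -/

lemma card_le : Fintype.card (Fin M × Fin p) ≤ Fintype.card (Fin q) := by
  simpa using hP.enough_iv

lemma nonempty_index (hM : 2 ≤ M) : Nonempty (Fin M × Fin p) :=
  ⟨(⟨0, by omega⟩, ⟨0, hP.p_pos hM⟩)⟩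

lemma nonempty_q (hM : 2 ≤ M) : Nonempty (Fin q) := ⟨⟨0, by have := hP.q_ge hM; omega⟩⟩

lemma vecMul_sigmaVZStar_ne_zero {x : Fin M × Fin p → ℝ} (hx : x ≠ 0) :
    x ᵥ* P.SigmaVZStar ≠ 0 := by
  intro h
  have h1 : P.SigmaVZStarᵀ.rank = M * p := by rw [Matrix.rank_transpose]; exact hP.full_rank
  have h2 := LinearMap.finrank_range_add_finrank_ker P.SigmaVZStarᵀ.mulVecLin
  rw [← Matrix.rank, h1] at h2
  simp only [Module.finrank_fintype_fun_eq_card, Fintype.card_prod, Fintype.card_fin,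
    Nat.add_eq_left, Submodule.finrank_eq_zero] at h2
  have h3 : x ∈ LinearMap.ker P.SigmaVZStarᵀ.mulVecLin := by
    rw [LinearMap.mem_ker, mulVecLin_apply, mulVec_transpose, h]
  rw [h2] at h3
  exact hx (by simpa using h3)

lemma phiMin_sigmaVZStar_pos (hM : 2 ≤ M) : 0 < phiMin P.SigmaVZStar := by
  have := hP.nonempty_index hM
  exact phiMin_pos_of_vecMul_ne_zero hP.card_le fun x hx => hP.vecMul_sigmaVZStar_ne_zero hx

lemma phiMin_sigmaZZ_pos (hM : 2 ≤ M) : 0 < phiMin P.SigmaZZ := by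
  have := hP.nonempty_q hM
  exact posDef_phiMin_pos hP.posDef

lemma phiMin_sigmaZZ_le (hM : 2 ≤ M) : phiMin P.SigmaZZ ≤ P.zbar ^ 2 := by
  set l : Fin q := ⟨0, by have := hP.q_ge hM; omega⟩
  have h1 := posDef_phiMin_le hP.posDef (Pi.single l 1)
  have h2 := (hP.integral_mul_le_of_bdd (f := fun x => x.2.1 l) (g := fun x => x.2.1 l)
    (by fun_prop) (by fun_prop) (hP.z_bdd' l) (hP.z_bdd' l)).2
  simp only [single_dotProduct, Pi.single_eq_same, mul_one, one_mul, mulVec_single_one,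
    col_apply] at h1
  calc _ ≤ _ := h1
    _ ≤ _ := le_abs_self _
    _ ≤ _ := h2
    _ = _ := by ring

lemma phiMin_sigmaVZStar_le (hM : 2 ≤ M) :
    phiMin P.SigmaVZStar ≤ √q * (P.vbar * P.zbar) := by
  obtain ⟨⟨i, k⟩⟩ := hP.nonempty_index hM
  have h1 := phiMin_mul_le hP.card_le (A := P.SigmaVZStar) (Pi.single (i, k) 1)
  rw [euclNorm_single, abs_one, mul_one, single_one_vecMul] at h1
  refine h1.trans ?_
  have h2 := euclNorm_le_of_abs_le (x := P.SigmaVZStar.row (i, k)) (d := P.vbar * P.zbar)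
    (mul_pos hP.vbar_pos hP.zbar_pos).le fun l =>
      (hP.integral_mul_le_of_bdd (P.measurable_vStar_fst i k) (by fun_prop) (hP.vStar_bdd i k)
        (hP.z_bdd' l)).2
  simpa using h2

end Assumption

/-- `E[v zᵀ]`, the covariance matrix of covariates and instruments without a selected arm. -/
def SigmaVZ (P : IVModel M p q) : Matrix (Fin p) (Fin q) ℝ :=
  Matrix.of fun k l => ∫ x, x.1 k * x.2.1 l ∂P.law

/-- The stacked vector whose only nonzero block is `x`, in place `i`. -/
def blockVec {n : Type*} (i : Fin M) (x : n → ℝ) : Fin M × n → ℝ :=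
  fun jk => if jk.1 = i then x jk.2 else 0

lemma blockVec_dotProduct {n : Type*} [Fintype n] (i : Fin M) (x : n → ℝ) (y : Fin M × n → ℝ) :
    blockVec i x ⬝ᵥ y = x ⬝ᵥ fun k => y (i, k) := by
  simp only [dotProduct, blockVec, Fintype.sum_prod_type]
  rw [Finset.sum_eq_single i (fun j _ hj => by simp [hj]) (by simp)]
  simp

lemma euclNorm_blockVec {n : Type*} [Fintype n] (i : Fin M) (x : n → ℝ) :
    euclNorm (blockVec i x) = euclNorm x := by
  rw [euclNorm, blockVec_dotProduct]; simp [blockVec, euclNorm]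

lemma sum_integral_ite_mul_ite (f g : Obs p q → ℝ) (i j : Fin M) :
    ∑ m : Fin M, ∫ x, (if m = i then f x else 0) * (if m = j then g x else 0) ∂P.law =
      if i = j then ∫ x, f x * g x ∂P.law else 0 := by
  rw [Finset.sum_eq_single i (fun m _ hm => by simp [hm]) (by simp)]
  by_cases h : i = j
  · subst h; simp
  · simp [h]

lemma sigmaVZBreve_apply (i j : Fin M) (k : Fin p) (l : Fin q) :
    P.SigmaVZBreve (i, k) (j, l) = if i = j then (M : ℝ)⁻¹ * P.SigmaVZ k l else 0 := by
  simp only [SigmaVZBreve, SigmaVZ, of_apply]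
  rw [sum_integral_ite_mul_ite (fun x => x.1 k) (fun x => x.2.1 l)]
  split_ifs <;> simp

lemma sigmaZZBreve_apply (i j : Fin M) (k l : Fin q) :
    P.SigmaZZBreve (i, k) (j, l) = if i = j then (M : ℝ)⁻¹ * P.SigmaZZ k l else 0 := by
  simp only [SigmaZZBreve, SigmaZZ, of_apply]
  rw [sum_integral_ite_mul_ite (fun x => x.2.1 k) (fun x => x.2.1 l)]
  split_ifs <;> simp

lemma vecMul_sigmaVZBreve (X : Fin M × Fin p → ℝ) (j : Fin M) (l : Fin q) :
    (X ᵥ* P.SigmaVZBreve) (j, l) = ((fun k => X (j, k)) ᵥ* ((M : ℝ)⁻¹ • P.SigmaVZ)) l := by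
  simp only [vecMul, dotProduct, Fintype.sum_prod_type, sigmaVZBreve_apply, Matrix.smul_apply,
    smul_eq_mul]
  rw [Finset.sum_eq_single j (fun i _ hi => by simp [hi]) (by simp)]
  simp

lemma sigmaZZBreve_mulVec (X : Fin M × Fin q → ℝ) (j : Fin M) (l : Fin q) :
    (P.SigmaZZBreve *ᵥ X) (j, l) = (((M : ℝ)⁻¹ • P.SigmaZZ) *ᵥ fun k => X (j, k)) l := by
  simp only [mulVec, dotProduct, Fintype.sum_prod_type, sigmaZZBreve_apply, Matrix.smul_apply,
    smul_eq_mul]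
  rw [Finset.sum_eq_single j (fun i _ hi => by simp [hi.symm]) (by simp)]
  simp

lemma quadForm_sigmaZZBreve (i : Fin M) (y : Fin q → ℝ) :
    blockVec i y ⬝ᵥ (P.SigmaZZBreve *ᵥ blockVec i y) =
      y ⬝ᵥ (((M : ℝ)⁻¹ • P.SigmaZZ) *ᵥ y) := by
  rw [blockVec_dotProduct]
  congr 1
  ext l
  rw [sigmaZZBreve_mulVec]
  simp [blockVec]

namespace Assumption

variable (hP : P.Assumption)
include hP

/-- Almost surely some arm is optimal, so that the blocks of `Σ*_vz` add up to `E[v zᵀ]`. -/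
lemma sum_sigmaVZStar (hM : 2 ≤ M) (k : Fin p) (l : Fin q) :
    ∑ i, P.SigmaVZStar (i, k) l = P.SigmaVZ k l := by
  simp only [SigmaVZStar, SigmaVZ, of_apply]
  rw [← integral_finsetSum _ fun i _ => hP.integrable_vStar_mul i k l]
  refine integral_congr_ae ?_
  filter_upwards [hP.ae_exists_isOptArm hM] with x ⟨i, hi⟩
  rw [Finset.sum_eq_single i (fun j _ hj => ?_) (by simp)]
  · simp [vStar, hi]
  · have : ¬ P.IsOptArm x.1 j := fun h => hj (h.unique hi)
    simp [vStar, this]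

lemma card_breve_le : Fintype.card (Fin M × Fin p) ≤ Fintype.card (Fin M × Fin q) := by
  simp only [Fintype.card_prod, Fintype.card_fin]
  rcases Nat.eq_zero_or_pos M with rfl | h
  · simp
  · exact Nat.mul_le_mul_left _ ((Nat.le_mul_of_pos_left p h).trans hP.enough_iv)

lemma phiMin_sigmaVZBreve_pos (hM : 2 ≤ M) : 0 < phiMin P.SigmaVZBreve := by
  have := hP.nonempty_index hM
  refine phiMin_pos_of_vecMul_ne_zero hP.card_breve_le fun X hX h => ?_
  obtain ⟨⟨j, k⟩, hjk⟩ := Function.ne_iff.1 hX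
  set x : Fin p → ℝ := fun k => X (j, k) with hx
  have h1 : x ᵥ* P.SigmaVZ = 0 := by
    ext l
    have h2 := congrFun h (j, l)
    rw [vecMul_sigmaVZBreve, vecMul_smul] at h2
    simpa [show M ≠ 0 by omega] using h2
  refine hP.vecMul_sigmaVZStar_ne_zero (x := fun ik => x ik.2) (fun h0 => ?_) ?_
  · exact hjk (congrFun h0 (j, k))
  · ext l
    rw [← h1]
    simp only [vecMul, dotProduct, Fintype.sum_prod_type]
    rw [Finset.sum_comm]
    refine Finset.sum_congr rfl fun k _ => ?_
    rw [← hP.sum_sigmaVZStar hM, Finset.mul_sum]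

lemma posDef_sigmaZZBreve (hM : 2 ≤ M) : P.SigmaZZBreve.PosDef := by
  refine PosDef.of_dotProduct_mulVec_pos ?_ fun {X} hX => ?_
  · ext ⟨i, k⟩ ⟨j, l⟩
    have h1 : P.SigmaZZ l k = P.SigmaZZ k l := by simp only [SigmaZZ, of_apply, mul_comm]
    simp only [conjTranspose_apply, star_trivial, sigmaZZBreve_apply, h1, eq_comm]
  · have h1 : star X ⬝ᵥ (P.SigmaZZBreve *ᵥ X) = ∑ i, (M : ℝ)⁻¹ *
        ((fun k => X (i, k)) ⬝ᵥ (P.SigmaZZ *ᵥ fun k => X (i, k))) := by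
      rw [star_trivial, dotProduct, Fintype.sum_prod_type]
      refine Finset.sum_congr rfl fun i _ => ?_
      simp only [sigmaZZBreve_mulVec, smul_mulVec, Pi.smul_apply, smul_eq_mul, dotProduct]
      rw [Finset.mul_sum]
      exact Finset.sum_congr rfl fun k _ => by ring
    rw [h1]
    obtain ⟨⟨j, k⟩, hjk⟩ := Function.ne_iff.1 hX
    have hM' : (0 : ℝ) < (M : ℝ)⁻¹ := by positivity
    refine Finset.sum_pos' (fun i _ => mul_nonneg hM'.le ?_) ⟨j, Finset.mem_univ _,
      mul_pos hM' ?_⟩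
    · simpa using hP.posDef.posSemidef.dotProduct_mulVec_nonneg fun k => X (i, k)
    · simpa using hP.posDef.dotProduct_mulVec_pos (x := fun k => X (j, k))
        fun h0 => hjk (congrFun h0 k)

lemma phiMin_sigmaZZBreve_pos (hM : 2 ≤ M) : 0 < phiMin P.SigmaZZBreve := by
  have : Nonempty (Fin M × Fin q) := by
    have := hP.nonempty_q hM
    exact ⟨(⟨0, by omega⟩, Classical.arbitrary _)⟩
  exact posDef_phiMin_pos (hP.posDef_sigmaZZBreve hM)

/-- The smallest singular value of the block diagonal matrix `Σ̆_vz` bounds its blocks. -/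
lemma phiMin_sigmaVZBreve_mul_le (hM : 2 ≤ M) (x : Fin p → ℝ) :
    phiMin P.SigmaVZBreve * euclNorm x ≤ euclNorm (x ᵥ* ((M : ℝ)⁻¹ • P.SigmaVZ)) := by
  have i : Fin M := ⟨0, by omega⟩
  have h1 := phiMin_mul_le hP.card_breve_le (A := P.SigmaVZBreve) (blockVec i x)
  have h2 : blockVec i x ᵥ* P.SigmaVZBreve = blockVec i (x ᵥ* ((M : ℝ)⁻¹ • P.SigmaVZ)) := by
    ext ⟨j, l⟩
    rw [vecMul_sigmaVZBreve]
    by_cases h : j = i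
    · simp [blockVec, h]
    · simp only [blockVec, h, if_false]
      exact congrFun (zero_vecMul _) l
  rwa [h2, euclNorm_blockVec, euclNorm_blockVec] at h1

lemma phiMin_sigmaZZBreve_le (hM : 2 ≤ M) (y : Fin q → ℝ) :
    phiMin P.SigmaZZBreve * (y ⬝ᵥ y) ≤ y ⬝ᵥ (((M : ℝ)⁻¹ • P.SigmaZZ) *ᵥ y) := by
  have i : Fin M := ⟨0, by omega⟩
  have h1 := posDef_phiMin_le (hP.posDef_sigmaZZBreve hM) (blockVec i y)
  rwa [quadForm_sigmaZZBreve, ← euclNorm_sq, euclNorm_blockVec, euclNorm_sq] at h1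

lemma le_phiMax_sigmaZZBreve (hM : 2 ≤ M) (y : Fin q → ℝ) :
    y ⬝ᵥ (((M : ℝ)⁻¹ • P.SigmaZZ) *ᵥ y) ≤ phiMax P.SigmaZZBreve * (y ⬝ᵥ y) := by
  have i : Fin M := ⟨0, by omega⟩
  have h1 := posDef_le_phiMax (hP.posDef_sigmaZZBreve hM) (blockVec i y)
  rwa [quadForm_sigmaZZBreve, ← euclNorm_sq, euclNorm_blockVec, euclNorm_sq] at h1

/-! #### The noise -/

lemma noise_subgaussian : HasSubgaussianMGF (fun x : Obs p q => x.2.2) (P.ς ^ 2) P.law := by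
  have := hP.noise_subG
  simpa [hP.noise_mean] using this

lemma integral_noise_sq : ∫ x, x.2.2 ^ 2 ∂P.law = P.sigmaSq := by
  rw [sigmaSq, variance_eq_integral (by fun_prop), hP.noise_mean]
  simp

lemma integral_noise_sq_sub : ∫ x, (x.2.2 ^ 2 - P.sigmaSq) ∂P.law = 0 := by
  have := hP.prob
  rw [integral_sub (hP.noise_subgaussian.memLp 2).integrable_sq (integrable_const _),
    hP.integral_noise_sq]
  simp

/-- Every `w > K_ε` is admissible in the definition of the sub-exponential norm; here the
finiteness of the norm enters. -/
lemma lintegral_exp_noise_le {w : ℝ} (h : P.Keps < w) :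
    ∫⁻ x, ENNReal.ofReal (Real.exp (|x.2.2 ^ 2 - P.sigmaSq| / w)) ∂P.law ≤ 2 := by
  have := hP.prob
  have hmeas : Measurable fun x : Obs p q => x.2.2 ^ 2 - P.sigmaSq := by fun_prop
  have hne : {w : ℝ | 0 < w ∧ ∫⁻ x, ENNReal.ofReal
      (Real.exp (|x.2.2 ^ 2 - P.sigmaSq| / w)) ∂P.law ≤ 2}.Nonempty := by
    obtain ⟨b, hb, hfin⟩ := exists_lintegral_exp_sq_lt_top hP.noise_subgaussian (by fun_prop)
    refine exists_lintegral_exp_le_two hmeas hb (lt_of_le_of_lt (b :=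
      ENNReal.ofReal (Real.exp (b * P.sigmaSq)) *
        ∫⁻ x, ENNReal.ofReal (Real.exp (b * x.2.2 ^ 2)) ∂P.law) ?_
      (ENNReal.mul_lt_top ENNReal.ofReal_lt_top hfin))
    rw [← lintegral_const_mul _ (by fun_prop)]
    refine lintegral_mono fun x => ?_
    rw [← ENNReal.ofReal_mul (Real.exp_nonneg _), ← Real.exp_add, ← mul_add]
    refine ENNReal.ofReal_le_ofReal (Real.exp_le_exp.2 (mul_le_mul_of_nonneg_left ?_ hb.le))
    have h1 := P.sigmaSq_nonneg
    have h2 := sq_nonneg x.2.2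
    rw [abs_le]; constructor <;> linarith
  obtain ⟨w', ⟨h1, h2⟩, h3⟩ := exists_lt_of_csInf_lt hne h
  refine le_trans (lintegral_mono fun x => ENNReal.ofReal_le_ofReal (Real.exp_le_exp.2 ?_)) h2
  gcongr

/-! #### Margins -/

lemma measureReal_isOptArm_sum (hM : 2 ≤ M) : ∑ i, P.law.real {x | P.IsOptArm x.1 i} = 1 := by
  have := hP.prob
  have hmeas : ∀ i, MeasurableSet {x : Obs p q | P.IsOptArm x.1 i} := fun i =>
    measurable_fst (P.measurableSet_isOptArm i)
  rw [← measureReal_iUnion_fintype (fun i j hij => ?_) hmeas]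
  · have : (⋃ i, {x : Obs p q | P.IsOptArm x.1 i}) =ᵐ[P.law] Set.univ := by
      rw [ae_eq_univ]
      have := hP.ae_exists_isOptArm hM
      rw [ae_iff] at this
      convert this using 2
      ext x; simp
    rw [measureReal_congr this]; simp
  · rw [Function.onFun, Set.disjoint_left]
    intro x hx hx'
    exact hij (IsOptArm.unique hx hx')

lemma optMargin_pos (hM : 2 ≤ M) {Lo : ℝ} (h : P.IsOptMargin Lo) : 0 < Lo := by
  have := hP.prob
  by_contra! hLo
  have hM1 : (0 : ℝ) < (M : ℝ) - 1 := by
    have : (2 : ℝ) ≤ M := by exact_mod_cast hM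
    linarith
  -- Otherwise no gap at the optimal arm is at most the almost sure bound `c`.
  have hzero : ∀ c : ℝ, 0 < c → ∀ i j : Fin M, j ≠ i →
      P.law.real {x | P.IsOptArm x.1 i ∧ |x.1 ⬝ᵥ (P.α j - P.α i)| ≤ c} = 0 := by
    intro c hc i j hij
    have h1 := (h c hc).trans
      (mul_nonpos_of_nonpos_of_nonneg (mul_nonpos_of_nonneg_of_nonpos hM1.le hLo) hc.le)
    have h2 : ∀ i, 0 ≤ ∑ j ∈ Finset.univ.erase i,
        P.law.real {x | P.IsOptArm x.1 i ∧ |x.1 ⬝ᵥ (P.α j - P.α i)| ≤ c} :=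
      fun i => Finset.sum_nonneg fun j _ => measureReal_nonneg
    have h3 := (Finset.sum_eq_zero_iff_of_nonneg fun i _ => h2 i).1
      (le_antisymm h1 (Finset.sum_nonneg fun i _ => h2 i)) i (Finset.mem_univ i)
    exact (Finset.sum_eq_zero_iff_of_nonneg fun j _ => measureReal_nonneg).1 h3 j
      (Finset.mem_erase.2 ⟨hij, Finset.mem_univ _⟩)
  have hopt : ∀ i, P.law.real {x | P.IsOptArm x.1 i} = 0 := by
    intro i
    obtain ⟨j, hj⟩ : ∃ j, j ≠ i := by
      have : Nontrivial (Fin M) := Fin.nontrivial_iff_two_le.2 hM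
      exact exists_ne i
    set c := √p * P.vbar * euclNorm (P.α j - P.α i) + 1
    have hc : 0 < c := by
      have h1 := euclNorm_nonneg (P.α j - P.α i)
      have h2 := hP.vbar_pos
      positivity
    rw [← hzero c hc i j hj]
    refine measureReal_congr ?_
    filter_upwards [hP.v_bdd] with x hx
    refine propext ⟨fun h => ⟨h, ?_⟩, fun h => h.1⟩
    refine (abs_dotProduct_le _ _).trans ?_
    have h1 := euclNorm_le_of_abs_le hP.vbar_pos.le hx
    simp only [Fintype.card_fin] at h1
    have h2 := mul_le_mul_of_nonneg_right h1 (euclNorm_nonneg (P.α j - P.α i))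
    linarith
  have h1 := hP.measureReal_isOptArm_sum hM
  simp [hopt] at h1

lemma isOptMargin (hM : 2 ≤ M) : P.IsOptMargin (M * P.L / 2) := by
  have := hP.prob
  intro c hc
  set S : Fin M → Fin M → Set (Obs p q) :=
    fun i j => {x | P.IsOptArm x.1 i ∧ |x.1 ⬝ᵥ (P.α j - P.α i)| ≤ c}
  have hmeas : ∀ i j, MeasurableSet (S i j) := fun i j =>
    (measurable_fst (P.measurableSet_isOptArm i)).inter
      (measurableSet_le (measurable_dotProduct_const measurable_fst _).abs measurable_const)
  -- At most one of the arms `i`, `j` is optimal, so the two events do not overlap.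
  have hpair : ∀ i j, i ≠ j → P.law.real (S i j) + P.law.real (S j i) ≤ P.L * c := by
    intro i j hij
    rw [← measureReal_union (Set.disjoint_left.2 fun x hx hx' => hij (hx.1.unique hx'.1))
      (hmeas j i)]
    refine le_trans (measureReal_mono fun x hx => ?_) (hP.margin c hc i j hij)
    rcases hx with hx | hx
    · have := hx.2
      rw [← neg_sub, dotProduct_neg, abs_neg] at this
      exact this
    · exact hx.2
  have h1 : 2 * ∑ i, ∑ j ∈ Finset.univ.erase i, P.law.real (S i j) =
      ∑ i, ∑ j ∈ Finset.univ.erase i, (P.law.real (S i j) + P.law.real (S j i)) := by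
    simp only [Finset.sum_add_distrib]
    rw [two_mul]
    congr 1
    simp only [← Finset.filter_ne', Finset.sum_filter]
    rw [Finset.sum_comm]
    simp only [ne_comm]
  have h2 : ∑ i : Fin M, ∑ j ∈ Finset.univ.erase i, (P.law.real (S i j) + P.law.real (S j i)) ≤
      ∑ i : Fin M, ∑ _j ∈ Finset.univ.erase i, P.L * c :=
    Finset.sum_le_sum fun i _ => Finset.sum_le_sum fun j hj =>
      hpair i j (Finset.ne_of_mem_erase hj).symm
  have h3 : ∑ i : Fin M, ∑ _j ∈ Finset.univ.erase i, P.L * c =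
      M * (((M : ℝ) - 1) * (P.L * c)) := by
    simp [Finset.card_erase_of_mem, Nat.cast_sub (show 1 ≤ M by omega)]
  change ∑ i, ∑ j ∈ Finset.univ.erase i, P.law.real (S i j) ≤ _
  nlinarith

end Assumption

end IVModel

/-! ### Deviations along a run of the algorithm -/

section Tails

variable {Ω : Type*} [MeasurableSpace Ω] {μ : Measure Ω}

/-- Hoeffding's inequality in the form used for the good event: the sum over `S` exceeds `thr` with
probability at most `2 e ^ (-E)` if `thr ^ 2 ≥ 2 E b ^ 2 |S|`. -/
lemma subgaussian_sum_tail {S : Finset ℕ} {Y : ℕ → Ω → ℝ} (hind : iIndepFun (fun s : S => Y s) μ)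
    {b : ℝ} (hb : 0 ≤ b) (h : ∀ s ∈ S, HasSubgaussianMGF (Y s) (Real.toNNReal b ^ 2) μ)
    {E thr : ℝ} (hE : 0 ≤ E) (hthr : 0 ≤ thr) (hle : 2 * E * b ^ 2 * S.card ≤ thr ^ 2) :
    μ.real {ω | thr < |∑ s ∈ S, Y s ω|} ≤ 2 * Real.exp (-E) := by
  have : IsProbabilityMeasure μ := hind.isProbabilityMeasure
  have h1 := HasSubgaussianMGF.sum_of_iIndepFun hind (s := Finset.univ)
    (c := fun _ => Real.toNNReal b ^ 2) fun s _ => h s s.2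
  have h2 := subgaussian_tail_abs h1 (Real.sqrt_nonneg (2 * E))
  have h3 : -√(2 * E) ^ 2 / 2 = -E := by rw [Real.sq_sqrt (by positivity)]; ring
  rw [h3] at h2
  refine le_trans (measureReal_mono fun ω hω => ?_) h2
  rw [Set.mem_ofPred_eq] at *
  rw [Finset.sum_coe_sort S (fun s => Y s ω)]
  refine lt_of_le_of_lt ?_ hω
  rw [← Real.sqrt_mul (by positivity)]
  refine Real.sqrt_le_iff.2 ⟨hthr, le_trans (le_of_eq ?_) hle⟩
  simp only [Finset.sum_const, Finset.card_univ, Fintype.card_coe, nsmul_eq_mul, NNReal.coe_mul,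
    NNReal.coe_natCast, NNReal.coe_pow, Real.coe_toNNReal b hb]
  ring

lemma subgaussian_of_bdd [IsProbabilityMeasure μ] {f : Ω → ℝ} (hf : AEMeasurable f μ) {b : ℝ}
    (h : ∀ᵐ ω ∂μ, |f ω| ≤ b) :
    HasSubgaussianMGF (fun ω => f ω - ∫ ω, f ω ∂μ) (Real.toNNReal b ^ 2) μ := by
  have hb : 0 ≤ b := by
    obtain ⟨ω, hω⟩ := h.exists
    exact (abs_nonneg _).trans hω
  have h1 := hasSubgaussianMGF_of_mem_Icc hf (a := -b) (b := b) (by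
    filter_upwards [h] with ω hω using ⟨(abs_le.1 hω).1, (abs_le.1 hω).2⟩)
  convert h1 using 2
  ext
  rw [Real.coe_toNNReal b hb, NNReal.coe_div, coe_nnnorm, Real.norm_eq_abs, sub_neg_eq_add,
    abs_of_nonneg (by positivity)]
  simp

end Tails

namespace IVModel

variable {M p q : ℕ} {P : IVModel M p q} {Ω : Type*} [MeasurableSpace Ω] {μ : Measure Ω}
  {θ : ℝ} {T1 T2 T : ℕ} {X : ℕ → Ω → Obs p q} {a : ℕ → Ω → Fin M}

namespace IsRun

variable (hr : P.IsRun θ T1 T2 T μ X a)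
include hr

lemma ae_of_law {π : Obs p q → Prop} (h : ∀ᵐ x ∂P.law, π x) :
    ∀ᵐ ω ∂μ, ∀ s ∈ Finset.Icc 1 T, π (X s ω) := by
  rw [Filter.eventually_all_finset]
  intro s hs
  rw [← hr.law_X s hs] at h
  exact ae_of_ae_map (hr.measurable_X s hs).aemeasurable h

lemma integral_comp {s : ℕ} (hs : s ∈ Finset.Icc 1 T) {f : Obs p q → ℝ} (hf : Measurable f) :
    ∫ ω, f (X s ω) ∂μ = ∫ x, f x ∂P.law := by
  rw [← hr.law_X s hs, integral_map (hr.measurable_X s hs).aemeasurable hf.aestronglyMeasurable]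

lemma measureReal_preimage {s : ℕ} (hs : s ∈ Finset.Icc 1 T) {A : Set (Obs p q)}
    (hA : MeasurableSet A) : μ.real {ω | X s ω ∈ A} = P.law.real A := by
  rw [← hr.law_X s hs, map_measureReal_apply (hr.measurable_X s hs) hA]
  rfl

lemma iIndepFun_comp {S : Finset ℕ} (hS : S ⊆ Finset.Icc 1 T) {f : Obs p q → ℝ}
    (hf : Measurable f) : iIndepFun (fun (s : S) ω => f (X s ω)) μ := by
  have h1 := hr.indep_X.precomp (g := fun s : S => (⟨s, hS s.2⟩ : Finset.Icc 1 T))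
    (fun s t h => Subtype.ext (Subtype.mk.inj h))
  exact h1.comp (fun _ => f) fun _ => hf

lemma subgaussian_comp {s : ℕ} (hs : s ∈ Finset.Icc 1 T) {f : Obs p q → ℝ} {c : ℝ≥0}
    (hf : HasSubgaussianMGF f c P.law) : HasSubgaussianMGF (fun ω => f (X s ω)) c μ := by
  rw [← hr.law_X s hs] at hf
  exact hf.of_map (hr.measurable_X s hs).aemeasurable

lemma sum_tail_of_subgaussian {S : Finset ℕ} (hS : S ⊆ Finset.Icc 1 T) {f : Obs p q → ℝ}
    (hf : Measurable f) {b : ℝ} (hb : 0 ≤ b)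
    (h : HasSubgaussianMGF f (Real.toNNReal b ^ 2) P.law) {E thr : ℝ} (hE : 0 ≤ E)
    (hthr : 0 ≤ thr) (hle : 2 * E * b ^ 2 * S.card ≤ thr ^ 2) :
    μ.real {ω | thr < |∑ s ∈ S, f (X s ω)|} ≤ 2 * Real.exp (-E) :=
  subgaussian_sum_tail (Y := fun s ω => f (X s ω)) (hr.iIndepFun_comp hS hf) hb
    (fun _ hs => hr.subgaussian_comp (hS hs) h) hE hthr hle

lemma sum_tail_of_bdd [IsProbabilityMeasure P.law] {S : Finset ℕ} (hS : S ⊆ Finset.Icc 1 T)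
    {f : Obs p q → ℝ} (hf : Measurable f) {b : ℝ} (hb : 0 ≤ b) (h : ∀ᵐ x ∂P.law, |f x| ≤ b)
    {E thr : ℝ} (hE : 0 ≤ E) (hthr : 0 ≤ thr) (hle : 2 * E * b ^ 2 * S.card ≤ thr ^ 2) :
    μ.real {ω | thr < |∑ s ∈ S, f (X s ω) - S.card * ∫ x, f x ∂P.law|} ≤ 2 * Real.exp (-E) := by
  have h1 := hr.sum_tail_of_subgaussian hS (hf.sub_const (∫ x, f x ∂P.law)) hb
    (subgaussian_of_bdd hf.aemeasurable h) hE hthr hle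
  simpa [Finset.sum_sub_distrib] using h1

lemma iIndepFun_pair (hT : T1 ≤ T) :
    iIndepFun (fun (s : Finset.Icc 1 T1) ω => (X s ω, a s ω)) μ := by
  have hS : Finset.Icc 1 T1 ⊆ Finset.Icc 1 T := Finset.Icc_subset_Icc_right hT
  have h1 := hr.indep_X.precomp (g := fun s : Finset.Icc 1 T1 => (⟨s, hS s.2⟩ : Finset.Icc 1 T))
    (fun s t h => Subtype.ext (Subtype.mk.inj h))
  refine iIndepFun_prodMk (X := fun (s : Finset.Icc 1 T1) ω => X s ω)
    (Y := fun (s : Finset.Icc 1 T1) ω => a s ω) (fun s => hr.measurable_X s (hS s.2))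
    (fun s => hr.measurable_a s (hS s.2)) h1 hr.indep_a ?_
  exact hr.indep_X_a.comp
    (φ := fun f (s : Finset.Icc 1 T1) => f ⟨s, hS s.2⟩) (ψ := id)
    (measurable_pi_lambda _ fun s => measurable_pi_apply _) measurable_id

/-- In the exploration phase the indicator of the pulled arm is independent of the data. -/
lemma integral_ite_mul (hT : T1 ≤ T) {s : ℕ} (hs : s ∈ Finset.Icc 1 T1) (i : Fin M)
    {f : Obs p q → ℝ} (hf : Measurable f) :
    ∫ ω, (if a s ω = i then f (X s ω) else 0) ∂μ = (M : ℝ)⁻¹ * ∫ x, f x ∂P.law := by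
  have hs' : s ∈ Finset.Icc 1 T := Finset.Icc_subset_Icc_right hT hs
  have hind : IndepFun (X s) (a s) μ := hr.indep_X_a.comp
    (φ := fun f : Finset.Icc 1 T → Obs p q => f ⟨s, hs'⟩)
    (ψ := fun g : Finset.Icc 1 T1 → Fin M => g ⟨s, hs⟩) (measurable_pi_apply _)
    (measurable_pi_apply _)
  have hg : Measurable fun j : Fin M => if j = i then (1 : ℝ) else 0 := measurable_of_finite _
  have h1 := (hind.comp hf hg).integral_fun_mul_eq_mul_integral
    (hf.comp (hr.measurable_X s hs')).aestronglyMeasurable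
    (hg.comp (hr.measurable_a s hs')).aestronglyMeasurable
  have h2 : ∫ ω, (if a s ω = i then (1 : ℝ) else 0) ∂μ = (M : ℝ)⁻¹ := by
    have h3 : MeasurableSet {ω | a s ω = i} := hr.measurable_a s hs' (measurableSet_singleton i)
    have h4 := integral_indicator_one (μ := μ) h3
    rw [Measure.real, hr.uniform_a s hs i, ENNReal.toReal_inv, ENNReal.toReal_natCast] at h4
    rw [← h4]
    refine integral_congr_ae (ae_of_all _ fun ω => ?_)
    simp [Set.indicator_apply]
  simp only [Function.comp_apply] at h1
  rw [h2, hr.integral_comp hs' hf] at h1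
  rw [mul_comm, ← h1]
  refine integral_congr_ae (ae_of_all _ fun ω => ?_)
  simp

lemma measurable_ite (hT : T1 ≤ T) {s : ℕ} (hs : s ∈ Finset.Icc 1 T1) (i : Fin M)
    {f : Obs p q → ℝ} (hf : Measurable f) :
    Measurable fun ω => if a s ω = i then f (X s ω) else 0 := by
  have hs' : s ∈ Finset.Icc 1 T := Finset.Icc_subset_Icc_right hT hs
  exact Measurable.ite (hr.measurable_a s hs' (measurableSet_singleton i))
    (hf.comp (hr.measurable_X s hs')) measurable_const

lemma iIndepFun_ite (hT : T1 ≤ T) (i : Fin M) {f : Obs p q → ℝ} (hf : Measurable f) (c : ℝ) :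
    iIndepFun (fun (s : Finset.Icc 1 T1) ω => (if a s ω = i then f (X s ω) else 0) - c) μ := by
  have h1 : Measurable fun y : Obs p q × Fin M => (if y.2 = i then f y.1 else 0) - c :=
    (Measurable.ite (measurable_snd (measurableSet_singleton i)) (hf.comp measurable_fst)
      measurable_const).sub_const _
  exact (hr.iIndepFun_pair hT).comp (fun _ => _) fun _ => h1

lemma explore_tail_of_bdd [IsProbabilityMeasure μ] (hT : T1 ≤ T) (i : Fin M)
    {f : Obs p q → ℝ} (hf : Measurable f) {b : ℝ} (hb : 0 ≤ b) (h : ∀ᵐ x ∂P.law, |f x| ≤ b)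
    {E thr : ℝ} (hE : 0 ≤ E) (hthr : 0 ≤ thr) (hle : 2 * E * b ^ 2 * T1 ≤ thr ^ 2) :
    μ.real {ω | thr < |∑ s ∈ Finset.Icc 1 T1, (if a s ω = i then f (X s ω) else 0) -
      T1 * ((M : ℝ)⁻¹ * ∫ x, f x ∂P.law)|} ≤ 2 * Real.exp (-E) := by
  have h1 := subgaussian_sum_tail (S := Finset.Icc 1 T1)
    (Y := fun s ω => (if a s ω = i then f (X s ω) else 0) - (M : ℝ)⁻¹ * ∫ x, f x ∂P.law)
    (hr.iIndepFun_ite hT i hf _) hb (fun s hs => ?_) hE hthr (by simpa using hle)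
  · simpa [Finset.sum_sub_distrib] using h1
  · rw [← hr.integral_ite_mul hT hs i hf]
    refine subgaussian_of_bdd (hr.measurable_ite hT hs i hf).aemeasurable ?_
    filter_upwards [hr.ae_of_law h] with ω hω
    split_ifs
    · exact hω s (Finset.Icc_subset_Icc_right hT hs)
    · simpa using hb

variable (hP : P.Assumption)
include hP

/-- The instrument times the noise is sub-Gaussian with variance proxy `2 (z̄ ς) ^ 2`. -/
lemma noise_tail [IsProbabilityMeasure μ] {S : Finset ℕ} (hS : S ⊆ Finset.Icc 1 T) (l : Fin q)
    {E thr : ℝ} (hE : 0 ≤ E) (hthr : 0 ≤ thr)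
    (hle : 4 * E * (P.zbar * P.ς) ^ 2 * S.card ≤ thr ^ 2) :
    μ.real {ω | thr < |∑ s ∈ S, (X s ω).2.1 l * (X s ω).2.2|} ≤ 2 * Real.exp (-E) := by
  have := hP.prob
  have hb : 0 ≤ √2 * (P.zbar * P.ς) := by have := hP.zbar_pos; positivity
  refine hr.sum_tail_of_subgaussian hS (f := fun x => x.2.1 l * x.2.2) (by fun_prop) hb ?_ hE hthr
    (by rw [mul_pow, Real.sq_sqrt (by norm_num)]; linarith)
  have h1 := subgaussian_of_abs_le hP.noise_subgaussian (Y := fun x => x.2.1 l * x.2.2)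
    (b := Real.toNNReal P.zbar) (by fun_prop) (by
      filter_upwards [hP.z_bdd' l] with x hx
      rw [abs_mul, Real.coe_toNNReal _ hP.zbar_pos.le]
      gcongr) (hP.valid_iv l)
  convert h1 using 1
  ext
  push_cast
  rw [Real.coe_toNNReal _ hb, Real.coe_toNNReal _ hP.zbar_pos.le, mul_pow,
    Real.sq_sqrt (by norm_num)]
  ring

lemma explore_noise_tail [IsProbabilityMeasure μ] (hT : T1 ≤ T) (i : Fin M) (l : Fin q)
    {E thr : ℝ} (hE : 0 ≤ E) (hthr : 0 ≤ thr)
    (hle : 4 * E * (P.zbar * P.ς) ^ 2 * T1 ≤ thr ^ 2) :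
    μ.real {ω | thr < |∑ s ∈ Finset.Icc 1 T1,
      (if a s ω = i then (X s ω).2.1 l * (X s ω).2.2 else 0)|} ≤ 2 * Real.exp (-E) := by
  have hb : 0 ≤ √2 * (P.zbar * P.ς) := by have := hP.zbar_pos; positivity
  have hf : Measurable fun x : Obs p q => x.2.1 l * x.2.2 := by fun_prop
  have hind := hr.iIndepFun_ite hT i hf 0
  simp only [sub_zero] at hind
  refine subgaussian_sum_tail (S := Finset.Icc 1 T1)
    (Y := fun s ω => if a s ω = i then (X s ω).2.1 l * (X s ω).2.2 else 0)
    hind hb (fun s hs => ?_) hE hthr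
    (by rw [mul_pow, Real.sq_sqrt (by norm_num)]; simp; linarith)
  have hs' : s ∈ Finset.Icc 1 T := Finset.Icc_subset_Icc_right hT hs
  have h1 := subgaussian_of_abs_le (hr.subgaussian_comp hs' hP.noise_subgaussian)
    (Y := fun ω => if a s ω = i then (X s ω).2.1 l * (X s ω).2.2 else 0)
    (b := Real.toNNReal P.zbar) (hr.measurable_ite hT hs i hf).aemeasurable (by
      filter_upwards [hr.ae_of_law (hP.z_bdd' l)] with ω hω
      rw [Real.coe_toNNReal _ hP.zbar_pos.le]
      have := hω s hs'
      split_ifs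
      · rw [abs_mul]; gcongr
      · rw [abs_zero]; exact mul_nonneg hP.zbar_pos.le (abs_nonneg _))
    (by rw [hr.integral_ite_mul hT hs i hf, hP.valid_iv l, mul_zero])
  convert h1 using 1
  ext
  push_cast
  rw [Real.coe_toNNReal _ hb, Real.coe_toNNReal _ hP.zbar_pos.le, mul_pow,
    Real.sq_sqrt (by norm_num)]
  ring

/-- Deviations of the empirical noise variance. If `K_ε = 0`, then any positive `w` serves as a
bound of the sub-exponential norm. -/
lemma noise_sq_tail {S : Finset ℕ} (hS : S ⊆ Finset.Icc 1 T) {Δ E : ℝ} (hΔ : 0 < Δ)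
    (hcard : 0 < S.card) (hE : 0 < E)
    (hE1 : 1024 * E * P.Keps ^ 2 ≤ S.card * Δ ^ 2)
    (hE2 : 16 * E * P.Keps ≤ S.card * Δ) :
    μ.real {ω | S.card * (P.sigmaSq + Δ / 2) < ∑ s ∈ S, (X s ω).2.2 ^ 2} ≤ Real.exp (-E) := by
  have : IsProbabilityMeasure μ := hr.indep_X.isProbabilityMeasure
  have hcard' : (0 : ℝ) < S.card := by exact_mod_cast hcard
  obtain ⟨w, hw, hKw, h1, h2⟩ : ∃ w : ℝ, 0 < w ∧ P.Keps < w ∧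
      256 * E * w ^ 2 ≤ S.card * Δ ^ 2 ∧ 8 * E * w ≤ S.card * Δ := by
    rcases P.Keps_nonneg.eq_or_lt with h0 | h0
    · set w := min (√(S.card * Δ ^ 2 / (256 * E))) (S.card * Δ / (8 * E)) with hw
      have hw0 : 0 < w := by positivity
      refine ⟨w, hw0, h0 ▸ hw0, ?_, ?_⟩
      · have h3 : w ^ 2 ≤ S.card * Δ ^ 2 / (256 * E) := by
          rw [← Real.sq_sqrt (by positivity : 0 ≤ S.card * Δ ^ 2 / (256 * E))]
          exact pow_le_pow_left₀ hw0.le (min_le_left _ _) 2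
        rw [le_div_iff₀ (by positivity)] at h3
        linarith
      · have h3 : w ≤ S.card * Δ / (8 * E) := min_le_right _ _
        rw [le_div_iff₀ (by positivity)] at h3
        linarith
    · exact ⟨2 * P.Keps, by positivity, by linarith, by linarith, by linarith⟩
  have hf : Measurable fun x : Obs p q => x.2.2 ^ 2 - P.sigmaSq := by fun_prop
  have h3 := bernstein_sum (hr.iIndepFun_comp hS hf)
    (fun s => hf.comp (hr.measurable_X s (hS s.2))) hw (fun s => ?_) (fun s => ?_)
    (half_pos hΔ) (E := E) ?_ ?_
  · refine le_trans (measureReal_mono fun ω hω => ?_) h3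
    rw [Set.mem_ofPred_eq] at *
    rw [Finset.sum_coe_sort S (fun s => (X s ω).2.2 ^ 2 - P.sigmaSq), Finset.sum_sub_distrib,
      Fintype.card_coe]
    simp only [Finset.sum_const, nsmul_eq_mul]
    linarith
  · have h4 := hP.lintegral_exp_noise_le hKw
    rwa [← hr.law_X s (hS s.2), lintegral_map (by fun_prop) (hr.measurable_X s (hS s.2))] at h4
  · rw [hr.integral_comp (hS s.2) hf, hP.integral_noise_sq_sub]
  · rw [Fintype.card_coe, ← mul_div_assoc, le_div_iff₀ (by positivity)]
    linarith
  · rw [Fintype.card_coe, ← mul_div_assoc, le_div_iff₀ (by positivity)]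
    linarith

end IsRun

end IVModel

/-! ### Two-stage least squares on well-conditioned samples -/

section Sample

variable {n m r : Type*} [Fintype n] [DecidableEq n] [Fintype m] [DecidableEq m]
  [Fintype r] [DecidableEq r]

/-- The error of two-stage least squares and the size of `(Vᵀ 𝒫[Z] V)⁻¹` when the sample moments
are within a tenth of population moments with singular values `φA ≤ ·` and `φB ≤ · ≤ ΦB`. The
constants come from `1.1 / (0.9 ^ 2 * 0.9) ≤ 8 / 5` and `1.1 / 0.9 ^ 2 ≤ 7 / 5`. -/
lemma coef2SLS_sample {V : Matrix n m ℝ} {Z : Matrix n r ℝ} {φA φB ΦB N : ℝ} (hA : 0 < φA)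
    (hB : 0 < φB) (hBB : φB ≤ ΦB) (hN : 0 < N)
    (hlo : ∀ y, 9 / 10 * φB * N * (y ⬝ᵥ y) ≤ (Z *ᵥ y) ⬝ᵥ (Z *ᵥ y))
    (hhi : ∀ y, (Z *ᵥ y) ⬝ᵥ (Z *ᵥ y) ≤ 11 / 10 * ΦB * N * (y ⬝ᵥ y))
    (hVZ : ∀ x, 9 / 10 * φA * N * euclNorm x ≤ euclNorm (Zᵀ *ᵥ (V *ᵥ x))) :
    (∀ α ε, euclNorm (coef2SLS V Z (V *ᵥ α + ε) - α) ^ 2 ≤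
      8 / 5 * (ΦB / (φA ^ 2 * φB)) * (euclNorm (Zᵀ *ᵥ ε) ^ 2 / N ^ 2)) ∧
    ∀ x, x ⬝ᵥ (omega2SLS V Z *ᵥ x) ≤ 7 / 5 * (ΦB / φA ^ 2) / N * (x ⬝ᵥ x) := by
  have hBB0 : 0 < ΦB := hB.trans_le hBB
  have hA' : ∀ x, (9 / 10 * φA * N) ^ 2 * (x ⬝ᵥ x) ≤ (Zᵀ *ᵥ (V *ᵥ x)) ⬝ᵥ (Zᵀ *ᵥ (V *ᵥ x)) := by
    intro x
    rw [← euclNorm_sq, ← euclNorm_sq, ← mul_pow]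
    have := euclNorm_nonneg x
    exact pow_le_pow_left₀ (by positivity) (hVZ x) 2
  constructor
  · intro α ε
    have h := coef2SLS_error (by positivity) (by positivity) (by positivity) hlo hhi hA' α ε
    rw [← euclNorm_sq, ← euclNorm_sq] at h
    refine h.trans ?_
    have h1 : 11 / 10 * ΦB * N / ((9 / 10 * φA * N) ^ 2 * (9 / 10 * φB * N)) =
        1100 / 729 * (ΦB / (φA ^ 2 * φB)) / N ^ 2 := by
      field_simp; norm_num
    have h2 : 0 ≤ ΦB / (φA ^ 2 * φB) * (euclNorm (Zᵀ *ᵥ ε) ^ 2 / N ^ 2) := by positivity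
    rw [h1]
    calc _ = 1100 / 729 * (ΦB / (φA ^ 2 * φB) * (euclNorm (Zᵀ *ᵥ ε) ^ 2 / N ^ 2)) := by ring
      _ ≤ 8 / 5 * (ΦB / (φA ^ 2 * φB) * (euclNorm (Zᵀ *ᵥ ε) ^ 2 / N ^ 2)) := by linarith
      _ = _ := by ring
  · intro x
    refine (omega2SLS_bound (by positivity) (by positivity) (by positivity) hlo hhi hA' x).trans ?_
    have h1 : 11 / 10 * ΦB * N / (9 / 10 * φA * N) ^ 2 = 110 / 81 * (ΦB / φA ^ 2) / N := by
      field_simp; norm_num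
    have := dotProduct_self_nonneg' x
    have h2 : 0 ≤ ΦB / φA ^ 2 / N * (x ⬝ᵥ x) := by positivity
    rw [h1]
    calc _ = 110 / 81 * (ΦB / φA ^ 2 / N * (x ⬝ᵥ x)) := by ring
      _ ≤ 7 / 5 * (ΦB / φA ^ 2 / N * (x ⬝ᵥ x)) := by linarith
      _ = _ := by ring

/-- Entrywise deviations of a sample moment matrix from `N * A`, as a bound on vectors. -/
lemma euclNorm_sum_smul_sub_le {S : Finset ℕ} {f : ℕ → m → ℝ} {g : ℕ → r → ℝ} {A : Matrix m r ℝ}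
    {N d : ℝ} (hd : 0 ≤ d) (h : ∀ i l, |∑ s ∈ S, f s i * g s l - N * A i l| ≤ d) (x : m → ℝ) :
    euclNorm (∑ s ∈ S, (f s ⬝ᵥ x) • g s - N • (x ᵥ* A)) ≤
      √(Fintype.card m * Fintype.card r) * d * euclNorm x := by
  set D : Matrix m r ℝ := Matrix.of fun i l => ∑ s ∈ S, f s i * g s l - N * A i l with hD
  have h1 : ∑ s ∈ S, (f s ⬝ᵥ x) • g s - N • (x ᵥ* A) = x ᵥ* D := by
    ext l
    simp only [Pi.sub_apply, Finset.sum_apply, Pi.smul_apply, smul_eq_mul, vecMul, dotProduct, hD,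
      of_apply, mul_sub, Finset.sum_sub_distrib, Finset.mul_sum, Finset.sum_mul]
    congr 1
    · rw [Finset.sum_comm]
      exact Finset.sum_congr rfl fun i _ => Finset.sum_congr rfl fun s _ => by ring
    · exact Finset.sum_congr rfl fun i _ => by ring
  rw [h1]
  exact euclNorm_vecMul_le_of_abs_le D hd h x

lemma abs_sum_sq_sub_le {S : Finset ℕ} {g : ℕ → r → ℝ} {B : Matrix r r ℝ}
    {N d : ℝ} (hd : 0 ≤ d) (h : ∀ i l, |∑ s ∈ S, g s i * g s l - N * B i l| ≤ d) (y : r → ℝ) :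
    |∑ s ∈ S, (g s ⬝ᵥ y) ^ 2 - N * (y ⬝ᵥ (B *ᵥ y))| ≤ Fintype.card r * d * (y ⬝ᵥ y) := by
  have h1 : ∑ s ∈ S, (g s ⬝ᵥ y) ^ 2 - N * (y ⬝ᵥ (B *ᵥ y)) =
      (∑ s ∈ S, (g s ⬝ᵥ y) • g s - N • (y ᵥ* B)) ⬝ᵥ y := by
    rw [sub_dotProduct, sum_dotProduct, smul_dotProduct, dotProduct_mulVec, smul_eq_mul]
    simp only [smul_dotProduct, smul_eq_mul, sq]
  rw [h1]
  refine (abs_dotProduct_le _ _).trans ?_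
  have h2 := euclNorm_sum_smul_sub_le hd h y
  rw [Real.sqrt_mul_self (by positivity)] at h2
  refine (mul_le_mul_of_nonneg_right h2 (euclNorm_nonneg y)).trans_eq ?_
  rw [← euclNorm_sq]; ring

end Sample

namespace History

variable {M p q : ℕ} (h : History M p q) (S : Finset ℕ)

lemma rowsZ_transpose_mulVec (u : ℕ → ℝ) :
    (h.rowsZ S)ᵀ *ᵥ (fun s : S => u s) = ∑ s ∈ S, u s • h.z s := by
  ext l
  simp only [mulVec, dotProduct, transpose_apply, rowsZ, of_apply, Finset.sum_apply,
    Pi.smul_apply, smul_eq_mul]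
  rw [Finset.sum_coe_sort S (fun s => h.z s l * u s)]
  exact Finset.sum_congr rfl fun s _ => mul_comm _ _

lemma rowsZ_mulVec_dotProduct (y : Fin q → ℝ) :
    (h.rowsZ S *ᵥ y) ⬝ᵥ (h.rowsZ S *ᵥ y) = ∑ s ∈ S, (h.z s ⬝ᵥ y) ^ 2 := by
  rw [← Finset.sum_coe_sort S]
  exact Finset.sum_congr rfl fun s _ => (sq _).symm

lemma rowsVTilde_mulVec (x : Fin M × Fin p → ℝ) :
    h.rowsVTilde S *ᵥ x = fun s : S => h.v s ⬝ᵥ fun k => x (h.arm s, k) := by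
  ext s
  simp only [mulVec, dotProduct, rowsVTilde, of_apply, Fintype.sum_prod_type]
  rw [Finset.sum_eq_single (h.arm s) (fun j _ hj => by simp [hj.symm]) (by simp)]
  simp

lemma rowsZ_transpose_mulVec_rowsV (x : Fin p → ℝ) :
    (h.rowsZ S)ᵀ *ᵥ (h.rowsV S *ᵥ x) = ∑ s ∈ S, (h.v s ⬝ᵥ x) • h.z s :=
  h.rowsZ_transpose_mulVec S fun s => h.v s ⬝ᵥ x

lemma rowsZ_transpose_mulVec_rowsVTilde (x : Fin M × Fin p → ℝ) :
    (h.rowsZ S)ᵀ *ᵥ (h.rowsVTilde S *ᵥ x) =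
      ∑ s ∈ S, (h.v s ⬝ᵥ fun k => x (h.arm s, k)) • h.z s := by
  rw [rowsVTilde_mulVec]
  exact h.rowsZ_transpose_mulVec S fun s => h.v s ⬝ᵥ fun k => x (h.arm s, k)

end History

namespace IVModel

variable {M p q : ℕ} (P : IVModel M p q)

/-- The stacked coefficient vector `(α_1, …, α_M)`. -/
def stackedCoef : Fin M × Fin p → ℝ := fun ik => P.α ik.1 ik.2

lemma rowsR_history_armPeriods (x : ℕ → Obs p q) (a : ℕ → Fin M) (i : Fin M) (t : ℕ) :
    (P.history x a).rowsR ((P.history x a).armPeriods i t) =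
      (P.history x a).rowsV ((P.history x a).armPeriods i t) *ᵥ P.α i +
        fun s : (P.history x a).armPeriods i t => (x s).2.2 := by
  ext s
  have hs : a s = i := (Finset.mem_filter.1 s.2).2
  change P.reward (x s) (a s) = (x s).1 ⬝ᵥ P.α i + (x s).2.2
  rw [hs]; rfl

lemma rowsR_history (x : ℕ → Obs p q) (a : ℕ → Fin M) (S : Finset ℕ) :
    (P.history x a).rowsR S = (P.history x a).rowsVTilde S *ᵥ P.stackedCoef +
        fun s : S => (x s).2.2 := by
  rw [History.rowsVTilde_mulVec]
  rfl

/-- `v` has an optimal arm and the gap of some other arm is at most `w`. -/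
def NearMargin (w : ℝ) (v : Fin p → ℝ) : Prop :=
  ∃ i j, P.IsOptArm v i ∧ j ≠ i ∧ |v ⬝ᵥ (P.α j - P.α i)| ≤ w

/-- The gap below which a wrong arm is tolerated: if, up to sampling errors, at most a fraction
`(M - 1) * Lo * marginWidth` of the arms is wrong, then `Ṽᵀ Z` is within `η` of its population
counterpart. -/
def marginWidth (Lo η : ℝ) : ℝ := η / (8 * M * Lo * √(p * q) * P.vbar * P.zbar)

/-- The bound for the gap of a wrong arm that is pulled when the estimates use `n` periods. -/
def ucbWidth (θ CA Δ : ℝ) (T : ℕ) (n : ℝ) : ℝ :=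
  2 * √p * P.vbar * P.ucbFactor θ CA Δ * √(Real.log T / n)

/-- The deterministic bounds that hold almost surely, for the draws of the periods `1, …, T`. -/
structure Regular (T : ℕ) (x : ℕ → Obs p q) : Prop where
  opt : ∀ s ∈ Finset.Icc 1 T, ∃ i, P.IsOptArm (x s).1 i
  v_le : ∀ s ∈ Finset.Icc 1 T, ∀ k, |(x s).1 k| ≤ P.vbar
  z_le : ∀ s ∈ Finset.Icc 1 T, ∀ l, |(x s).2.1 l| ≤ P.zbar

/-- The sample moments of the exploration phase are close to their expectations. The bound for the
noise is what makes the width of the resulting estimates at most `marginWidth`. -/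
structure ExploreTypical (Lo η : ℝ) (T1 : ℕ) (x : ℕ → Obs p q) (a : ℕ → Fin M) : Prop where
  vz : ∀ i k l, |∑ s ∈ Finset.Icc 1 T1, (if a s = i then (x s).1 k * (x s).2.1 l else 0) -
    T1 * ((M : ℝ)⁻¹ * ∫ y, y.1 k * y.2.1 l ∂P.law)| ≤
      T1 * (phiMin P.SigmaVZBreve / (10 * √(p * q)))
  zz : ∀ i k l, |∑ s ∈ Finset.Icc 1 T1, (if a s = i then (x s).2.1 k * (x s).2.1 l else 0) -
    T1 * ((M : ℝ)⁻¹ * ∫ y, y.2.1 k * y.2.1 l ∂P.law)| ≤ T1 * (phiMin P.SigmaZZBreve / (10 * q))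
  noise : ∀ i l, |∑ s ∈ Finset.Icc 1 T1, (if a s = i then (x s).2.1 l * (x s).2.2 else 0)| ≤
    T1 * (P.marginWidth Lo η / (2 * √p * P.vbar * P.kappaBreve * √q))

open Classical in
/-- The sample moments of the periods `T1 + 1, …, t` are close to their expectations. None of these
moments involves the pulled arms. -/
structure GreedyTypical (Lo η Δ : ℝ) (T T1 t : ℕ) (x : ℕ → Obs p q) : Prop where
  vz : ∀ ik l, |∑ s ∈ Finset.Ioc T1 t, P.vStar (x s).1 ik * (x s).2.1 l -
    ((t : ℝ) - T1) * P.SigmaVZStar ik l| ≤ ((t : ℝ) - T1) * (η / (2 * √(M * p * q)))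
  zz : ∀ k l, |∑ s ∈ Finset.Ioc T1 t, (x s).2.1 k * (x s).2.1 l -
    ((t : ℝ) - T1) * P.SigmaZZ k l| ≤ ((t : ℝ) - T1) * (η / q)
  margin : ∑ s ∈ Finset.Ioc T1 t,
    (if P.NearMargin (P.marginWidth Lo η) (x s).1 then (1 : ℝ) else 0) ≤
      ((t : ℝ) - T1) * (345 / 1000 * (η / (√(p * q) * P.vbar * P.zbar)))
  noise_sq : ∑ s ∈ Finset.Ioc T1 t, (x s).2.2 ^ 2 ≤ ((t : ℝ) - T1) * (P.sigmaSq + Δ / 2)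
  noise : ∀ l, |∑ s ∈ Finset.Ioc T1 t, (x s).2.1 l * (x s).2.2| ≤
    √(4 * q * (P.zbar * P.ς) ^ 2 * Real.log T * ((t : ℝ) - T1))

variable {P}

lemma marginWidth_pos (hP : P.Assumption) (hM : 2 ≤ M) {Lo η : ℝ} (hLo : 0 < Lo) (hη : 0 < η) :
    0 < P.marginWidth Lo η := by
  have h1 := hP.vbar_pos
  have h2 := hP.zbar_pos
  have h3 : 0 < p := hP.p_pos hM
  have h4 : 0 < q := by have := hP.q_ge hM; omega
  unfold marginWidth
  positivity

lemma four_mul_le_sq {φA ΦA φB ΦB : ℝ} (hA : 0 < φA) (hB : 0 < φB) (hAA : φA ≤ ΦA)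
    (hBB : φB ≤ ΦB) :
    4 * (ΦB / (φA ^ 2 * φB)) ≤ (2 * ΦA * ΦB / (φA ^ 2 * φB)) ^ 2 := by
  have hB' : 0 < ΦB := hB.trans_le hBB
  have h1 : (2 * ΦA * ΦB / (φA ^ 2 * φB)) ^ 2 =
      4 * (ΦB / (φA ^ 2 * φB)) * ((ΦA / φA) ^ 2 * (ΦB / φB)) := by
    field_simp; ring
  rw [h1]
  refine le_mul_of_one_le_right (by positivity) ?_
  have h2 : 1 ≤ (ΦA / φA) ^ 2 := one_le_pow₀ ((one_le_div hA).2 hAA)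
  have h3 : 1 ≤ ΦB / φB := (one_le_div hB).2 hBB
  nlinarith

namespace Assumption

variable (hP : P.Assumption)
include hP

lemma kappaBreve_pos (hM : 2 ≤ M) : 0 < P.kappaBreve := by
  have h1 := hP.phiMin_sigmaVZBreve_pos hM
  have h2 := hP.phiMin_sigmaZZBreve_pos hM
  have := hP.nonempty_index hM
  have : Nonempty (Fin M × Fin q) := by
    have := hP.nonempty_q hM
    exact ⟨(⟨0, by omega⟩, Classical.arbitrary _)⟩
  have h3 := h1.trans_le (phiMin_le_phiMax (A := P.SigmaVZBreve) hP.card_breve_le)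
  have h4 := h2.trans_le (phiMin_le_phiMax (A := P.SigmaZZBreve) le_rfl)
  unfold kappaBreve
  positivity

lemma le_kappaBreve_sq (hM : 2 ≤ M) :
    4 * (phiMax P.SigmaZZBreve / (phiMin P.SigmaVZBreve ^ 2 * phiMin P.SigmaZZBreve)) ≤
      P.kappaBreve ^ 2 := by
  have := hP.nonempty_index hM
  have : Nonempty (Fin M × Fin q) := by
    have := hP.nonempty_q hM
    exact ⟨(⟨0, by omega⟩, Classical.arbitrary _)⟩
  exact four_mul_le_sq (hP.phiMin_sigmaVZBreve_pos hM) (hP.phiMin_sigmaZZBreve_pos hM)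
    (phiMin_le_phiMax hP.card_breve_le) (phiMin_le_phiMax le_rfl)

lemma le_kappaBar_sq (hM : 2 ≤ M) :
    4 * (phiMax P.SigmaZZ / (phiMin P.SigmaVZStar ^ 2 * phiMin P.SigmaZZ)) ≤
      P.kappaBar ^ 2 := by
  have := hP.nonempty_index hM
  have := hP.nonempty_q hM
  exact four_mul_le_sq (hP.phiMin_sigmaVZStar_pos hM) (hP.phiMin_sigmaZZ_pos hM)
    (phiMin_le_phiMax hP.card_le) (phiMin_le_phiMax le_rfl)

lemma kappaBar_pos (hM : 2 ≤ M) : 0 < P.kappaBar := by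
  have := hP.nonempty_index hM
  have := hP.nonempty_q hM
  have h1 := hP.phiMin_sigmaVZStar_pos hM
  have h2 := hP.phiMin_sigmaZZ_pos hM
  have h3 := h1.trans_le (phiMin_le_phiMax (A := P.SigmaVZStar) hP.card_le)
  have h4 := h2.trans_le (phiMin_le_phiMax (A := P.SigmaZZ) le_rfl)
  unfold kappaBar
  positivity

lemma kappaRing_pos (hM : 2 ≤ M) : 0 < P.kappaRing := by
  have := hP.nonempty_q hM
  have h1 := hP.phiMin_sigmaVZStar_pos hM
  have h2 := hP.phiMin_sigmaZZ_pos hM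
  have h4 := h2.trans_le (phiMin_le_phiMax (A := P.SigmaZZ) le_rfl)
  unfold kappaRing
  positivity

/-- After a typical exploration phase the estimates are precise up to gaps of `marginWidth`. -/
lemma explore_error (hM : 2 ≤ M) {Lo η : ℝ} (hLo : 0 < Lo) (hη : 0 < η) {T1 : ℕ} (hT1 : 0 < T1)
    {x : ℕ → Obs p q} {a : ℕ → Fin M} (hx : P.ExploreTypical Lo η T1 x a) (i : Fin M) :
    2 * (√p * P.vbar) * euclNorm ((P.history x a).armCoef i T1 - P.α i) ≤
      P.marginWidth Lo η := by
  have hp : (0 : ℝ) < p := by exact_mod_cast hP.p_pos hM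
  have hq : (0 : ℝ) < q := by have := hP.q_ge hM; positivity
  have hN : (0 : ℝ) < T1 := by exact_mod_cast hT1
  have hA := hP.phiMin_sigmaVZBreve_pos hM
  have hB := hP.phiMin_sigmaZZBreve_pos hM
  have hv := hP.vbar_pos
  have hκ := hP.kappaBreve_pos hM
  have hw := marginWidth_pos hP hM hLo hη
  have : Nonempty (Fin M × Fin q) := by
    have := hP.nonempty_q hM
    exact ⟨(⟨0, by omega⟩, Classical.arbitrary _)⟩
  have hBB := phiMin_le_phiMax (A := P.SigmaZZBreve) le_rfl
  set h := P.history x a with hh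
  set S := h.armPeriods i T1 with hS
  set φA := phiMin P.SigmaVZBreve
  set φB := phiMin P.SigmaZZBreve
  set ΦB := phiMax P.SigmaZZBreve
  have hsum : ∀ f : ℕ → ℝ, ∑ s ∈ S, f s =
      ∑ s ∈ Finset.Icc 1 T1, (if a s = i then f s else 0) := fun f => Finset.sum_filter _ _
  have hvz : ∀ k l, |∑ s ∈ S, (x s).1 k * (x s).2.1 l - T1 * ((M : ℝ)⁻¹ • P.SigmaVZ) k l| ≤
      T1 * (φA / (10 * √(p * q))) := by
    intro k l
    rw [hsum]
    exact hx.vz i k l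
  have hzz : ∀ k l, |∑ s ∈ S, (x s).2.1 k * (x s).2.1 l - T1 * ((M : ℝ)⁻¹ • P.SigmaZZ) k l| ≤
      T1 * (φB / (10 * q)) := by
    intro k l
    rw [hsum]
    exact hx.zz i k l
  have hZ : ∀ y, |(h.rowsZ S *ᵥ y) ⬝ᵥ (h.rowsZ S *ᵥ y) -
      T1 * (y ⬝ᵥ (((M : ℝ)⁻¹ • P.SigmaZZ) *ᵥ y))| ≤ φB / 10 * T1 * (y ⬝ᵥ y) := by
    intro y
    rw [History.rowsZ_mulVec_dotProduct]
    refine (abs_sum_sq_sub_le (by positivity) hzz y).trans_eq ?_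
    rw [Fintype.card_fin]; field_simp
  have hest := coef2SLS_sample (V := h.rowsV S) (Z := h.rowsZ S) hA hB hBB hN
    (fun y => by
      have h1 := (abs_le.1 (hZ y)).1
      have h2 := mul_le_mul_of_nonneg_left (hP.phiMin_sigmaZZBreve_le hM y) hN.le
      linarith)
    (fun y => by
      have h1 := (abs_le.1 (hZ y)).2
      have h2 := mul_le_mul_of_nonneg_left (hP.le_phiMax_sigmaZZBreve hM y) hN.le
      have h3 := mul_le_mul_of_nonneg_right hBB (mul_nonneg hN.le (dotProduct_self_nonneg' y))
      linarith)
    (fun y => by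
      rw [History.rowsZ_transpose_mulVec_rowsV]
      have h1 := euclNorm_sum_smul_sub_le (by positivity) hvz y
      have h2 := mul_le_mul_of_nonneg_left (hP.phiMin_sigmaVZBreve_mul_le hM y) hN.le
      have h3 := euclNorm_sub_le (∑ s ∈ S, ((x s).1 ⬝ᵥ y) • (x s).2.1)
        ((T1 : ℝ) • (y ᵥ* ((M : ℝ)⁻¹ • P.SigmaVZ)))
      rw [euclNorm_smul, abs_of_pos hN] at h3
      simp only [Fintype.card_fin] at h1
      have h4 : √(p * q) * (T1 * (φA / (10 * √(p * q)))) * euclNorm y =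
          T1 * (φA / 10 * euclNorm y) := by
        have : 0 < √((p : ℝ) * q) := by positivity
        field_simp
      change 9 / 10 * φA * T1 * euclNorm y ≤ euclNorm (∑ s ∈ S, ((x s).1 ⬝ᵥ y) • (x s).2.1)
      linarith)
  have h1 := hest.1 (P.α i) (fun s : S => (x s).2.2)
  rw [← rowsR_history_armPeriods] at h1
  change euclNorm (h.armCoef i T1 - P.α i) ^ 2 ≤ _ at h1
  set d := P.marginWidth Lo η / (2 * √p * P.vbar * P.kappaBreve * √q) with hd
  have hg : euclNorm ((h.rowsZ S)ᵀ *ᵥ fun s : S => (x s).2.2) ≤ √q * (T1 * d) := by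
    have h2 := euclNorm_le_of_abs_le (x := (h.rowsZ S)ᵀ *ᵥ fun s : S => (x s).2.2)
      (d := T1 * d) (by positivity) (fun l => by
        rw [h.rowsZ_transpose_mulVec S (fun s => (x s).2.2)]
        have := hx.noise i l
        rw [← hsum (fun s => (x s).2.1 l * (x s).2.2)] at this
        refine le_trans (le_of_eq ?_) this
        simp only [Finset.sum_apply, Pi.smul_apply, smul_eq_mul]
        congr 1
        exact Finset.sum_congr rfl fun s _ => mul_comm _ _)
    simpa using h2
  have h2 : euclNorm (h.armCoef i T1 - P.α i) ^ 2 ≤ (P.kappaBreve * √q * d) ^ 2 := by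
    calc _ ≤ _ := h1
      _ ≤ 8 / 5 * (P.kappaBreve ^ 2 / 4) * ((√q * (T1 * d)) ^ 2 / T1 ^ 2) := by
        have h3 : ΦB / (φA ^ 2 * φB) ≤ P.kappaBreve ^ 2 / 4 := by
          linarith [hP.le_kappaBreve_sq hM]
        have h4 := pow_le_pow_left₀ (euclNorm_nonneg _) hg 2
        gcongr
      _ = 2 / 5 * (P.kappaBreve * √q * d) ^ 2 := by field_simp; ring
      _ ≤ _ := by linarith [sq_nonneg (P.kappaBreve * √q * d)]
  have h3 := abs_le_of_sq_le_sq h2 (by positivity)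
  calc 2 * (√p * P.vbar) * euclNorm (h.armCoef i T1 - P.α i)
      ≤ 2 * (√p * P.vbar) * (P.kappaBreve * √q * d) := by
        have := le_of_abs_le h3
        gcongr
    _ = _ := by rw [hd]; field_simp

end Assumption

end IVModel

/-! ### Joint estimates in the presence of few wrong arms -/

namespace IVModel

variable {M p q : ℕ} {P : IVModel M p q}

lemma vStar_dotProduct {v : Fin p → ℝ} {i : Fin M} (hi : P.IsOptArm v i)
    (X : Fin M × Fin p → ℝ) : P.vStar v ⬝ᵥ X = v ⬝ᵥ fun k => X (i, k) := by
  have h : P.vStar v = blockVec i v := by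
    ext ⟨j, k⟩
    rcases eq_or_ne j i with rfl | hj
    · simp [vStar, blockVec, hi]
    · have : ¬ P.IsOptArm v j := fun h => hj (h.unique hi)
      simp [vStar, blockVec, this, hj]
  rw [h, blockVec_dotProduct]

lemma sum_euclNorm_block_sq (X : Fin M × Fin p → ℝ) :
    ∑ i, euclNorm (fun k => X (i, k)) ^ 2 = euclNorm X ^ 2 := by
  simp only [euclNorm_sq, dotProduct, Fintype.sum_prod_type]

lemma euclNorm_block_le (X : Fin M × Fin p → ℝ) (i : Fin M) :
    euclNorm (fun k => X (i, k)) ≤ euclNorm X := by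
  refine le_of_abs_le (abs_le_of_sq_le_sq ?_ (euclNorm_nonneg _))
  rw [← sum_euclNorm_block_sq]
  exact Finset.single_le_sum (f := fun i => euclNorm (fun k => X (i, k)) ^ 2)
    (fun _ _ => sq_nonneg _) (Finset.mem_univ i)

lemma euclNorm_block_sub_le (X : Fin M × Fin p → ℝ) {i j : Fin M} (hij : i ≠ j) :
    euclNorm ((fun k => X (i, k)) - fun k => X (j, k)) ≤ √2 * euclNorm X := by
  have h1 := euclNorm_add_le (fun k => X (i, k)) ((-1 : ℝ) • fun k => X (j, k))
  rw [euclNorm_smul, neg_one_smul, ← sub_eq_add_neg, abs_neg, abs_one, one_mul] at h1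
  refine h1.trans (le_of_abs_le (abs_le_of_sq_le_sq ?_
    (mul_nonneg (Real.sqrt_nonneg _) (euclNorm_nonneg _))))
  have h2 : euclNorm (fun k => X (i, k)) ^ 2 + euclNorm (fun k => X (j, k)) ^ 2 ≤
      euclNorm X ^ 2 := by
    rw [← sum_euclNorm_block_sq, ← Finset.sum_pair (f := fun i => euclNorm (fun k => X (i, k)) ^ 2)
      hij]
    exact Finset.sum_le_sum_of_subset_of_nonneg (Finset.subset_univ _) fun _ _ _ => sq_nonneg _
  rw [mul_pow, Real.sq_sqrt (by norm_num)]
  nlinarith [sq_nonneg (euclNorm (fun k => X (i, k)) - euclNorm (fun k => X (j, k)))]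

lemma log_two_le_log {T : ℕ} (hT : 2 ≤ T) : 69 / 100 ≤ Real.log T := by
  have h1 : Real.log 2 ≤ Real.log T := Real.log_le_log (by norm_num) (by exact_mod_cast hT)
  linarith [Real.log_two_gt_d9]

lemma ucbFactor_pos (hP : P.Assumption) (hM : 2 ≤ M) {θ CA Δ : ℝ} (hθ : 0 < θ)
    (hCA : 0 ≤ CA) (hΔ : 0 < Δ) : 0 < P.ucbFactor θ CA Δ := by
  have h1 := hP.kappaRing_pos hM
  have h2 := P.sigmaSq_nonneg
  unfold ucbFactor
  positivity

namespace ConstantsOK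

variable {θ cB Lo CA η Δ C1 C2 : ℝ} (hC : P.ConstantsOK θ cB Lo CA η Δ C1 C2)
  (hP : P.Assumption) (hM : 2 ≤ M)
include hC hP hM

lemma CA_nonneg : 0 ≤ CA := by
  have h1 := hP.kappaBar_pos hM
  have h2 := hP.zbar_pos
  exact le_trans (by positivity) hC.CA_ge

lemma eta_le_vz : η ≤ 1 / 10 * phiMin P.SigmaVZStar := by
  have := min_le_left (phiMin P.SigmaVZStar) (phiMin P.SigmaZZ)
  linarith [hC.η_le]

lemma eta_le_zz : η ≤ 1 / 10 * phiMin P.SigmaZZ := by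
  have := min_le_right (phiMin P.SigmaVZStar) (phiMin P.SigmaZZ)
  linarith [hC.η_le]

/-- The relative tolerance is at most `1 / 10`, as `φ_min(Σ*_vz) ≤ √q v̄ z̄`. -/
lemma ten_mul_eta_le : 10 * η ≤ √(p * q) * P.vbar * P.zbar := by
  have h1 := hC.eta_le_vz hP hM
  have h2 := hP.phiMin_sigmaVZStar_le hM
  have h3 : √q * (P.vbar * P.zbar) ≤ √(p * q) * P.vbar * P.zbar := by
    rw [← mul_assoc]
    have := hP.vbar_pos
    have := hP.zbar_pos
    gcongr
    have : (1 : ℝ) ≤ p := by exact_mod_cast hP.p_pos hM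
    have : (0 : ℝ) ≤ q := by positivity
    nlinarith
  linarith

/-- One period is a negligible fraction of the tolerated wrong arms. -/
lemma one_le_tolerance {ℓ N : ℝ} (hℓ : 69 / 100 ≤ ℓ) (hN : C2 * ℓ ≤ N) :
    1 ≤ N * (12 / 10000 * (η / (√(p * q) * P.vbar * P.zbar))) := by
  have hη := hC.η_pos
  have hv := hP.vbar_pos
  have hz := hP.zbar_pos
  have hp : (0 : ℝ) < p := by exact_mod_cast hP.p_pos hM
  have hq : (0 : ℝ) < q := by have := hP.q_ge hM; positivity
  have hM1 : (1 : ℝ) ≤ (M : ℝ) - 1 := by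
    have : (2 : ℝ) ≤ M := by exact_mod_cast hM
    linarith
  set D := √(p * q) * P.vbar * P.zbar with hD
  have hD0 : 0 < D := by positivity
  have hD2 : D ^ 2 = p * q * P.vbar ^ 2 * P.zbar ^ 2 := by
    rw [hD, mul_pow, mul_pow, Real.sq_sqrt (by positivity)]
  have h1 : 128 * D ^ 2 / η ^ 2 ≤ C2 := by
    refine le_trans ?_ hC.C2_ge₆
    rw [hD2]
    refine div_le_div_of_nonneg_right ?_ (by positivity)
    have h2 : (1 : ℝ) ≤ ((M : ℝ) - 1) ^ 2 := one_le_pow₀ hM1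
    have h3 : 0 ≤ (p : ℝ) * q * P.vbar ^ 2 * P.zbar ^ 2 := by positivity
    nlinarith
  have h2 := hC.ten_mul_eta_le hP hM
  have h3 : 128 * D ^ 2 / η ^ 2 * ℓ ≤ N := (mul_le_mul_of_nonneg_right h1 (by linarith)).trans hN
  have h4 : 128 * D ^ 2 / η ^ 2 * (69 / 100) ≤ N :=
    le_trans (mul_le_mul_of_nonneg_left hℓ (by positivity)) h3
  calc (1 : ℝ) ≤ 128 * (69 / 100) * (12 / 10000) * 10 := by norm_num
    _ ≤ 128 * (69 / 100) * (12 / 10000) * (D / η) := by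
      gcongr
      rw [le_div_iff₀ hη]; exact h2
    _ = 128 * D ^ 2 / η ^ 2 * (69 / 100) * (12 / 10000 * (η / D)) := by field_simp
    _ ≤ _ := by gcongr

/-- The prediction error of the estimated coefficients adds little to the residual variance. -/
lemma estimation_error_small {ℓ N : ℝ} (hℓ : 0 < ℓ) (hN : C2 * ℓ ≤ N) :
    p * P.vbar ^ 2 * ((2 * q * P.zbar * P.ς * P.kappaBar) ^ 2 * ℓ) ≤ N * (Δ / 4) := by
  have hΔ := hC.Δ_pos
  have h1 := mul_le_mul_of_nonneg_right hC.C2_ge₄ hℓ.le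
  rw [div_mul_eq_mul_div, div_le_iff₀ hΔ] at h1
  have h2 : C2 * ℓ * Δ ≤ N * Δ := by gcongr
  have hM' : (1 : ℝ) ≤ M := by exact_mod_cast (by omega : 1 ≤ M)
  set K := p * q ^ 2 * P.vbar ^ 2 * P.zbar ^ 2 * (P.ς : ℝ) ^ 2 * P.kappaBar ^ 2 * ℓ with hK
  have hK0 : 0 ≤ K := by positivity
  have h3 : 6 * M * p * q ^ 2 * P.vbar ^ 2 * P.zbar ^ 2 * P.ς ^ 2 * P.kappaBar ^ 2 * 64 * ℓ =
      384 * (M * K) := by rw [hK]; ring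
  have h4 : p * P.vbar ^ 2 * ((2 * q * P.zbar * P.ς * P.kappaBar) ^ 2 * ℓ) = 4 * K := by
    rw [hK]; ring
  rw [h3] at h1
  rw [h4]
  nlinarith

/-- The last lower bound for `C2` is what keeps the gaps of wrong arms within the tolerance. -/
lemma ucbWidth_le (hθ : 0 < θ) (hLo : 0 < Lo) {T : ℕ} {N : ℝ} (hT : 2 ≤ T)
    (hN0 : 0 < N) (hN : C2 * Real.log T ≤ N) :
    P.ucbWidth θ CA Δ T N ≤ P.marginWidth Lo η := by
  have hη := hC.η_pos
  have hv := hP.vbar_pos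
  have hz := hP.zbar_pos
  have hp : (0 : ℝ) < p := by exact_mod_cast hP.p_pos hM
  have hq : (0 : ℝ) < q := by have := hP.q_ge hM; positivity
  have hℓ : 0 < Real.log T := Real.log_pos (by exact_mod_cast hT)
  have hΓ := ucbFactor_pos hP hM hθ (hC.CA_nonneg hP hM) hC.Δ_pos
  have hw := marginWidth_pos hP hM hLo hη
  refine le_of_abs_le (abs_le_of_sq_le_sq ?_ hw.le)
  have h1 := (mul_le_mul_of_nonneg_right hC.C2_ge₇ hℓ.le).trans hN
  rw [ucbWidth, marginWidth]
  simp only [mul_pow, div_pow]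
  rw [Real.sq_sqrt hp.le, Real.sq_sqrt (by positivity), Real.sq_sqrt (by positivity)]
  set Γ := P.ucbFactor θ CA Δ
  have hM0 : (0 : ℝ) < M := by positivity
  rw [div_mul_eq_mul_div, div_le_iff₀ (by positivity)] at h1
  rw [← mul_div_assoc, div_le_div_iff₀ hN0 (by positivity)]
  linarith

end ConstantsOK

section Joint

variable {θ cB Lo CA η Δ C1 C2 : ℝ} (hC : P.ConstantsOK θ cB Lo CA η Δ C1 C2)
  (hP : P.Assumption) (hM : 2 ≤ M) {T T1 t : ℕ} {x : ℕ → Obs p q} {a : ℕ → Fin M}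
include hC hP hM

open Classical in
/-- Few wrong arms hardly change the moment matrix of the selected covariates. -/
lemma selected_moment_ge (hT : 2 ≤ T) (htT : t ≤ T) (hN : C2 * Real.log T ≤ (t : ℝ) - T1)
    (hN0 : 0 < (t : ℝ) - T1) (hreg : P.Regular T x) (hx : P.GreedyTypical Lo η Δ T T1 t x)
    (hmiss : (({s ∈ Finset.Ioc T1 t | ¬ P.IsOptArm (x s).1 (a s)}.card : ℕ) : ℝ) ≤
      ((t : ℝ) - T1) * (345 / 1000 * (η / (√(p * q) * P.vbar * P.zbar))) + 1)
    (X : Fin M × Fin p → ℝ) :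
    9 / 10 * phiMin P.SigmaVZStar * ((t : ℝ) - T1) * euclNorm X ≤
      euclNorm (∑ s ∈ Finset.Ioc T1 t, ((x s).1 ⬝ᵥ fun k => X (a s, k)) • (x s).2.1) := by
  have hη := hC.η_pos
  have hv := hP.vbar_pos
  have hz := hP.zbar_pos
  have hp : (0 : ℝ) < p := by exact_mod_cast hP.p_pos hM
  have hq : (0 : ℝ) < q := by have := hP.q_ge hM; positivity
  have hM0 : (0 : ℝ) < M := by positivity
  set N := (t : ℝ) - T1
  set S := Finset.Ioc T1 t
  have hS : S ⊆ Finset.Icc 1 T := fun s hs => by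
    rw [Finset.mem_Ioc] at hs; rw [Finset.mem_Icc]; omega
  set D := √(p * q) * P.vbar * P.zbar with hD
  have hD0 : 0 < D := by positivity
  have hX := euclNorm_nonneg X
  set W := ∑ s ∈ S, ((x s).1 ⬝ᵥ fun k => X (a s, k)) • (x s).2.1 with hW
  set U := ∑ s ∈ S, (P.vStar (x s).1 ⬝ᵥ X) • (x s).2.1 with hU
  have hWU : euclNorm (W - U) ≤ N * (η / 2) * euclNorm X := by
    have h1 : ∀ s ∈ S, euclNorm ((((x s).1 ⬝ᵥ fun k => X (a s, k)) - P.vStar (x s).1 ⬝ᵥ X) •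
        (x s).2.1) ≤ if ¬ P.IsOptArm (x s).1 (a s) then √2 * D * euclNorm X else 0 := by
      intro s hs
      obtain ⟨i, hi⟩ := hreg.opt s (hS hs)
      rw [vStar_dotProduct hi]
      by_cases h : P.IsOptArm (x s).1 (a s)
      · have : a s = i := h.unique hi
        subst this
        simp [h, euclNorm]
      · have hne : a s ≠ i := fun h' => h (h' ▸ hi)
        rw [if_pos h, ← dotProduct_sub, euclNorm_smul]
        have h2 := abs_dotProduct_le (x s).1 ((fun k => X (a s, k)) - fun k => X (i, k))
        have h3 := euclNorm_block_sub_le X hne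
        have h4 := euclNorm_le_of_abs_le hv.le (hreg.v_le s (hS hs))
        have h5 := euclNorm_le_of_abs_le hz.le (hreg.z_le s (hS hs))
        rw [Fintype.card_fin] at h4 h5
        calc _ ≤ (√p * P.vbar * (√2 * euclNorm X)) * (√q * P.zbar) :=
              mul_le_mul (h2.trans (mul_le_mul h4 h3 (euclNorm_nonneg _) (by positivity))) h5
                (euclNorm_nonneg _) (by positivity)
          _ = _ := by rw [hD, Real.sqrt_mul hp.le]; ring
    have h2 : W - U = ∑ s ∈ S, (((x s).1 ⬝ᵥ fun k => X (a s, k)) - P.vStar (x s).1 ⬝ᵥ X) •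
        (x s).2.1 := by
      rw [hW, hU, ← Finset.sum_sub_distrib]
      exact Finset.sum_congr rfl fun s _ => (sub_smul _ _ _).symm
    rw [h2]
    refine (euclNorm_sum_le _ _).trans ((Finset.sum_le_sum h1).trans ?_)
    rw [← Finset.sum_filter, Finset.sum_const, nsmul_eq_mul]
    have h3 := hC.one_le_tolerance hP hM (log_two_le_log hT) hN
    have h4 : √2 ≤ 14143 / 10000 := Real.sqrt_le_iff.2 ⟨by norm_num, by norm_num⟩
    have h5 : (({s ∈ S | ¬ P.IsOptArm (x s).1 (a s)}.card : ℕ) : ℝ) ≤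
        N * (3462 / 10000 * (η / D)) := by linarith
    calc _ ≤ N * (3462 / 10000 * (η / D)) * (14143 / 10000 * D * euclNorm X) := by gcongr
      _ = N * (3462 / 10000 * (14143 / 10000) * η) * euclNorm X := by field_simp
      _ ≤ _ := by
        gcongr
        linarith
  have hUA : euclNorm (U - N • (X ᵥ* P.SigmaVZStar)) ≤ N * (η / 2) * euclNorm X := by
    refine (euclNorm_sum_smul_sub_le (by positivity) hx.vz X).trans_eq ?_
    simp only [Fintype.card_prod, Fintype.card_fin]
    push_cast
    have : 0 < √((M : ℝ) * p * q) := by positivity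
    field_simp
    ring
  have h1 := euclNorm_sub_le W U
  have h2 := euclNorm_sub_le U (N • (X ᵥ* P.SigmaVZStar))
  rw [euclNorm_smul, abs_of_pos hN0] at h2
  have h3 := mul_le_mul_of_nonneg_left (phiMin_mul_le hP.card_le (A := P.SigmaVZStar) X) hN0.le
  have h4 := mul_le_mul_of_nonneg_right (hC.eta_le_vz hP hM) (mul_nonneg hN0.le hX)
  linarith

open Classical in
/-- On a typical sample with few wrong arms, the coefficient estimates, the matrix that scales the
bonuses and the estimated noise variance are all under control. -/
lemma joint_estimate (hT : 2 ≤ T) (htT : t ≤ T) (hN : C2 * Real.log T ≤ (t : ℝ) - T1)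
    (hN0 : 0 < (t : ℝ) - T1) (hreg : P.Regular T x) (hx : P.GreedyTypical Lo η Δ T T1 t x)
    (hmiss : (({s ∈ Finset.Ioc T1 t | ¬ P.IsOptArm (x s).1 (a s)}.card : ℕ) : ℝ) ≤
      ((t : ℝ) - T1) * (345 / 1000 * (η / (√(p * q) * P.vbar * P.zbar))) + 1) :
    euclNorm ((P.history x a).jointCoef T1 t - P.stackedCoef) ^ 2 ≤
        2 / 5 * ((2 * q * P.zbar * P.ς * P.kappaBar) ^ 2 * (Real.log T / ((t : ℝ) - T1))) ∧
      (∀ X, X ⬝ᵥ ((P.history x a).jointOmega T1 t *ᵥ X) ≤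
        7 / 10 * (P.kappaRing / ((t : ℝ) - T1)) * (X ⬝ᵥ X)) ∧
      ((t : ℝ) - T1)⁻¹ * ∑ s : Finset.Ioc T1 t, ((P.history x a).R s -
        ((P.history x a).rowsVTilde (Finset.Ioc T1 t) *ᵥ
          (P.history x a).jointCoef T1 t) s) ^ 2 ≤ 2 * (P.sigmaSq + Δ) := by
  have hη := hC.η_pos
  have hv := hP.vbar_pos
  have hz := hP.zbar_pos
  have hp : (0 : ℝ) < p := by exact_mod_cast hP.p_pos hM
  have hq : (0 : ℝ) < q := by have := hP.q_ge hM; positivity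
  have hℓ : 0 < Real.log T := Real.log_pos (by exact_mod_cast hT)
  have hA := hP.phiMin_sigmaVZStar_pos hM
  have hB := hP.phiMin_sigmaZZ_pos hM
  have := hP.nonempty_q hM
  have hBB := phiMin_le_phiMax (A := P.SigmaZZ) le_rfl
  have hsel := selected_moment_ge hC hP hM hT htT hN hN0 hreg hx hmiss
  set N := (t : ℝ) - T1
  set S := Finset.Ioc T1 t with hSdef
  have hcard : (S.card : ℝ) = N := by
    have hlt : T1 < t := by
      have : (T1 : ℝ) < t := by linarith
      exact_mod_cast this
    rw [hSdef, Nat.card_Ioc, Nat.cast_sub hlt.le]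
  have hS : S ⊆ Finset.Icc 1 T := fun s hs => by
    rw [Finset.mem_Ioc] at hs; rw [Finset.mem_Icc]; omega
  set h := P.history x a with hh
  have hZ : ∀ y, |(h.rowsZ S *ᵥ y) ⬝ᵥ (h.rowsZ S *ᵥ y) -
      N * (y ⬝ᵥ (P.SigmaZZ *ᵥ y))| ≤ N * η * (y ⬝ᵥ y) := by
    intro y
    rw [History.rowsZ_mulVec_dotProduct]
    refine (abs_sum_sq_sub_le (by positivity) hx.zz y).trans_eq ?_
    rw [Fintype.card_fin]; field_simp; ring
  have hηy : ∀ y : Fin q → ℝ, N * η * (y ⬝ᵥ y) ≤ N * (1 / 10 * phiMin P.SigmaZZ) * (y ⬝ᵥ y) :=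
    fun y => mul_le_mul_of_nonneg_right
      (mul_le_mul_of_nonneg_left (hC.eta_le_zz hP hM) hN0.le) (dotProduct_self_nonneg' y)
  obtain ⟨hest, hom⟩ := coef2SLS_sample (V := h.rowsVTilde S) (Z := h.rowsZ S) hA hB hBB hN0
    (fun y => by
      have h1 := (abs_le.1 (hZ y)).1
      have h2 := mul_le_mul_of_nonneg_left (posDef_phiMin_le hP.posDef y) hN0.le
      linarith [hηy y])
    (fun y => by
      have h1 := (abs_le.1 (hZ y)).2
      have h2 := mul_le_mul_of_nonneg_left (posDef_le_phiMax hP.posDef y) hN0.le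
      have h3 := mul_le_mul_of_nonneg_right hBB (mul_nonneg hN0.le (dotProduct_self_nonneg' y))
      linarith [hηy y])
    (fun X => by
      rw [History.rowsZ_transpose_mulVec_rowsVTilde]
      exact hsel X)
  have hcoef := hest P.stackedCoef (fun s : S => (x s).2.2)
  rw [← rowsR_history] at hcoef
  change euclNorm (h.jointCoef T1 t - P.stackedCoef) ^ 2 ≤ _ at hcoef
  set e := h.jointCoef T1 t - P.stackedCoef with he
  have hg : euclNorm ((h.rowsZ S)ᵀ *ᵥ fun s : S => (x s).2.2) ^ 2 ≤
      q * (4 * q * (P.zbar * P.ς) ^ 2 * Real.log T * N) := by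
    have h2 := euclNorm_le_of_abs_le (x := (h.rowsZ S)ᵀ *ᵥ fun s : S => (x s).2.2)
      (Real.sqrt_nonneg _) (fun l => by
        rw [h.rowsZ_transpose_mulVec S (fun s => (x s).2.2)]
        refine le_trans (le_of_eq ?_) (hx.noise l)
        simp only [Finset.sum_apply, Pi.smul_apply, smul_eq_mul]
        congr 1
        exact Finset.sum_congr rfl fun s _ => mul_comm _ _)
    have h3 := pow_le_pow_left₀ (euclNorm_nonneg _) h2 2
    rwa [mul_pow, Fintype.card_fin, Real.sq_sqrt hq.le, Real.sq_sqrt (by positivity)] at h3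
  have herr : euclNorm e ^ 2 ≤
      2 / 5 * ((2 * q * P.zbar * P.ς * P.kappaBar) ^ 2 * (Real.log T / N)) := by
    calc _ ≤ _ := hcoef
      _ ≤ 8 / 5 * (P.kappaBar ^ 2 / 4) *
          (q * (4 * q * (P.zbar * P.ς) ^ 2 * Real.log T * N) / N ^ 2) := by
        have h3 : phiMax P.SigmaZZ / (phiMin P.SigmaVZStar ^ 2 * phiMin P.SigmaZZ) ≤
            P.kappaBar ^ 2 / 4 := by
          linarith [hP.le_kappaBar_sq hM]
        gcongr
      _ = _ := by field_simp; ring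
  refine ⟨herr, fun X => ?_, ?_⟩
  · refine (hom X).trans_eq ?_
    rw [kappaRing]; ring
  · have h1 : ∀ s ∈ S, ((x s).2.2 - (x s).1 ⬝ᵥ fun k => e (a s, k)) ^ 2 ≤
        2 * (x s).2.2 ^ 2 + 2 * (p * P.vbar ^ 2 * euclNorm e ^ 2) := by
      intro s hs
      have h2 := abs_dotProduct_le (x s).1 fun k => e (a s, k)
      have h3 := euclNorm_le_of_abs_le hv.le (hreg.v_le s (hS hs))
      rw [Fintype.card_fin] at h3
      have h4 : |(x s).1 ⬝ᵥ fun k => e (a s, k)| ≤ √p * P.vbar * euclNorm e :=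
        h2.trans (mul_le_mul h3 (euclNorm_block_le e (a s)) (euclNorm_nonneg _) (by positivity))
      have h5 := pow_le_pow_left₀ (abs_nonneg _) h4 2
      rw [sq_abs, mul_pow, mul_pow, Real.sq_sqrt hp.le] at h5
      nlinarith [sq_nonneg ((x s).2.2 + (x s).1 ⬝ᵥ fun k => e (a s, k))]
    have h2 : ∑ s : S, (h.R s - (h.rowsVTilde S *ᵥ h.jointCoef T1 t) s) ^ 2 =
        ∑ s ∈ S, ((x s).2.2 - (x s).1 ⬝ᵥ fun k => e (a s, k)) ^ 2 := by
      rw [← Finset.sum_coe_sort S]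
      refine Finset.sum_congr rfl fun s _ => ?_
      rw [History.rowsVTilde_mulVec]
      have h3 : (fun k => e (a s, k)) = (fun k => h.jointCoef T1 t (a s, k)) - P.α (a s) := rfl
      rw [h3, dotProduct_sub]
      change (((x s).1 ⬝ᵥ P.α (a s) + (x s).2.2) -
        (x s).1 ⬝ᵥ fun k => h.jointCoef T1 t (a s, k)) ^ 2 = _
      ring
    rw [h2, inv_mul_le_iff₀ hN0]
    refine (Finset.sum_le_sum h1).trans ?_
    rw [Finset.sum_add_distrib, ← Finset.mul_sum, Finset.sum_const, nsmul_eq_mul, hcard]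
    have h3 := hx.noise_sq
    have h4 := hC.estimation_error_small hP hM hℓ hN
    have h5 : N * (p * P.vbar ^ 2 * euclNorm e ^ 2) ≤ N * (Δ / 4) := by
      calc _ ≤ N * (p * P.vbar ^ 2 *
            (2 / 5 * ((2 * q * P.zbar * P.ς * P.kappaBar) ^ 2 * (Real.log T / N)))) := by gcongr
        _ = 2 / 5 * (p * P.vbar ^ 2 *
            ((2 * q * P.zbar * P.ς * P.kappaBar) ^ 2 * Real.log T)) := by field_simp
        _ ≤ 2 / 5 * (N * (Δ / 4)) := by gcongr
        _ ≤ _ := by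
          have : 0 ≤ N * (Δ / 4) := by have := hC.Δ_pos; positivity
          linarith
    have h6 : 0 ≤ N * Δ := by have := hC.Δ_pos; positivity
    linarith

end Joint

end IVModel

/-! ### Gaps of the pulled arms -/

namespace IVModel

variable {M p q : ℕ} {P : IVModel M p q}

lemma jointCoef_block {h : History M p q} {T1 t : ℕ} (j : Fin M) :
    (fun k => h.jointCoef T1 t (j, k)) =
      P.α j + fun k => (h.jointCoef T1 t - P.stackedCoef) (j, k) := by
  ext k
  simp [stackedCoef]

lemma submatrix_quadratic (A : Matrix (Fin M × Fin p) (Fin M × Fin p) ℝ) (j : Fin M)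
    (v : Fin p → ℝ) :
    v ⬝ᵥ (A.submatrix (fun k => (j, k)) (fun k => (j, k)) *ᵥ v) =
      blockVec j v ⬝ᵥ (A *ᵥ blockVec j v) := by
  rw [blockVec_dotProduct]
  congr 1
  ext k
  change _ = (fun l => A (j, k) l) ⬝ᵥ blockVec j v
  rw [dotProduct_comm, blockVec_dotProduct, dotProduct_comm]
  rfl

/-- An arm that maximizes the upper confidence bound has a small gap. Only its own bonus enters:
the bonus of the optimal arm is dropped. -/
lemma gap_le_ucbWidth_of_estimate (hP : P.Assumption) (hM : 2 ≤ M) {θ CA Δ : ℝ} (hθ : 0 < θ)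
    (hΔ : 0 < Δ) (hCA : 2 * q * P.zbar * P.ς * P.kappaBar ≤ CA) {T T1 T2 s : ℕ}
    {x : ℕ → Obs p q} {a : ℕ → Fin M} (hT : 2 ≤ T) (hTT : T1 ≤ T2) (hs2 : T2 + 1 < s)
    (hsT : s ≤ T) (hv : ∀ k, |(x s).1 k| ≤ P.vbar)
    (hcoef : euclNorm ((P.history x a).jointCoef T1 (s - 1) - P.stackedCoef) ^ 2 ≤
      2 / 5 * ((2 * q * P.zbar * P.ς * P.kappaBar) ^ 2 *
        (Real.log T / (((s - 1 : ℕ) : ℝ) - T1))))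
    (hom : ∀ X, X ⬝ᵥ ((P.history x a).jointOmega T1 (s - 1) *ᵥ X) ≤
        7 / 10 * (P.kappaRing / (((s - 1 : ℕ) : ℝ) - T1)) * (X ⬝ᵥ X))
    (hσ : (((s - 1 : ℕ) : ℝ) - T1)⁻¹ * ∑ r : Finset.Ioc T1 (s - 1), ((P.history x a).R r -
        ((P.history x a).rowsVTilde (Finset.Ioc T1 (s - 1)) *ᵥ
          (P.history x a).jointCoef T1 (s - 1)) r) ^ 2 ≤ 2 * (P.sigmaSq + Δ))
    (hmax : ∀ i, (P.history x a).criterion θ T1 T2 s i ≤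
      (P.history x a).criterion θ T1 T2 s (a s)) {i : Fin M} (hi : i ≠ a s) :
    (x s).1 ⬝ᵥ (P.α i - P.α (a s)) ≤ P.ucbWidth θ CA Δ T (((s - 1 : ℕ) : ℝ) - T1) := by
  have hN0 : 0 < ((s - 1 : ℕ) : ℝ) - T1 := by
    rw [sub_pos]; exact_mod_cast (by omega : T1 < s - 1)
  have hvb := hP.vbar_pos
  have hzb := hP.zbar_pos
  have hp : (0 : ℝ) < p := by exact_mod_cast hP.p_pos hM
  have hκ := hP.kappaRing_pos hM
  have hκ' := hP.kappaBar_pos hM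
  have hσ0 := P.sigmaSq_nonneg
  have hC0 : 0 ≤ 2 * q * P.zbar * P.ς * P.kappaBar := by positivity
  have hℓ : 0 ≤ Real.log T := Real.log_nonneg (by exact_mod_cast (by omega : 1 ≤ T))
  have hlog0 : 0 ≤ Real.log ((s : ℝ) - T1) := by
    refine Real.log_nonneg ?_
    have : (T1 : ℝ) + 1 ≤ s := by exact_mod_cast (by omega : T1 + 1 ≤ s)
    linarith
  have hlog : Real.log ((s : ℝ) - T1) ≤ Real.log T := by
    have h1 : (T1 : ℝ) + 1 ≤ s := by exact_mod_cast (by omega : T1 + 1 ≤ s)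
    have h2 : (s : ℝ) ≤ T := by exact_mod_cast hsT
    have h3 : (0 : ℝ) ≤ T1 := by positivity
    exact Real.log_le_log (by linarith) (by linarith)
  set N := ((s - 1 : ℕ) : ℝ) - T1
  set h := P.history x a with hh
  set v := (x s).1 with hvdef
  set e := h.jointCoef T1 (s - 1) - P.stackedCoef with he
  set C0 := 2 * q * P.zbar * P.ς * P.kappaBar
  have hv' := euclNorm_le_of_abs_le hvb.le hv
  rw [Fintype.card_fin] at hv'
  have hcrit := hmax i
  have hns : ¬ s ≤ T2 := by omega
  have hns' : ¬ s - 1 ≤ T2 := by omega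
  simp only [History.criterion, History.alphaHat, History.omegaHat, if_neg hns, if_neg hns'] at hcrit
  rw [jointCoef_block (P := P) i, jointCoef_block (P := P) (a s), submatrix_quadratic,
    submatrix_quadratic] at hcrit
  change v ⬝ᵥ _ + _ * √(2 * θ * Real.log ((s : ℝ) - T1) * (blockVec i v ⬝ᵥ
      (h.jointOmega T1 (s - 1) *ᵥ blockVec i v))) ≤
    v ⬝ᵥ _ + _ * √(2 * θ * Real.log ((s : ℝ) - T1) * (blockVec (a s) v ⬝ᵥ
      (h.jointOmega T1 (s - 1) *ᵥ blockVec (a s) v))) at hcrit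
  have hr := Real.sqrt_nonneg (Real.log T / N)
  set r := √(Real.log T / N) with hrdef
  have hr2 : r ^ 2 = Real.log T / N := Real.sq_sqrt (div_nonneg hℓ hN0.le)
  -- the error of the two coefficient estimates
  have herr : |v ⬝ᵥ ((fun k => e (a s, k)) - fun k => e (i, k))| ≤ √p * P.vbar * (C0 * r) := by
    refine (abs_dotProduct_le _ _).trans (mul_le_mul hv' ?_ (euclNorm_nonneg _) (by positivity))
    refine (euclNorm_block_sub_le e hi.symm).trans (le_of_abs_le (abs_le_of_sq_le_sq ?_
      (by positivity)))
    rw [mul_pow, mul_pow, Real.sq_sqrt (by norm_num), hr2]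
    have : 0 ≤ C0 ^ 2 * (Real.log T / N) := by positivity
    linarith
  -- the bonus of the pulled arm
  have hbonus : h.sigmaHat T1 T2 (s - 1) * √(2 * θ * Real.log ((s : ℝ) - T1) *
      (blockVec (a s) v ⬝ᵥ (h.jointOmega T1 (s - 1) *ᵥ blockVec (a s) v))) ≤
      2 * √p * P.vbar * √(θ * P.kappaRing * (P.sigmaSq + Δ)) * r := by
    rw [History.sigmaHat, if_neg hns']
    have h1 : blockVec (a s) v ⬝ᵥ (h.jointOmega T1 (s - 1) *ᵥ blockVec (a s) v) ≤
        7 / 10 * (P.kappaRing / N) * (p * P.vbar ^ 2) := by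
      refine (hom _).trans (mul_le_mul_of_nonneg_left ?_ (by positivity))
      rw [← euclNorm_sq, euclNorm_blockVec]
      have := pow_le_pow_left₀ (euclNorm_nonneg _) hv' 2
      rwa [mul_pow, Real.sq_sqrt hp.le] at this
    have h2 : 2 * θ * Real.log ((s : ℝ) - T1) *
        (blockVec (a s) v ⬝ᵥ (h.jointOmega T1 (s - 1) *ᵥ blockVec (a s) v)) ≤
        2 * θ * Real.log T * (7 / 10 * (P.kappaRing / N) * (p * P.vbar ^ 2)) := by
      refine (mul_le_mul_of_nonneg_left h1 (by positivity)).trans ?_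
      gcongr
    refine (mul_le_mul (Real.sqrt_le_sqrt hσ) (Real.sqrt_le_sqrt h2) (Real.sqrt_nonneg _)
      (Real.sqrt_nonneg _)).trans ?_
    rw [← Real.sqrt_mul (by positivity)]
    refine Real.sqrt_le_iff.2 ⟨by positivity, ?_⟩
    simp only [mul_pow]
    rw [hr2, Real.sq_sqrt hp.le, Real.sq_sqrt (by positivity)]
    have h3 : 0 ≤ p * P.vbar ^ 2 * (θ * P.kappaRing * (P.sigmaSq + Δ)) * (Real.log T / N) := by
      positivity
    calc _ = 14 / 5 * (p * P.vbar ^ 2 * (θ * P.kappaRing * (P.sigmaSq + Δ)) *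
          (Real.log T / N)) := by field_simp; ring
      _ ≤ 4 * (p * P.vbar ^ 2 * (θ * P.kappaRing * (P.sigmaSq + Δ)) *
          (Real.log T / N)) := by linarith
      _ = _ := by ring
  have hnn : 0 ≤ h.sigmaHat T1 T2 (s - 1) * √(2 * θ * Real.log ((s : ℝ) - T1) *
      (blockVec i v ⬝ᵥ (h.jointOmega T1 (s - 1) *ᵥ blockVec i v))) := by
    refine mul_nonneg ?_ (Real.sqrt_nonneg _)
    rw [History.sigmaHat, if_neg hns']
    exact Real.sqrt_nonneg _
  have h1 := le_of_abs_le herr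
  rw [dotProduct_sub] at h1
  rw [dotProduct_add, dotProduct_add] at hcrit
  have h2 : √p * P.vbar * (C0 * r) ≤ √p * P.vbar * (2 * (CA * r)) := by
    have h3 : C0 * r ≤ CA * r := mul_le_mul_of_nonneg_right hCA hr
    have h4 : 0 ≤ C0 * r := by positivity
    refine mul_le_mul_of_nonneg_left (by linarith) (by positivity)
  rw [ucbWidth, ucbFactor, dotProduct_sub, ← hrdef]
  linarith

/-- An arm that maximizes the reward estimated after a typical exploration phase has a small
gap. -/
lemma greedy_gap_le (hP : P.Assumption) (hM : 2 ≤ M) {Lo η θ : ℝ} (hLo : 0 < Lo) (hη : 0 < η)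
    {T1 T2 s : ℕ} (hT1 : 0 < T1) {x : ℕ → Obs p q} {a : ℕ → Fin M}
    (hx : P.ExploreTypical Lo η T1 x a) (hs : s ≤ T2) (hv : ∀ k, |(x s).1 k| ≤ P.vbar)
    (hmax : ∀ i, (P.history x a).criterion θ T1 T2 s i ≤
      (P.history x a).criterion θ T1 T2 s (a s)) (i : Fin M) :
    (x s).1 ⬝ᵥ (P.α i - P.α (a s)) ≤ P.marginWidth Lo η := by
  have hvb := hP.vbar_pos
  have hv' := euclNorm_le_of_abs_le hvb.le hv
  rw [Fintype.card_fin] at hv'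
  have h1 := hmax i
  simp only [History.criterion, if_pos hs] at h1
  change (x s).1 ⬝ᵥ _ ≤ (x s).1 ⬝ᵥ _ at h1
  have h2 := hP.explore_error hM hLo hη hT1 hx
  have h3 : ∀ j, |(x s).1 ⬝ᵥ ((P.history x a).armCoef j T1 - P.α j)| ≤
      P.marginWidth Lo η / 2 := by
    intro j
    have h4 := abs_dotProduct_le (x s).1 ((P.history x a).armCoef j T1 - P.α j)
    have h5 := mul_le_mul_of_nonneg_right hv'
      (euclNorm_nonneg ((P.history x a).armCoef j T1 - P.α j))
    linarith [h2 j]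
  have h4 := (abs_le.1 (h3 i)).1
  have h5 := (abs_le.1 (h3 (a s))).2
  rw [dotProduct_sub] at h4 h5 ⊢
  linarith

section Induction

variable {θ cB Lo CA η Δ C1 C2 : ℝ} {T T1 T2 : ℕ} {x : ℕ → Obs p q} {a : ℕ → Fin M}

open Classical in
/-- All wrong arms, except possibly the one in period `T2 + 1`, are near the margin. -/
lemma card_wrong_le {w : ℝ} {t : ℕ} (hopt : ∀ s ∈ Finset.Ioc T1 t, ∃ i, P.IsOptArm (x s).1 i)
    (h : ∀ s ∈ Finset.Ioc T1 t, s ≠ T2 + 1 → ∀ i, P.IsOptArm (x s).1 i →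
      (x s).1 ⬝ᵥ (P.α i - P.α (a s)) ≤ w) :
    (({s ∈ Finset.Ioc T1 t | ¬ P.IsOptArm (x s).1 (a s)}.card : ℕ) : ℝ) ≤
      ∑ s ∈ Finset.Ioc T1 t, (if P.NearMargin w (x s).1 then (1 : ℝ) else 0) + 1 := by
  have hsub : ({s ∈ Finset.Ioc T1 t | ¬ P.IsOptArm (x s).1 (a s)} : Finset ℕ) ⊆
      insert (T2 + 1) {s ∈ Finset.Ioc T1 t | P.NearMargin w (x s).1} := by
    intro s hs
    rw [Finset.mem_filter] at hs
    rw [Finset.mem_insert, Finset.mem_filter]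
    refine or_iff_not_imp_left.2 fun hne => ⟨hs.1, ?_⟩
    obtain ⟨i, hi⟩ := hopt s hs.1
    have hia : a s ≠ i := fun h' => hs.2 (h' ▸ hi)
    refine ⟨i, a s, hi, hia, ?_⟩
    have h1 := hi (a s) hia
    have h2 := h s hs.1 hne i hi
    rw [← neg_sub (P.α i), dotProduct_neg, abs_neg, abs_of_pos h1]
    exact h2
  rw [← Finset.sum_filter, Finset.sum_const, nsmul_eq_mul, mul_one]
  exact_mod_cast (Finset.card_le_card hsub).trans (Finset.card_insert_le _ _)

/-- The event on which the analysis of the algorithm is deterministic. -/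
structure Typical (P : IVModel M p q) (Lo η Δ : ℝ) (T T1 T2 : ℕ) (x : ℕ → Obs p q)
    (a : ℕ → Fin M) : Prop where
  regular : P.Regular T x
  explore : P.ExploreTypical Lo η T1 x a
  greedy : ∀ t ∈ Finset.Ioc T2 T, P.GreedyTypical Lo η Δ T T1 t x

variable (hC : P.ConstantsOK θ cB Lo CA η Δ C1 C2) (hP : P.Assumption) (hM : 2 ≤ M)
  (hθ : 0 < θ) (hLo : 0 < Lo) (hT : 2 ≤ T) (hT1 : 0 < T1) (hTT : T1 ≤ T2)
  (hT2 : C2 * Real.log T ≤ (T2 : ℝ) - T1) (hx : P.Typical Lo η Δ T T1 T2 x a)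
  (hmax : ∀ s ∈ Finset.Ioc T1 T, ∀ i, (P.history x a).criterion θ T1 T2 s i ≤
      (P.history x a).criterion θ T1 T2 s (a s))
include hC hP hM hθ hLo hT hT1 hTT hT2 hx hmax

/-- The induction step: small gaps in the past make the next gap small. -/
lemma gap_le_of_forall {s : ℕ} (hs : T2 + 1 < s) (hsT : s ≤ T)
    (ih : ∀ r ∈ Finset.Ioc T1 (s - 1), r ≠ T2 + 1 → ∀ i, P.IsOptArm (x r).1 i →
      (x r).1 ⬝ᵥ (P.α i - P.α (a r)) ≤ P.marginWidth Lo η) {i : Fin M} (hi : i ≠ a s) :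
    (x s).1 ⬝ᵥ (P.α i - P.α (a s)) ≤ P.ucbWidth θ CA Δ T (((s - 1 : ℕ) : ℝ) - T1) := by
  have h1 : (T2 : ℝ) + 1 ≤ ((s - 1 : ℕ) : ℝ) := by exact_mod_cast (by omega : T2 + 1 ≤ s - 1)
  have h2 : (T1 : ℝ) ≤ T2 := by exact_mod_cast hTT
  have hg := hx.greedy (s - 1) (Finset.mem_Ioc.2 ⟨by omega, by omega⟩)
  have hmiss := card_wrong_le (fun r hr => hx.regular.opt r (by
    rw [Finset.mem_Ioc] at hr; rw [Finset.mem_Icc]; omega)) ih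
  obtain ⟨e1, e2, e3⟩ := joint_estimate hC hP hM hT (by omega : s - 1 ≤ T) (by linarith)
    (by linarith) hx.regular hg (hmiss.trans (by linarith [hg.margin]))
  exact gap_le_ucbWidth_of_estimate hP hM hθ hC.Δ_pos hC.CA_ge hT hTT hs hsT
    (hx.regular.v_le s (Finset.mem_Icc.2 ⟨by omega, hsT⟩)) e1 e2 e3
    (hmax s (Finset.mem_Ioc.2 ⟨by omega, hsT⟩)) hi

/-- On the typical event the gaps of the pulled arms are small in all periods but `T2 + 1`. -/
lemma gap_le_marginWidth {s : ℕ} (hs : s ∈ Finset.Ioc T1 T) (hne : s ≠ T2 + 1) (i : Fin M) :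
    (x s).1 ⬝ᵥ (P.α i - P.α (a s)) ≤ P.marginWidth Lo η := by
  induction s using Nat.strong_induction_on generalizing i with
  | _ s ih =>
  rw [Finset.mem_Ioc] at hs
  have hw := marginWidth_pos hP hM hLo hC.η_pos
  rcases le_or_gt s T2 with h | h
  · exact greedy_gap_le hP hM hLo hC.η_pos hT1 hx.explore h
      (hx.regular.v_le s (Finset.mem_Icc.2 ⟨by omega, hs.2⟩)) (hmax s (Finset.mem_Ioc.2 hs)) i
  · rcases eq_or_ne i (a s) with rfl | hi
    · simpa using hw.le
    refine (gap_le_of_forall hC hP hM hθ hLo hT hT1 hTT hT2 hx hmax (by omega) hs.2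
      (fun r hr hr' j _ => ?_) hi).trans ?_
    · rw [Finset.mem_Ioc] at hr
      exact ih r (by omega) (Finset.mem_Ioc.2 ⟨hr.1, by omega⟩) hr' j
    · have h1 : (T2 : ℝ) + 1 ≤ ((s - 1 : ℕ) : ℝ) := by
        exact_mod_cast (by omega : T2 + 1 ≤ s - 1)
      have h2 : (T1 : ℝ) ≤ T2 := by exact_mod_cast hTT
      exact hC.ucbWidth_le hP hM hθ hLo hT (by linarith) (by linarith)

lemma gap_le_ucbWidth {s : ℕ} (hs : T2 + 1 < s) (hsT : s ≤ T) {i : Fin M} (hi : i ≠ a s) :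
    (x s).1 ⬝ᵥ (P.α i - P.α (a s)) ≤ P.ucbWidth θ CA Δ T (((s - 1 : ℕ) : ℝ) - T1) :=
  gap_le_of_forall hC hP hM hθ hLo hT hT1 hTT hT2 hx hmax hs hsT (fun r hr hr' j _ =>
    gap_le_marginWidth hC hP hM hθ hLo hT hT1 hTT hT2 hx hmax
      (Finset.mem_Ioc.2 ⟨(Finset.mem_Ioc.1 hr).1, by have := (Finset.mem_Ioc.1 hr).2; omega⟩)
      hr' j) hi

end Induction

end IVModel

/-! ### The probability of the typical event -/

section UnionBound

variable {Ω : Type*} [MeasurableSpace Ω] {μ : Measure Ω} [IsFiniteMeasure μ]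

lemma measureReal_not_and_le {A B : Ω → Prop} {c d : ℝ} (hA : μ.real {ω | ¬ A ω} ≤ c)
    (hB : μ.real {ω | ¬ B ω} ≤ d) : μ.real {ω | ¬ (A ω ∧ B ω)} ≤ c + d := by
  have h : {ω | ¬ (A ω ∧ B ω)} = {ω | ¬ A ω} ∪ {ω | ¬ B ω} := by
    ext ω
    rw [Set.mem_union, Set.mem_ofPred_eq, Set.mem_ofPred_eq, Set.mem_ofPred_eq, not_and_or]
  rw [h]
  exact (measureReal_union_le _ _).trans (add_le_add hA hB)

lemma measureReal_not_forall_mem_le {ι : Type*} {s : Finset ι} {A : ι → Ω → Prop} {c : ℝ}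
    (h : ∀ i ∈ s, μ.real {ω | ¬ A i ω} ≤ c) :
    μ.real {ω | ¬ ∀ i ∈ s, A i ω} ≤ s.card * c := by
  have h1 : {ω | ¬ ∀ i ∈ s, A i ω} = ⋃ i ∈ s, {ω | ¬ A i ω} := by
    ext ω
    simp
  rw [h1, ← nsmul_eq_mul, ← Finset.sum_const]
  exact (measureReal_biUnion_finset_le _ _).trans (Finset.sum_le_sum h)

lemma measureReal_not_forall_le {ι : Type*} [Fintype ι] {A : ι → Ω → Prop} {c : ℝ}
    (h : ∀ i, μ.real {ω | ¬ A i ω} ≤ c) :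
    μ.real {ω | ¬ ∀ i, A i ω} ≤ Fintype.card ι * c := by
  simpa using measureReal_not_forall_mem_le (s := Finset.univ) fun i _ => h i

end UnionBound

namespace IVModel

variable {M p q : ℕ} {P : IVModel M p q}

lemma measurableSet_near (i j : Fin M) (w : ℝ) : MeasurableSet {x : Obs p q |
    P.IsOptArm x.1 i ∧ |x.1 ⬝ᵥ (P.α j - P.α i)| ≤ w} := by
  have h : Measurable fun x : Obs p q => |x.1 ⬝ᵥ (P.α j - P.α i)| :=
    (measurable_dotProduct_const measurable_fst _).abs
  exact MeasurableSet.inter (measurable_fst (P.measurableSet_isOptArm i))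
    (measurableSet_le h measurable_const)

lemma setOf_nearMargin (w : ℝ) : {x : Obs p q | P.NearMargin w x.1} =
    ⋃ i ∈ Finset.univ, ⋃ j ∈ Finset.univ.erase i,
      {x : Obs p q | P.IsOptArm x.1 i ∧ |x.1 ⬝ᵥ (P.α j - P.α i)| ≤ w} := by
  ext x
  simp only [NearMargin, Set.mem_ofPred_eq, Set.mem_iUnion, Finset.mem_univ, Finset.mem_erase,
    and_true, exists_prop, true_and]
  exact exists_congr fun i => exists_congr fun j => and_left_comm

lemma measurableSet_nearMargin (w : ℝ) : MeasurableSet {x : Obs p q | P.NearMargin w x.1} := by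
  rw [setOf_nearMargin]
  exact Finset.measurableSet_biUnion _ fun i _ => Finset.measurableSet_biUnion _ fun j _ =>
    measurableSet_near i j w

lemma measureReal_nearMargin_le [IsFiniteMeasure P.law] {Lo w : ℝ} (hw : 0 < w)
    (h : P.IsOptMargin Lo) :
    P.law.real {x : Obs p q | P.NearMargin w x.1} ≤ ((M : ℝ) - 1) * Lo * w := by
  rw [setOf_nearMargin]
  exact (measureReal_biUnion_finset_le _ _).trans ((Finset.sum_le_sum fun i _ =>
    measureReal_biUnion_finset_le _ _).trans (h w hw))

/-- The margin below which a wrong arm is tolerated is rarely met. -/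
lemma measureReal_nearMargin_marginWidth_le (hP : P.Assumption) (hM : 2 ≤ M) {Lo η : ℝ}
    (hη : 0 < η) (h : P.IsOptMargin Lo) :
    P.law.real {x : Obs p q | P.NearMargin (P.marginWidth Lo η) x.1} ≤
      1 / 8 * (η / (√(p * q) * P.vbar * P.zbar)) := by
  have := hP.prob
  have hLo := hP.optMargin_pos hM h
  refine (measureReal_nearMargin_le (marginWidth_pos hP hM hLo hη) h).trans ?_
  have hv := hP.vbar_pos
  have hz := hP.zbar_pos
  have hp : (0 : ℝ) < p := by exact_mod_cast hP.p_pos hM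
  have hq : (0 : ℝ) < q := by have := hP.q_ge hM; positivity
  have hM0 : (0 : ℝ) < M := by positivity
  calc _ = (((M : ℝ) - 1) / M) * (1 / 8 * (η / (√(p * q) * P.vbar * P.zbar))) := by
        rw [marginWidth]; field_simp
    _ ≤ 1 * (1 / 8 * (η / (√(p * q) * P.vbar * P.zbar))) := by
        gcongr
        rw [div_le_one hM0]; linarith
    _ = _ := one_mul _

variable {Ω : Type*} [MeasurableSpace Ω] {μ : Measure Ω} [IsProbabilityMeasure μ]
  {θ Lo CA η Δ C1 C2 : ℝ} {T1 T2 T : ℕ} {X : ℕ → Ω → Obs p q} {a : ℕ → Ω → Fin M}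

namespace IsRun

variable (hr : P.IsRun θ T1 T2 T μ X a) (hC : P.ConstantsOK θ (1 / 256) Lo CA η Δ C1 C2)
  (hP : P.Assumption) (hM : 2 ≤ M) (hLo : P.IsOptMargin Lo) (hT : 2 ≤ T)
include hr hC hP hM hLo hT

lemma measureReal_not_exploreTypical_le (hT1 : C1 * Real.log T ≤ T1) (hTT : T1 ≤ T) :
    μ.real {ω | ¬ P.ExploreTypical Lo η T1 (fun s => X s ω) (fun s => a s ω)} ≤
      M * (p * (q * (2 * Real.exp (-(3 * Real.log T))))) +
        (M * (q * (q * (2 * Real.exp (-(3 * Real.log T))))) +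
          M * (q * (2 * Real.exp (-(3 * Real.log T))))) := by
  have := hP.prob
  have hη := hC.η_pos
  have hv := hP.vbar_pos
  have hz := hP.zbar_pos
  have hp : (0 : ℝ) < p := by exact_mod_cast hP.p_pos hM
  have hq : (2 : ℝ) ≤ q := by exact_mod_cast hP.q_ge hM
  have hM' : (2 : ℝ) ≤ M := by exact_mod_cast hM
  have hℓ : 0 < Real.log T := Real.log_pos (by exact_mod_cast hT)
  have hA := hP.phiMin_sigmaVZBreve_pos hM
  have hB := hP.phiMin_sigmaZZBreve_pos hM
  have hκ := hP.kappaBreve_pos hM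
  have hLo0 := hP.optMargin_pos hM hLo
  have hw := marginWidth_pos hP hM hLo0 hη
  set ℓ := Real.log T
  set φA := phiMin P.SigmaVZBreve
  set φB := phiMin P.SigmaZZBreve
  -- `D` stands for either term of the maximum and `φ` for the corresponding singular value
  have hkey : ∀ D φ : ℝ, 0 < D → D ≤ max (√(p * q) * P.vbar * P.zbar) (q * P.zbar ^ 2) →
      0 < φ → min φA φB ≤ φ → 600 * D ^ 2 / φ ^ 2 * ℓ ≤ T1 := by
    intro D φ hD hDm hφ hφm
    refine le_trans (mul_le_mul_of_nonneg_right ?_ hℓ.le) hT1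
    refine le_trans ?_ hC.C1_ge₁
    have hmin : 0 < min φA φB := lt_min hA hB
    have h1 : 40 * M * D / φ ≤ 40 * M * max (√(p * q) * P.vbar * P.zbar) (q * P.zbar ^ 2) /
        min φA φB := by gcongr
    refine le_trans ?_ (pow_le_pow_left₀ (by positivity) h1 2)
    have h2 : (40 * M * D / φ) ^ 2 = 1600 * (M : ℝ) ^ 2 * (D ^ 2 / φ ^ 2) := by ring
    rw [h2, mul_div_assoc]
    have h3 : 0 ≤ D ^ 2 / φ ^ 2 := by positivity
    have h4 : (600 : ℝ) ≤ 1600 * (M : ℝ) ^ 2 := by nlinarith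
    exact mul_le_mul_of_nonneg_right h4 h3
  have hT0 : (0 : ℝ) ≤ T1 := by positivity
  have hvz : ∀ (i : Fin M) (k : Fin p) (l : Fin q), μ.real {ω | ¬ |∑ s ∈ Finset.Icc 1 T1,
      (if a s ω = i then (X s ω).1 k * (X s ω).2.1 l else 0) -
      T1 * ((M : ℝ)⁻¹ * ∫ y, y.1 k * y.2.1 l ∂P.law)| ≤ T1 * (φA / (10 * √(p * q)))} ≤
      2 * Real.exp (-(3 * ℓ)) := by
    intro i k l
    simp only [not_le]
    refine hr.explore_tail_of_bdd hTT i (f := fun x => x.1 k * x.2.1 l) (by fun_prop)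
      (b := P.vbar * P.zbar) (by positivity) ?_ (by positivity) (by positivity) ?_
    · filter_upwards [hP.v_bdd' k, hP.z_bdd' l] with x h1 h2
      rw [abs_mul]
      gcongr
    · have h1 := hkey (√(p * q) * P.vbar * P.zbar) φA (by positivity) (le_max_left _ _) hA
        (min_le_left _ _)
      rw [mul_pow, mul_pow, Real.sq_sqrt (by positivity), div_mul_eq_mul_div,
        div_le_iff₀ (by positivity)] at h1
      have h2 := mul_le_mul_of_nonneg_right h1 hT0
      rw [mul_pow (T1 : ℝ), div_pow, mul_pow 10 √_, Real.sq_sqrt (by positivity), mul_div_assoc',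
        le_div_iff₀ (by positivity)]
      linarith
  have hzz : ∀ (i : Fin M) (k : Fin q) (l : Fin q), μ.real {ω | ¬ |∑ s ∈ Finset.Icc 1 T1,
      (if a s ω = i then (X s ω).2.1 k * (X s ω).2.1 l else 0) -
      T1 * ((M : ℝ)⁻¹ * ∫ y, y.2.1 k * y.2.1 l ∂P.law)| ≤ T1 * (φB / (10 * q))} ≤
      2 * Real.exp (-(3 * ℓ)) := by
    intro i k l
    simp only [not_le]
    refine hr.explore_tail_of_bdd hTT i (f := fun x => x.2.1 k * x.2.1 l) (by fun_prop)
      (b := P.zbar * P.zbar) (by positivity) ?_ (by positivity) (by positivity) ?_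
    · filter_upwards [hP.z_bdd' k, hP.z_bdd' l] with x h1 h2
      rw [abs_mul]
      gcongr
    · have h1 := hkey (q * P.zbar ^ 2) φB (by positivity) (le_max_right _ _) hB
        (min_le_right _ _)
      rw [div_mul_eq_mul_div, div_le_iff₀ (by positivity)] at h1
      have h2 := mul_le_mul_of_nonneg_right h1 hT0
      rw [mul_pow (T1 : ℝ), div_pow, mul_div_assoc', le_div_iff₀ (by positivity)]
      linarith
  have hno : ∀ (i : Fin M) (l : Fin q), μ.real {ω | ¬ |∑ s ∈ Finset.Icc 1 T1,
      (if a s ω = i then (X s ω).2.1 l * (X s ω).2.2 else 0)| ≤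
      T1 * (P.marginWidth Lo η / (2 * √p * P.vbar * P.kappaBreve * √q))} ≤
      2 * Real.exp (-(3 * ℓ)) := by
    intro i l
    simp only [not_le]
    refine hr.explore_noise_tail hP hTT i l (by positivity) (by positivity) ?_
    have h1 := (mul_le_mul_of_nonneg_right hC.C1_ge₂ hℓ.le).trans hT1
    have h2 : P.marginWidth Lo η / (2 * √p * P.vbar * P.kappaBreve * √q) =
        η / (16 * M * Lo * p * q * P.vbar ^ 2 * P.zbar * P.kappaBreve) := by
      rw [marginWidth, div_div]
      congr 1
      have h3 : √((p : ℝ) * q) * (√p * √q) = p * q := by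
        rw [← Real.sqrt_mul hp.le, Real.mul_self_sqrt (by positivity)]
      calc _ = 16 * M * Lo * (√((p : ℝ) * q) * (√p * √q)) * P.vbar ^ 2 * P.zbar *
            P.kappaBreve := by ring
        _ = _ := by rw [h3]; ring
    rw [div_mul_eq_mul_div, div_le_iff₀ (by positivity)] at h1
    rw [h2, mul_pow (T1 : ℝ), div_pow, mul_div_assoc', le_div_iff₀ (by positivity)]
    set K := 1024 * (M : ℝ) ^ 2 * p ^ 2 * q ^ 2 * P.vbar ^ 4 * P.zbar ^ 4 * P.ς ^ 2 *
      P.kappaBreve ^ 2 * Lo ^ 2 * ℓ * T1 with hK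
    have hK0 : 0 ≤ K := by positivity
    have h3 : 8 * K ≤ M ^ 2 * q * K := by
      refine mul_le_mul_of_nonneg_right ?_ hK0
      nlinarith
    calc _ = 3 * K := by rw [hK]; ring
      _ ≤ M ^ 2 * q * K := by linarith
      _ = 1024 * M ^ 4 * p ^ 2 * q ^ 3 * P.vbar ^ 4 * P.zbar ^ 4 * P.ς ^ 2 *
          P.kappaBreve ^ 2 * Lo ^ 2 * ℓ * T1 := by rw [hK]; ring
      _ ≤ T1 * η ^ 2 * T1 := mul_le_mul_of_nonneg_right h1 hT0
      _ = _ := by ring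
  have h1 := measureReal_not_forall_le fun i => measureReal_not_forall_le fun k =>
    measureReal_not_forall_le fun l => hvz i k l
  have h2 := measureReal_not_forall_le fun i => measureReal_not_forall_le fun k =>
    measureReal_not_forall_le fun l => hzz i k l
  have h3 := measureReal_not_forall_le fun i => measureReal_not_forall_le fun l => hno i l
  simp only [Fintype.card_fin] at h1 h2 h3
  refine le_trans (measureReal_mono fun ω hω => ?_)
    (measureReal_not_and_le h1 (measureReal_not_and_le h2 h3))
  rw [Set.mem_ofPred_eq] at *
  exact fun h => hω ⟨h.1, h.2.1, h.2.2⟩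

lemma measureReal_not_greedyTypical_le {t : ℕ} (hN : C2 * Real.log T ≤ (t : ℝ) - T1)
    (ht : T1 < t) (htT : t ≤ T) :
    μ.real {ω | ¬ P.GreedyTypical Lo η Δ T T1 t (fun s => X s ω)} ≤
      (M * p : ℕ) * (q * (2 * Real.exp (-(3 * Real.log T)))) +
        (q * (q * (2 * Real.exp (-(3 * Real.log T)))) +
          (2 * Real.exp (-(3 * Real.log T)) + (Real.exp (-(3 * Real.log T)) +
            q * (2 * Real.exp (-(2 * Real.log T)))))) := by
  classical
  have := hP.prob
  have hη := hC.η_pos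
  have hΔ := hC.Δ_pos
  have hv := hP.vbar_pos
  have hz := hP.zbar_pos
  have hp : (0 : ℝ) < p := by exact_mod_cast hP.p_pos hM
  have hq : (2 : ℝ) ≤ q := by exact_mod_cast hP.q_ge hM
  have hM' : (2 : ℝ) ≤ M := by exact_mod_cast hM
  have hℓ : 0 < Real.log T := Real.log_pos (by exact_mod_cast hT)
  have hLo0 := hP.optMargin_pos hM hLo
  have hS : Finset.Ioc T1 t ⊆ Finset.Icc 1 T := fun s hs => by
    rw [Finset.mem_Ioc] at hs; rw [Finset.mem_Icc]; omega
  have hcard : ((Finset.Ioc T1 t).card : ℝ) = (t : ℝ) - T1 := by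
    rw [Nat.card_Ioc, Nat.cast_sub ht.le]
  have hN0 : 0 < (t : ℝ) - T1 := by rw [sub_pos]; exact_mod_cast ht
  set ℓ := Real.log T
  set N := (t : ℝ) - T1
  set S := Finset.Ioc T1 t
  have h6 : 128 * ((M : ℝ) - 1) ^ 2 * p * q * P.vbar ^ 2 * P.zbar ^ 2 * ℓ ≤ N * η ^ 2 := by
    have h := (mul_le_mul_of_nonneg_right hC.C2_ge₆ hℓ.le).trans hN
    rwa [div_mul_eq_mul_div, div_le_iff₀ (by positivity)] at h
  have hvz : ∀ (ik : Fin M × Fin p) (l : Fin q), μ.real {ω | ¬ |∑ s ∈ S,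
      P.vStar (X s ω).1 ik * (X s ω).2.1 l - N * P.SigmaVZStar ik l| ≤
      N * (η / (2 * √(M * p * q)))} ≤ 2 * Real.exp (-(3 * ℓ)) := by
    rintro ⟨i, k⟩ l
    simp only [not_le]
    rw [← hcard]
    refine hr.sum_tail_of_bdd hS (f := fun x => P.vStar x.1 (i, k) * x.2.1 l)
      ((P.measurable_vStar_fst i k).mul (by fun_prop)) (b := P.vbar * P.zbar) (by positivity) ?_
      (by positivity) (by positivity) ?_
    · filter_upwards [hP.vStar_bdd i k, hP.z_bdd' l] with x h1 h2
      rw [abs_mul]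
      gcongr
    · rw [hcard, mul_pow N, div_pow, mul_pow 2 √_, Real.sq_sqrt (by positivity), mul_div_assoc',
        le_div_iff₀ (by positivity)]
      set K := p * q * P.vbar ^ 2 * P.zbar ^ 2 * ℓ * N with hK
      have hK0 : 0 ≤ K := by positivity
      have h7 := mul_le_mul_of_nonneg_right h6 hN0.le
      have h8 : 24 * M * K ≤ 128 * ((M : ℝ) - 1) ^ 2 * K := by
        refine mul_le_mul_of_nonneg_right ?_ hK0
        nlinarith
      calc _ = 24 * M * K := by rw [hK]; ring
        _ ≤ _ := h8
        _ = 128 * ((M : ℝ) - 1) ^ 2 * p * q * P.vbar ^ 2 * P.zbar ^ 2 * ℓ * N := by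
          rw [hK]; ring
        _ ≤ _ := h7
        _ = _ := by ring
  have hzz : ∀ (k : Fin q) (l : Fin q), μ.real {ω | ¬ |∑ s ∈ S,
      (X s ω).2.1 k * (X s ω).2.1 l - N * P.SigmaZZ k l| ≤ N * (η / q)} ≤
      2 * Real.exp (-(3 * ℓ)) := by
    intro k l
    simp only [not_le]
    rw [← hcard]
    refine hr.sum_tail_of_bdd hS (f := fun x => x.2.1 k * x.2.1 l) (by fun_prop)
      (b := P.zbar * P.zbar) (by positivity) ?_ (by positivity) (by positivity) ?_
    · filter_upwards [hP.z_bdd' k, hP.z_bdd' l] with x h1 h2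
      rw [abs_mul]
      gcongr
    · have h := (mul_le_mul_of_nonneg_right hC.C2_ge₅ hℓ.le).trans hN
      rw [div_mul_eq_mul_div, div_le_iff₀ (by positivity)] at h
      have h7 := mul_le_mul_of_nonneg_right h hN0.le
      rw [hcard, mul_pow N, div_pow, mul_div_assoc', le_div_iff₀ (by positivity)]
      linarith
  have hma : μ.real {ω | ¬ ∑ s ∈ S,
      (if P.NearMargin (P.marginWidth Lo η) (X s ω).1 then (1 : ℝ) else 0) ≤
      N * (345 / 1000 * (η / (√(p * q) * P.vbar * P.zbar)))} ≤ 2 * Real.exp (-(3 * ℓ)) := by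
    set u := η / (√(p * q) * P.vbar * P.zbar) with hu
    have hu0 : 0 < u := by positivity
    have hmeas := P.measurableSet_nearMargin (P.marginWidth Lo η)
    have hf : Measurable fun x : Obs p q =>
        if P.NearMargin (P.marginWidth Lo η) x.1 then (1 : ℝ) else 0 :=
      Measurable.ite hmeas measurable_const measurable_const
    have h1 := hr.sum_tail_of_bdd hS hf (b := 1) zero_le_one
      (ae_of_all _ fun x => by split_ifs <;> simp) (E := 3 * ℓ) (thr := N * (22 / 100 * u))
      (by positivity) (by positivity) (by
        rw [hcard]
        have h7 := mul_le_mul_of_nonneg_right h6 hN0.le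
        have h8 : u ^ 2 * (p * q * P.vbar ^ 2 * P.zbar ^ 2) = η ^ 2 := by
          rw [hu, div_pow, mul_pow, mul_pow, Real.sq_sqrt (by positivity)]
          field_simp
        set D := p * q * P.vbar ^ 2 * P.zbar ^ 2 with hD
        have hD0 : 0 < D := by positivity
        have h9 : 128 * (ℓ * N) ≤ N ^ 2 * u ^ 2 := by
          refine le_of_mul_le_mul_right ?_ hD0
          calc 128 * (ℓ * N) * D ≤ 128 * ((M : ℝ) - 1) ^ 2 * (ℓ * N * D) := by
                have : 0 ≤ ℓ * N * D := by positivity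
                have : (1 : ℝ) ≤ ((M : ℝ) - 1) ^ 2 := by nlinarith
                nlinarith
            _ = 128 * ((M : ℝ) - 1) ^ 2 * p * q * P.vbar ^ 2 * P.zbar ^ 2 * ℓ * N := by
              rw [hD]; ring
            _ ≤ _ := h7
            _ = _ := by rw [← h8]; ring
        have h10 : 0 ≤ ℓ * N := by positivity
        nlinarith)
    refine le_trans (measureReal_mono fun ω hω => ?_) h1
    rw [Set.mem_ofPred_eq] at *
    have hint : ∫ x, (if P.NearMargin (P.marginWidth Lo η) x.1 then (1 : ℝ) else 0) ∂P.law ≤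
        1 / 8 * u := by
      refine le_trans (le_of_eq ?_) (measureReal_nearMargin_marginWidth_le hP hM hη hLo)
      rw [← integral_indicator_one hmeas]
      refine integral_congr_ae (ae_of_all _ fun x => ?_)
      simp [Set.indicator_apply]
    rw [not_le] at hω
    rw [hcard]
    refine lt_of_lt_of_le ?_ (le_abs_self _)
    have h2 := mul_le_mul_of_nonneg_left hint hN0.le
    linarith
  have hsq : μ.real {ω | ¬ ∑ s ∈ S, (X s ω).2.2 ^ 2 ≤ N * (P.sigmaSq + Δ / 2)} ≤
      Real.exp (-(3 * ℓ)) := by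
    simp only [not_le]
    rw [← hcard]
    refine hr.noise_sq_tail hP hS hΔ (by exact_mod_cast hcard ▸ hN0) (by positivity) ?_ ?_
    · have h := (mul_le_mul_of_nonneg_right hC.C2_ge₁ hℓ.le).trans hN
      rw [div_mul_eq_mul_div, div_le_iff₀ (by positivity)] at h
      rw [hcard]
      linarith
    · have h := (mul_le_mul_of_nonneg_right hC.C2_ge₂ hℓ.le).trans hN
      rw [div_mul_eq_mul_div, div_le_iff₀ (by positivity)] at h
      rw [hcard]
      have : 0 ≤ P.Keps * ℓ := mul_nonneg P.Keps_nonneg hℓ.le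
      linarith
  have hno : ∀ l : Fin q, μ.real {ω | ¬ |∑ s ∈ S, (X s ω).2.1 l * (X s ω).2.2| ≤
      √(4 * q * (P.zbar * P.ς) ^ 2 * ℓ * N)} ≤ 2 * Real.exp (-(2 * ℓ)) := by
    intro l
    simp only [not_le]
    refine hr.noise_tail hP hS l (by positivity) (by positivity) ?_
    rw [Real.sq_sqrt (by positivity), hcard]
    have : 0 ≤ (P.zbar * P.ς) ^ 2 * ℓ * N := by positivity
    nlinarith
  have h1 := measureReal_not_forall_le fun ik => measureReal_not_forall_le fun l => hvz ik l
  have h2 := measureReal_not_forall_le fun k => measureReal_not_forall_le fun l => hzz k l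
  have h3 := measureReal_not_forall_le fun l => hno l
  simp only [Fintype.card_fin, Fintype.card_prod] at h1 h2 h3
  refine le_trans (measureReal_mono fun ω hω => ?_) (measureReal_not_and_le h1
    (measureReal_not_and_le h2 (measureReal_not_and_le hma (measureReal_not_and_le hsq h3))))
  rw [Set.mem_ofPred_eq] at *
  exact fun h => hω ⟨h.1, h.2.1, by convert h.2.2.1, h.2.2.2.1, h.2.2.2.2⟩

lemma ae_regular : ∀ᵐ ω ∂μ, P.Regular T (fun s => X s ω) := by
  filter_upwards [hr.ae_of_law (hP.ae_exists_isOptArm hM), hr.ae_of_law hP.v_bdd,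
    hr.ae_of_law hP.z_bdd] with ω h1 h2 h3 using ⟨h1, h2, h3⟩

/-- The horizon dominates the squared number of instruments, because `η` is small. -/
lemma horizon_ge (hT2 : C2 * Real.log T ≤ (T2 : ℝ) - T1) (hTT : T2 < T) :
    400 * (q : ℝ) ^ 2 ≤ T := by
  have hη := hC.η_pos
  have hz := hP.zbar_pos
  have h1 : (T2 : ℝ) ≤ T := by exact_mod_cast hTT.le
  have h2 : (0 : ℝ) ≤ T1 := by positivity
  have h3 := hC.eta_le_zz hP hM
  have h4 := hP.phiMin_sigmaZZ_le hM
  have h5 : 10 * η ≤ P.zbar ^ 2 := by linarith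
  have h6 : 100 * η ^ 2 ≤ P.zbar ^ 4 := by nlinarith
  have h7 : 600 * (q : ℝ) ^ 2 ≤ 6 * q ^ 2 * P.zbar ^ 4 / η ^ 2 := by
    rw [le_div_iff₀ (by positivity)]
    have : 0 ≤ (q : ℝ) ^ 2 := by positivity
    nlinarith
  have h8 := log_two_le_log hT
  have h9 : 600 * (q : ℝ) ^ 2 * Real.log T ≤ C2 * Real.log T :=
    mul_le_mul_of_nonneg_right (h7.trans hC.C2_ge₅) (by linarith)
  have h10 : 600 * (q : ℝ) ^ 2 * (69 / 100) ≤ 600 * (q : ℝ) ^ 2 * Real.log T := by gcongr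
  have : 0 ≤ (q : ℝ) ^ 2 := by positivity
  linarith

/-- The number of periods times the probability that the run is not typical. The summand `2 q` comes
from the noise moments, which exceed their bounds with probability up to `2 / T ^ 2` each, in up to
`T` periods; all other events have probabilities of order `T ^ (-3)`. -/
lemma mul_measureReal_not_typical_le (hT1 : C1 * Real.log T ≤ T1)
    (hT2 : C2 * Real.log T ≤ (T2 : ℝ) - T1) (hTT : T1 ≤ T2) (hT2T : T2 < T) :
    T * μ.real {ω | ¬ P.Typical Lo η Δ T T1 T2 (fun s => X s ω) (fun s => a s ω)} ≤
      2 * q + 2 := by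
  have hT0 : (0 : ℝ) < T := by positivity
  have hq : (2 : ℝ) ≤ q := by exact_mod_cast hP.q_ge hM
  have hreg : μ.real {ω | ¬ P.Regular T (fun s => X s ω)} ≤ 0 := by
    have h := hr.ae_regular hC hP hM hLo hT
    rw [ae_iff] at h
    rw [Measure.real, h]; simp
  have hexp := hr.measureReal_not_exploreTypical_le hC hP hM hLo hT hT1 (hTT.trans hT2T.le)
  have hgr := measureReal_not_forall_mem_le (μ := μ) (s := Finset.Ioc T2 T) fun t ht => by
    rw [Finset.mem_Ioc] at ht
    have h1 : (T2 : ℝ) ≤ t := by exact_mod_cast ht.1.le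
    exact hr.measureReal_not_greedyTypical_le hC hP hM hLo hT (t := t) (by linarith)
      (by omega) ht.2
  have h1 := measureReal_not_and_le hreg (measureReal_not_and_le hexp hgr)
  have h2 : μ.real {ω | ¬ P.Typical Lo η Δ T T1 T2 (fun s => X s ω) (fun s => a s ω)} ≤ _ :=
    le_trans (measureReal_mono fun ω hω => by
      rw [Set.mem_ofPred_eq] at *
      exact fun h => hω ⟨h.1, h.2.1, h.2.2⟩) h1
  have h400 := hr.horizon_ge hC hP hM hLo hT hT2 hT2T
  have hMp : ((M * p : ℕ) : ℝ) ≤ q := by exact_mod_cast hP.enough_iv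
  have hMq : (M : ℝ) ≤ q := by
    exact_mod_cast (Nat.le_mul_of_pos_right M (hP.p_pos hM)).trans hP.enough_iv
  have hcard : ((Finset.Ioc T2 T).card : ℝ) ≤ T := by
    rw [Nat.card_Ioc]; exact_mod_cast Nat.sub_le T T2
  have he3 : Real.exp (-(3 * Real.log T)) = 1 / T ^ 3 := by
    rw [Real.exp_neg, mul_comm, Real.exp_mul, Real.exp_log hT0]
    norm_num
  have he2 : Real.exp (-(2 * Real.log T)) = 1 / T ^ 2 := by
    rw [Real.exp_neg, mul_comm, Real.exp_mul, Real.exp_log hT0]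
    norm_num
  rw [he3, he2] at h2
  push_cast at h2 hMp
  set R : ℝ := (T : ℝ) with hR
  have hb1 : (M : ℝ) * (p * (q * (2 * (1 / R ^ 3)))) ≤ q * (q * (2 * (1 / R ^ 3))) := by
    rw [← mul_assoc]; gcongr
  have hb2 : (M : ℝ) * (q * (q * (2 * (1 / R ^ 3)))) ≤ q * (q * (q * (2 * (1 / R ^ 3)))) := by
    gcongr
  have hb3 : (M : ℝ) * (q * (2 * (1 / R ^ 3))) ≤ q * (q * (2 * (1 / R ^ 3))) := by gcongr
  have hb4 : (M : ℝ) * p * (q * (2 * (1 / R ^ 3))) ≤ q * (q * (2 * (1 / R ^ 3))) := by gcongr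
  have hb5 : ((Finset.Ioc T2 T).card : ℝ) * ((M : ℝ) * p * (q * (2 * (1 / R ^ 3))) +
      (q * (q * (2 * (1 / R ^ 3))) + (2 * (1 / R ^ 3) + (1 / R ^ 3 + q * (2 * (1 / R ^ 2)))))) ≤
      R * (q * (q * (2 * (1 / R ^ 3))) +
      (q * (q * (2 * (1 / R ^ 3))) + (2 * (1 / R ^ 3) + (1 / R ^ 3 + q * (2 * (1 / R ^ 2)))))) := by
    gcongr
  calc R * _ ≤ R * (q * (q * (2 * (1 / R ^ 3))) + (q * (q * (q * (2 * (1 / R ^ 3)))) +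
        q * (q * (2 * (1 / R ^ 3)))) + R * (q * (q * (2 * (1 / R ^ 3))) +
      (q * (q * (2 * (1 / R ^ 3))) +
        (2 * (1 / R ^ 3) + (1 / R ^ 3 + q * (2 * (1 / R ^ 2))))))) := by
        refine mul_le_mul_of_nonneg_left ?_ hT0.le
        linarith
    _ = 2 * q + (2 * q ^ 3 + 4 * q ^ 2) / R ^ 2 + (4 * q ^ 2 + 3) / R := by
      field_simp; ring
    _ ≤ 2 * q + 1 + 1 := by
      gcongr
      · rw [div_le_one (by positivity)]
        have h3 := pow_le_pow_left₀ (by positivity) h400 2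
        have h4 : (0 : ℝ) ≤ q ^ 2 * (q - 2) := mul_nonneg (by positivity) (by linarith)
        have h5 : (0 : ℝ) ≤ q ^ 3 * (q - 2) := mul_nonneg (by positivity) (by linarith)
        have h6 : (0 : ℝ) ≤ q ^ 4 := by positivity
        linarith
      · rw [div_le_one hT0]
        nlinarith
    _ = _ := by ring

end IsRun

end IVModel

/-! ### The regret -/

/-- Comparison of the partial sums of the harmonic series with the logarithm. -/
lemma sum_one_div_le_log {c : ℝ} {m T : ℕ} (hm : 1 ≤ (m : ℝ) - 1 - c) (hT : m ≤ T) :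
    ∑ t ∈ Finset.Ioc m T, 1 / ((t : ℝ) - 1 - c) ≤ Real.log ((T : ℝ) - 1 - c) := by
  induction T, hT using Nat.le_induction with
  | base => simpa using Real.log_nonneg hm
  | succ n hn ih =>
    have hn' : (m : ℝ) ≤ n := by exact_mod_cast hn
    rw [Finset.sum_Ioc_succ_top (by omega)]
    push_cast
    rw [add_sub_cancel_right]
    have h1 : 0 < (n : ℝ) - 1 - c := by linarith
    have h2 : 0 < (n : ℝ) - c := by linarith
    have h3 := Real.log_le_sub_one_of_pos (div_pos h1 h2)
    rw [Real.log_div h1.ne' h2.ne'] at h3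
    have h4 : ((n : ℝ) - 1 - c) / (n - c) - 1 = -(1 / ((n : ℝ) - c)) := by
      field_simp; ring
    linarith

namespace IVModel

variable {M p q : ℕ} {P : IVModel M p q}

lemma oracleReward_sub_reward {x : Obs p q} {i : Fin M} (hi : P.IsOptArm x.1 i) (j : Fin M) :
    P.oracleReward x - P.reward x j = x.1 ⬝ᵥ (P.α i - P.α j) := by
  rw [oracleReward, reward, hi.iSup_eq, dotProduct_sub]; ring

lemma le_deltaBar (i j : Fin M) : euclNorm (P.α i - P.α j) ≤ P.deltaBar := by
  rw [euclNorm_eq]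
  exact le_ciSup (f := fun ij : Fin M × Fin M => ‖WithLp.toLp 2 (P.α ij.1 - P.α ij.2)‖)
    (Set.finite_range _).bddAbove (i, j)

lemma deltaBar_nonneg : 0 ≤ P.deltaBar := Real.iSup_nonneg fun _ => norm_nonneg _

lemma gap_le_deltaBar (hv : 0 ≤ P.vbar) {v : Fin p → ℝ} (h : ∀ k, |v k| ≤ P.vbar) (i j : Fin M) :
    v ⬝ᵥ (P.α i - P.α j) ≤ √p * P.vbar * P.deltaBar := by
  have h1 := euclNorm_le_of_abs_le hv h
  rw [Fintype.card_fin] at h1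
  exact (le_abs_self _).trans ((abs_dotProduct_le _ _).trans
    (mul_le_mul h1 (le_deltaBar i j) (euclNorm_nonneg _) (by positivity)))

lemma measurable_oracleReward : Measurable fun x : Obs p q => P.oracleReward x := by
  unfold oracleReward
  exact (Measurable.iSup fun i => measurable_dotProduct_const measurable_fst (P.α i)).add
    (by fun_prop)

lemma measurable_reward : Measurable fun y : Obs p q × Fin M => P.reward y.1 y.2 := by
  refine measurable_from_prod_countable_left fun i => ?_
  exact (measurable_dotProduct_const measurable_fst (P.α i)).add (by fun_prop)

variable {Ω : Type*} [MeasurableSpace Ω] {μ : Measure Ω} [IsProbabilityMeasure μ]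
  {θ Lo CA η Δ C1 C2 : ℝ} {T1 T2 T : ℕ} {X : ℕ → Ω → Obs p q} {a : ℕ → Ω → Fin M}

namespace IsRun

variable (hr : P.IsRun θ T1 T2 T μ X a) (hP : P.Assumption) (hM : 2 ≤ M)
include hr hP hM

lemma measurable_regret {t : ℕ} (ht : t ∈ Finset.Icc 1 T) :
    Measurable fun ω => P.oracleReward (X t ω) - P.reward (X t ω) (a t ω) :=
  (P.measurable_oracleReward.comp (hr.measurable_X t ht)).sub
    (P.measurable_reward.comp ((hr.measurable_X t ht).prodMk (hr.measurable_a t ht)))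

lemma ae_regret_mem {t : ℕ} (ht : t ∈ Finset.Icc 1 T) :
    ∀ᵐ ω ∂μ, 0 ≤ P.oracleReward (X t ω) - P.reward (X t ω) (a t ω) ∧
      P.oracleReward (X t ω) - P.reward (X t ω) (a t ω) ≤ √p * P.vbar * P.deltaBar := by
  filter_upwards [hr.ae_of_law (hP.ae_exists_isOptArm hM), hr.ae_of_law hP.v_bdd] with ω h1 h2
  obtain ⟨i, hi⟩ := h1 t ht
  rw [oracleReward_sub_reward hi]
  refine ⟨?_, gap_le_deltaBar hP.vbar_pos.le (h2 t ht) _ _⟩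
  rw [dotProduct_sub, sub_nonneg]
  exact hi.le _

lemma integrable_regret {t : ℕ} (ht : t ∈ Finset.Icc 1 T) :
    Integrable (fun ω => P.oracleReward (X t ω) - P.reward (X t ω) (a t ω)) μ := by
  refine Integrable.of_bound (hr.measurable_regret hP hM ht).aestronglyMeasurable
    (√p * P.vbar * P.deltaBar) ?_
  filter_upwards [hr.ae_regret_mem hP hM ht] with ω h
  rw [Real.norm_eq_abs, abs_of_nonneg h.1]
  exact h.2

lemma integral_regret_nonneg {t : ℕ} (ht : t ∈ Finset.Icc 1 T) :
    0 ≤ ∫ ω, (P.oracleReward (X t ω) - P.reward (X t ω) (a t ω)) ∂μ :=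
  integral_nonneg_of_ae ((hr.ae_regret_mem hP hM ht).mono fun _ h => h.1)

lemma integral_regret_le {t : ℕ} (ht : t ∈ Finset.Icc 1 T) :
    ∫ ω, (P.oracleReward (X t ω) - P.reward (X t ω) (a t ω)) ∂μ ≤ √p * P.vbar * P.deltaBar := by
  have h := integral_mono_ae (hr.integrable_regret hP hM ht)
    (integrable_const (√p * P.vbar * P.deltaBar))
    ((hr.ae_regret_mem hP hM ht).mono fun _ h => h.2)
  simpa using h

lemma regret_nonneg : 0 ≤ P.regret T μ X a :=
  Finset.sum_nonneg fun _ ht => hr.integral_regret_nonneg hP hM ht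

/-- If wrong arms have gaps at most `w` on the event `A`, then `A` contributes at most
`(M - 1) * Lo * w ^ 2` to the regret of a period: a gap at most `w` must occur, and then costs at
most `w`. -/
lemma integral_regret_le_of_gap (hLo : P.IsOptMargin Lo) {t : ℕ} (ht : t ∈ Finset.Icc 1 T)
    {w : ℝ} (hw : 0 < w) {A : Ω → Prop}
    (h : ∀ ω, A ω → ∀ i, i ≠ a t ω → (X t ω).1 ⬝ᵥ (P.α i - P.α (a t ω)) ≤ w) :
    ∫ ω, (P.oracleReward (X t ω) - P.reward (X t ω) (a t ω)) ∂μ ≤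
      ((M : ℝ) - 1) * Lo * w ^ 2 + √p * P.vbar * P.deltaBar * μ.real {ω | ¬ A ω} := by
  set B := √p * P.vbar * P.deltaBar with hB
  have hB0 : 0 ≤ B := by
    have := hP.vbar_pos
    have := P.deltaBar_nonneg
    positivity
  set D := toMeasurable μ {ω | ¬ A ω} with hD
  have hDm : MeasurableSet D := measurableSet_toMeasurable _ _
  set S : Fin M → Fin M → Set Ω := fun i j =>
    {ω | X t ω ∈ {x : Obs p q | P.IsOptArm x.1 i ∧ |x.1 ⬝ᵥ (P.α j - P.α i)| ≤ w}} with hS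
  have hSm : ∀ i j, MeasurableSet (S i j) := fun i j =>
    hr.measurable_X t ht (measurableSet_near i j w)
  have hint1 : ∀ i j, Integrable ((S i j).indicator fun _ => w) μ := fun i j =>
    (integrable_const w).indicator (hSm i j)
  have hint2 : Integrable (D.indicator fun _ => B) μ := (integrable_const B).indicator hDm
  have hint3 : Integrable (fun ω => ∑ i, ∑ j ∈ Finset.univ.erase i,
      (S i j).indicator (fun _ => w) ω) μ :=
    integrable_finsetSum _ fun i _ => integrable_finsetSum _ fun j _ => hint1 i j
  have hle : ∀ᵐ ω ∂μ, P.oracleReward (X t ω) - P.reward (X t ω) (a t ω) ≤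
      ∑ i, ∑ j ∈ Finset.univ.erase i, (S i j).indicator (fun _ => w) ω +
        D.indicator (fun _ => B) ω := by
    filter_upwards [hr.ae_regret_mem hP hM ht, hr.ae_of_law (hP.ae_exists_isOptArm hM)]
      with ω h1 h2
    have hnn : ∀ i j, 0 ≤ (S i j).indicator (fun _ => w) ω := fun i j =>
      Set.indicator_nonneg (fun _ _ => hw.le) _
    have hnn1 : 0 ≤ ∑ i, ∑ j ∈ Finset.univ.erase i, (S i j).indicator (fun _ => w) ω :=
      Finset.sum_nonneg fun i _ => Finset.sum_nonneg fun j _ => hnn i j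
    have hnn2 : 0 ≤ D.indicator (fun _ => B) ω := Set.indicator_nonneg (fun _ _ => hB0) _
    by_cases hA : A ω
    · obtain ⟨i, hi⟩ := h2 t ht
      rw [oracleReward_sub_reward hi]
      by_cases hia : i = a t ω
      · rw [← hia, sub_self, dotProduct_zero]
        linarith
      · have hgap := h ω hA i hia
        have hmem : ω ∈ S i (a t ω) := by
          rw [hS]
          refine ⟨hi, ?_⟩
          rw [← neg_sub (P.α i), dotProduct_neg, abs_neg,
            abs_of_pos (hi _ (Ne.symm hia))]
          exact hgap
        have h3 : w ≤ ∑ i, ∑ j ∈ Finset.univ.erase i, (S i j).indicator (fun _ => w) ω := by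
          have h4 := Finset.single_le_sum (f := fun i => ∑ j ∈ Finset.univ.erase i,
            (S i j).indicator (fun _ => w) ω) (fun i _ => Finset.sum_nonneg fun j _ => hnn i j)
            (Finset.mem_univ i)
          have h5 := Finset.single_le_sum (f := fun j => (S i j).indicator (fun _ => w) ω)
            (fun j _ => hnn i j)
            (Finset.mem_erase.2 ⟨Ne.symm hia, Finset.mem_univ (a t ω)⟩)
          simp only [Set.indicator_of_mem hmem] at h5
          exact h5.trans h4
        linarith
    · have : ω ∈ D := subset_toMeasurable _ _ hA
      rw [Set.indicator_of_mem this]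
      linarith [h1.2]
  refine (integral_mono_ae (hr.integrable_regret hP hM ht) (hint3.add hint2) hle).trans ?_
  simp only [Pi.add_apply]
  rw [integral_add hint3 hint2, integral_indicator_const _ hDm]
  rw [integral_finsetSum _ fun i _ => integrable_finsetSum _ fun j _ => hint1 i j]
  have h1 : ∀ i : Fin M, ∫ ω, ∑ j ∈ Finset.univ.erase i, (S i j).indicator (fun _ => w) ω ∂μ =
      (∑ j ∈ Finset.univ.erase i,
        P.law.real {x : Obs p q | P.IsOptArm x.1 i ∧ |x.1 ⬝ᵥ (P.α j - P.α i)| ≤ w}) * w := by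
    intro i
    rw [integral_finsetSum _ fun j _ => hint1 i j, Finset.sum_mul]
    refine Finset.sum_congr rfl fun j _ => ?_
    rw [integral_indicator_const _ (hSm i j), smul_eq_mul,
      hr.measureReal_preimage ht (measurableSet_near i j w)]
  simp only [h1]
  rw [← Finset.sum_mul, smul_eq_mul, Measure.real, measure_toMeasurable, mul_comm _ B]
  have h2 := mul_le_mul_of_nonneg_right (hLo w hw) hw.le
  change _ + B * μ.real _ ≤ _
  linarith

end IsRun

namespace IsRun

variable (hr : P.IsRun θ T1 T2 T μ X a) (hC : P.ConstantsOK θ (1 / 256) Lo CA η Δ C1 C2)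
  (hP : P.Assumption) (hM : 2 ≤ M) (hθ : 0 < θ) (hLo : P.IsOptMargin Lo)
include hr hC hP hM hθ hLo

lemma regret_le_of_two_le (hT : 2 ≤ T) (hT1 : C1 * Real.log T ≤ T1)
    (hT2 : C2 * Real.log T ≤ (T2 : ℝ) - T1) (hTT : T1 ≤ T2) (hT2T : T2 < T) :
    P.regret T μ X a ≤
      4 * Lo * p * P.vbar ^ 2 * ((M : ℝ) - 1) * P.ucbFactor θ CA Δ ^ 2 * Real.log T ^ 2 +
        √p * P.vbar * P.deltaBar * (T2 + 1) + √p * P.vbar * P.deltaBar * (2 * q + 2) := by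
  have hv := hP.vbar_pos
  have hη := hC.η_pos
  have hp : (0 : ℝ) < p := by exact_mod_cast hP.p_pos hM
  have hℓ : 0 < Real.log T := Real.log_pos (by exact_mod_cast hT)
  have hLo0 := hP.optMargin_pos hM hLo
  have hΓ := ucbFactor_pos hP hM hθ (hC.CA_nonneg hP hM) hC.Δ_pos
  have hM1 : (1 : ℝ) ≤ (M : ℝ) - 1 := by
    have : (2 : ℝ) ≤ M := by exact_mod_cast hM
    linarith
  have hq : (0 : ℝ) < q := by have := hP.q_ge hM; positivity
  have hC1 : 0 < C1 := by
    refine lt_of_lt_of_le ?_ hC.C1_ge₁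
    have h1 := hP.zbar_pos
    have h2 := lt_min (hP.phiMin_sigmaVZBreve_pos hM) (hP.phiMin_sigmaZZBreve_pos hM)
    have h3 : 0 < max (√(p * q) * P.vbar * P.zbar) (q * P.zbar ^ 2) :=
      lt_max_of_lt_right (by positivity)
    positivity
  have hT1' : 0 < T1 := by
    have : (0 : ℝ) < T1 := lt_of_lt_of_le (by positivity) hT1
    exact_mod_cast this
  have hC2 : 0 < C2 := by
    refine lt_of_lt_of_le ?_ hC.C2_ge₅
    have h1 := hP.zbar_pos
    positivity
  have hT12 : (T1 : ℝ) + 1 ≤ T2 := by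
    have h1 : (T1 : ℝ) < T2 := by
      have : 0 < C2 * Real.log T := by positivity
      linarith
    have h2 : T1 < T2 := by exact_mod_cast h1
    exact_mod_cast h2
  set B := √p * P.vbar * P.deltaBar with hB
  have hB0 : 0 ≤ B := by
    have := P.deltaBar_nonneg
    positivity
  set β := μ.real {ω | ¬ P.Typical Lo η Δ T T1 T2 (fun s => X s ω) (fun s => a s ω)} with hβ
  have hβ0 : 0 ≤ β := measureReal_nonneg
  set G := 4 * Lo * p * P.vbar ^ 2 * ((M : ℝ) - 1) * P.ucbFactor θ CA Δ ^ 2 with hG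
  have hlate : ∀ t ∈ Finset.Ioc (T2 + 1) T,
      ∫ ω, (P.oracleReward (X t ω) - P.reward (X t ω) (a t ω)) ∂μ ≤
        G * Real.log T * (1 / ((t : ℝ) - 1 - T1)) + B * β := by
    intro t ht
    rw [Finset.mem_Ioc] at ht
    have htc : ((t - 1 : ℕ) : ℝ) = (t : ℝ) - 1 := by rw [Nat.cast_sub (by omega)]; simp
    have htr : (T2 : ℝ) + 2 ≤ t := by exact_mod_cast (by omega : T2 + 2 ≤ t)
    have hN : 0 < (t : ℝ) - 1 - T1 := by linarith
    have hw : 0 < P.ucbWidth θ CA Δ T (((t - 1 : ℕ) : ℝ) - T1) := by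
      rw [htc]; unfold ucbWidth; positivity
    have h1 := hr.integral_regret_le_of_gap hP hM hLo (t := t)
      (Finset.mem_Icc.2 ⟨by omega, ht.2⟩) hw
      (A := fun ω => P.Typical Lo η Δ T T1 T2 (fun s => X s ω) (fun s => a s ω))
      fun ω hω i hi => gap_le_ucbWidth hC hP hM hθ hLo0 hT hT1' hTT hT2 hω
        (fun s hs i => hr.argmax_a s hs ω i) ht.1 ht.2 hi
    refine h1.trans_eq ?_
    congr 1
    rw [htc, ucbWidth, mul_pow, Real.sq_sqrt (by positivity), mul_pow, mul_pow, mul_pow,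
      Real.sq_sqrt hp.le, hG]
    ring
  rw [regret, ← Finset.sum_filter_add_sum_filter_not (Finset.Icc 1 T) (fun t => t ≤ T2 + 1)]
  have hs1 : (Finset.Icc 1 T).filter (fun t => t ≤ T2 + 1) = Finset.Icc 1 (T2 + 1) := by
    ext t; simp only [Finset.mem_filter, Finset.mem_Icc]; omega
  have hs2 : (Finset.Icc 1 T).filter (fun t => ¬ t ≤ T2 + 1) = Finset.Ioc (T2 + 1) T := by
    ext t; simp only [Finset.mem_filter, Finset.mem_Icc, Finset.mem_Ioc]; omega
  rw [hs1, hs2]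
  have h1 : ∑ t ∈ Finset.Icc 1 (T2 + 1),
      ∫ ω, (P.oracleReward (X t ω) - P.reward (X t ω) (a t ω)) ∂μ ≤ B * (T2 + 1) := by
    refine (Finset.sum_le_card_nsmul _ _ B fun t ht => hr.integral_regret_le hP hM ?_).trans_eq ?_
    · rw [Finset.mem_Icc] at *; omega
    · rw [nsmul_eq_mul, Nat.card_Icc, Nat.add_sub_cancel]; push_cast; ring
  have h2 := Finset.sum_le_sum hlate
  rw [Finset.sum_add_distrib, ← Finset.mul_sum, Finset.sum_const, nsmul_eq_mul] at h2
  have h3 := sum_one_div_le_log (c := T1) (m := T2 + 1) (T := T) (by push_cast; linarith)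
    (by omega)
  have h4 : Real.log ((T : ℝ) - 1 - T1) ≤ Real.log T := by
    have : (T2 : ℝ) + 1 ≤ T := by exact_mod_cast hT2T
    have : (0 : ℝ) ≤ T1 := by positivity
    exact Real.log_le_log (by linarith) (by linarith)
  have h5 : G * Real.log T * ∑ t ∈ Finset.Ioc (T2 + 1) T, 1 / ((t : ℝ) - 1 - T1) ≤
      G * Real.log T * Real.log T := mul_le_mul_of_nonneg_left (h3.trans h4) (by positivity)
  have h6 : ((Finset.Ioc (T2 + 1) T).card : ℝ) * (B * β) ≤ B * (2 * q + 2) := by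
    have h7 := hr.mul_measureReal_not_typical_le hC hP hM hLo hT hT1 hT2 hTT hT2T
    have h8 : ((Finset.Ioc (T2 + 1) T).card : ℝ) ≤ T := by
      rw [Nat.card_Ioc]; exact_mod_cast Nat.sub_le _ _
    calc _ ≤ (T : ℝ) * (B * β) := by gcongr
      _ = B * (T * β) := by ring
      _ ≤ _ := mul_le_mul_of_nonneg_left h7 hB0
  rw [sq (Real.log T), ← mul_assoc]
  linarith

/-- The explicit regret bound. -/
lemma regret_le (hT1 : C1 * Real.log T ≤ T1)
    (hT2 : C2 * Real.log T ≤ (T2 : ℝ) - T1) (hTT : T1 ≤ T2) (hT2T : T2 < T) :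
    P.regret T μ X a ≤
      4 * Lo * p * P.vbar ^ 2 * ((M : ℝ) - 1) * P.ucbFactor θ CA Δ ^ 2 * Real.log T ^ 2
        + √p * P.vbar * P.deltaBar * T2
        + √p * P.vbar * P.deltaBar *
          (((M : ℝ) - 1) * (24 * M * p + (40 * M + 48) * q + 16) + 1) := by
  have hB0 : 0 ≤ √p * P.vbar * P.deltaBar := by
    have := hP.vbar_pos
    have := P.deltaBar_nonneg
    positivity
  have hM' : (2 : ℝ) ≤ M := by exact_mod_cast hM
  have hc : (2 * q + 2 : ℝ) ≤ ((M : ℝ) - 1) * (24 * M * p + (40 * M + 48) * q + 16) := by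
    have h1 : (0 : ℝ) ≤ M * p := by positivity
    have h2 : (0 : ℝ) ≤ M * q := by positivity
    have h3 : (0 : ℝ) ≤ q := by positivity
    have h4 : (0 : ℝ) ≤ 24 * M * p + (40 * M + 48) * q + 16 := by positivity
    nlinarith
  rcases Nat.lt_or_ge T 2 with h | hT
  · -- a horizon of one period, where `log T = 0` and only the constant term is left
    obtain rfl : T = 1 := by omega
    have h1 := hr.integral_regret_le hP hM (t := 1) (by simp)
    have h2 : (0 : ℝ) ≤ T2 := by positivity
    have h3 : (0 : ℝ) ≤ q := by positivity
    simp only [regret, Finset.Icc_self, Finset.sum_singleton, Nat.cast_one, Real.log_one]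
    have h4 := mul_le_mul_of_nonneg_left hc hB0
    have h5 := mul_nonneg hB0 h2
    have h6 := mul_nonneg hB0 h3
    linarith
  · have h1 := hr.regret_le_of_two_le hC hP hM hθ hLo hT hT1 hT2 hTT hT2T
    have h2 := mul_le_mul_of_nonneg_left hc hB0
    linarith

end IsRun

end IVModel

/-! ### Admissible constants -/

namespace IVModel

variable {M p q : ℕ} {P : IVModel M p q} {θ cB Lo CA η Δ C1 C2 : ℝ}

lemma ConstantsOK.mono (h : P.ConstantsOK θ cB Lo CA η Δ C1 C2) {C1' C2' : ℝ} (h1 : C1 ≤ C1')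
    (h2 : C2 ≤ C2') : P.ConstantsOK θ cB Lo CA η Δ C1' C2' where
  η_pos := h.η_pos
  η_le := h.η_le
  Δ_pos := h.Δ_pos
  CA_ge := h.CA_ge
  C1_ge₁ := h.C1_ge₁.trans h1
  C1_ge₂ := h.C1_ge₂.trans h1
  C2_ge₁ := h.C2_ge₁.trans h2
  C2_ge₂ := h.C2_ge₂.trans h2
  C2_ge₃ := h.C2_ge₃.trans h2
  C2_ge₄ := h.C2_ge₄.trans h2
  C2_ge₅ := h.C2_ge₅.trans h2
  C2_ge₆ := h.C2_ge₆.trans h2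
  C2_ge₇ := h.C2_ge₇.trans h2

lemma exists_constantsOK (hη : 0 < η) (hη' : η ≤ 1 / 10 * min (phiMin P.SigmaVZStar)
    (phiMin P.SigmaZZ)) (hΔ : 0 < Δ) (hCA : 2 * q * P.zbar * P.ς * P.kappaBar ≤ CA)
    (θ cB Lo : ℝ) : ∃ C1 C2, P.ConstantsOK θ cB Lo CA η Δ C1 C2 :=
  ⟨max _ _, max (max (max _ _) (max _ _)) (max (max _ _) _),
    { η_pos := hη
      η_le := hη'
      Δ_pos := hΔ
      CA_ge := hCA
      C1_ge₁ := le_max_left _ _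
      C1_ge₂ := le_max_right _ _
      C2_ge₁ := ((le_max_left _ _).trans (le_max_left _ _)).trans (le_max_left _ _)
      C2_ge₂ := ((le_max_right _ _).trans (le_max_left _ _)).trans (le_max_left _ _)
      C2_ge₃ := ((le_max_left _ _).trans (le_max_right _ _)).trans (le_max_left _ _)
      C2_ge₄ := ((le_max_right _ _).trans (le_max_right _ _)).trans (le_max_left _ _)
      C2_ge₅ := ((le_max_left _ _).trans (le_max_left _ _)).trans (le_max_right _ _)
      C2_ge₆ := ((le_max_right _ _).trans (le_max_left _ _)).trans (le_max_right _ _)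
      C2_ge₇ := (le_max_right _ _).trans (le_max_right _ _) }⟩

end IVModel

end

theorem theorem2 :
    -- the absolute constant of Bernstein's inequality for sub-exponential variables
    ∃ cB : ℝ, 0 < cB ∧
    ∀ (M p q : ℕ) (P : IVModel M p q) (θ : ℝ), 2 ≤ M → P.Assumption → 0 < θ →
      -- the order of the regret
      (∃ c1 c2 : ℝ, ∀ C1 C2 : ℝ, c1 ≤ C1 → c2 ≤ C2 → ∃ K : ℝ,
        ∀ T T1 T2 : ℕ, 2 ≤ T → |(T1 : ℝ) - C1 * Real.log T| ≤ 1 →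
          |(T2 : ℝ) - (C1 + C2) * Real.log T| ≤ 1 → T1 ≤ T2 → T2 < T →
        ∀ (Ω : Type*) [MeasurableSpace Ω] (μ : Measure Ω) [IsProbabilityMeasure μ]
          (X : ℕ → Ω → Obs p q) (a : ℕ → Ω → Fin M), P.IsRun θ T1 T2 T μ X a →
          |P.regret T μ X a| ≤ K * Real.log T ^ 2) ∧
      -- the explicit bound
      (∀ Lo CA η Δ C1 C2 : ℝ, P.IsOptMargin Lo → P.ConstantsOK θ cB Lo CA η Δ C1 C2 →
        ∀ T T1 T2 : ℕ, C1 * Real.log T ≤ T1 → C2 * Real.log T ≤ (T2 : ℝ) - T1 →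
          T1 ≤ T2 → T2 < T →
        ∀ (Ω : Type*) [MeasurableSpace Ω] (μ : Measure Ω) [IsProbabilityMeasure μ]
          (X : ℕ → Ω → Obs p q) (a : ℕ → Ω → Fin M), P.IsRun θ T1 T2 T μ X a →
          (∀ t ∈ Finset.Icc 1 T, Integrable
            (fun ω => P.oracleReward (X t ω) - P.reward (X t ω) (a t ω)) μ) ∧
          P.regret T μ X a ≤
            4 * Lo * p * P.vbar ^ 2 * ((M : ℝ) - 1) * P.ucbFactor θ CA Δ ^ 2 * Real.log T ^ 2
              + √p * P.vbar * P.deltaBar * T2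
              + √p * P.vbar * P.deltaBar *
                (((M : ℝ) - 1) * (24 * M * p + (40 * M + 48) * q + 16) + 1)) ∧
      -- the margin condition always provides the constant `M L / 2`, which is `L` if `M = 2`
      P.IsOptMargin (M * P.L / 2) := by
  refine ⟨1 / 256, by norm_num, fun M p q P θ hM hP hθ => ⟨?_, ?_, hP.isOptMargin hM⟩⟩
  · have hη : 0 < 1 / 10 * min (phiMin P.SigmaVZStar) (phiMin P.SigmaZZ) := by
      have := lt_min (hP.phiMin_sigmaVZStar_pos hM) (hP.phiMin_sigmaZZ_pos hM)
      positivity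
    set CA := 2 * q * P.zbar * P.ς * P.kappaBar with hCA
    set Lo := M * P.L / 2 with hLo
    obtain ⟨c1, c2, hc⟩ := IVModel.exists_constantsOK hη le_rfl one_pos hCA.ge θ (1 / 256) Lo
    -- the slack absorbs the rounding, as `log T ≥ log 2 > 1 / 2`
    refine ⟨c1 + 2, c2 + 4, fun C1 C2 hC1 hC2 => ?_⟩
    set B := √p * P.vbar * P.deltaBar with hB
    have hB0 : 0 ≤ B := by
      have := hP.vbar_pos
      have := P.deltaBar_nonneg
      positivity
    set D := ((M : ℝ) - 1) * (24 * M * p + (40 * M + 48) * q + 16) + 1 with hD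
    refine ⟨4 * Lo * p * P.vbar ^ 2 * ((M : ℝ) - 1) * P.ucbFactor θ CA 1 ^ 2 +
      B * (2 * |C1 + C2| + 3) + 3 * (B * D), ?_⟩
    intro T T1 T2 hT hT1 hT2 hTT hT2T Ω _ μ _ X a hr
    have hℓ := IVModel.log_two_le_log hT
    rw [abs_le] at hT1 hT2
    rw [abs_of_nonneg (hr.regret_nonneg hP hM)]
    have h1 := hr.regret_le (hc.mono (by linarith : c1 ≤ C1 - 2) (by linarith : c2 ≤ C2 - 4))
      hP hM hθ (hP.isOptMargin hM) (by linarith) (by linarith) hTT hT2T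
    set ℓ := Real.log T
    have hM' : (2 : ℝ) ≤ M := by exact_mod_cast hM
    have hD0 : 0 ≤ D := by
      have : (0 : ℝ) ≤ M - 1 := by linarith
      positivity
    have h2 : ℓ ≤ 2 * ℓ ^ 2 := by nlinarith
    have h3 : 1 ≤ 3 * ℓ ^ 2 := by nlinarith
    have h4 : (T2 : ℝ) ≤ (2 * |C1 + C2| + 3) * ℓ ^ 2 := by
      have h5 : (C1 + C2) * ℓ ≤ |C1 + C2| * (2 * ℓ ^ 2) :=
        mul_le_mul (le_abs_self _) h2 (by linarith) (abs_nonneg _)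
      linarith
    have h5 := mul_le_mul_of_nonneg_left h4 hB0
    have h6 := mul_le_mul_of_nonneg_left h3 (mul_nonneg hB0 hD0)
    linarith
  · intro Lo CA η Δ C1 C2 hLo hC T T1 T2 hT1 hT2 hTT hT2T Ω _ μ _ X a hr
    exact ⟨fun t ht => hr.integrable_regret hP hM ht,
      hr.regret_le hC hP hM hθ hLo hT1 hT2 hTT hT2T⟩
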